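/- Let $K$ be a non-archimedean local field with ring of integers $\mathcal O$, maximal ideal $\mathfrak m$, residue field of cardinality $q$, normalized absolute value $|\cdot|$ and uniformizer $\varpi$; put $\zeta(s)=(1-q^{-s})^{-1}$ and $G=\mathrm{PGL}_2$. Let $\psi:K\to\mathbb C^\times$ be a continuous unitary additive character of conductor $\mathcal O$ (that is, $\{x\in K:\psi(x\mathcal O)=1\}=\mathcal O$). Let $d^\times a$ be the Haar measure on $K^\times$ with $\mathrm{vol}(\mathcal O^\times)=1$, and fix any Haar measure on $G(K)$. Let $\chi,\eta:K^\times\to\mathbb C^\times$ be unramified characters with $\chi^2=\eta^2=1$. Let $\mathrm{St}=C^\infty(\mathbb P^1(K))/\mathbb C$ be the Steinberg representation of $G(K)$, let $\pi=\mathrm{St}_\chi=\mathrm{St}\otimes(\chi\circ\det)$, and let $\mathcal W$ be its Whittaker model with respect to $\psi$: the space of functions $W$ on $G(K)$ with $W\left(\begin{pmatrix}1&x\\0&1\end{pmatrix}g\right)=\psi(x)W(g)$, stable under right translation and isomorphic to $\pi$. The local factors are those of the Langlands parameter $\chi|\cdot|^{-1/2}\otimes\mathrm{sp}(2)$ of $\mathrm{St}_\chi$.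 For a Weil–Deligne representation $V$ with trivial action of inertia, geometric Frobenius $\Phi$ and monodromy $N$ one has $L(V,s)=\det(1-q^{-s}\Phi\mid\ker N)^{-1}$ and $\varepsilon(V,s,\psi)=\det(-q^{-s}\Phi\mid V/\ker N)$. For a character $\eta'\in\{\mathbf 1,\eta\}$ and a function $W$ on $G(K)$, let $\lambda^\natural(W,\eta',s)$ be the entire function of $s\in\mathbb C$ given, for $\mathrm{Re}(s)$ large, by $$\lambda^\natural(W,\eta',s)=\frac1{L(\pi\otimes\eta',s+\frac12)}\int_{K^\times}W\begin{pmatrix}a&\\&1\end{pmatrix}\eta'(a)|a|^s\,d^\times a ,$$ and let $$\theta^\natural(W,W')=\frac1{L(\pi\times\widetilde\pi,1)}\int_{K^\times}W\begin{pmatrix}a&\\&1\end{pmatrix}\overline{W'\begin{pmatrix}a&\\&1\end{pmatrix}}\,d^\times a .$$ For $f\in C_c^\infty(G(K))$ and $s_1,s_2\in\mathbb C$ the local spherical character is $$\mathbb J_\pi(f,s_1,s_2)=\sum_{\{W_i\}}\frac{\lambda^\natural(\pi(f)W_i,\mathbf 1,s_1+s_2)\,\lambda^\natural(\overline{W_i},\eta,s_1-s_2)}{\theta^\natural(W_i,W_i)},$$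 where $\{W_i\}$ is a $\theta^\natural$-orthogonal basis of $\mathcal W$. Let $\mathrm{Iw}\subset G(K)$ be the image of the matrices in $\mathrm{GL}_2(\mathcal O)$ whose lower left entry lies in $\mathfrak m$, and let $w=\begin{pmatrix}0&1\\-1&0\end{pmatrix}$. Then for all $s_1,s_2\in\mathbb C$ and every $\theta^\natural$-orthogonal basis of $\mathcal W$, the sums defining $\mathbb J_\pi(1_{\mathrm{Iw}},s_1,s_2)$ and $\mathbb J_\pi(1_{\mathrm{Iw}\cdot w},s_1,s_2)$ have only finitely many nonzero terms, and $$\mathbb J_\pi(1_{\mathrm{Iw}},s_1,s_2)=\mathrm{vol}(G(\mathcal O))\,\zeta(2)\,q^{-1},$$ $$\mathbb J_\pi(1_{\mathrm{Iw}\cdot w},s_1,s_2)=\mathrm{vol}(G(\mathcal O))\,\zeta(2)\,\varepsilon(\pi\otimes\eta,\tfrac12,\psi)\,q^{s_1-s_2-1}.$$ -/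

import Mathlib

open ValuativeRel MeasureTheory
open scoped MatrixGroups WithZero

namespace LocalSpherical

noncomputable section

/-! ### The projective linear group as a topological group -/

section Topology

variable {K : Type*} [Field K] [TopologicalSpace K]

/-- `PGL₂(K)` carries the quotient topology from `GL₂(K)`. -/
instance instTopologicalSpacePGL : TopologicalSpace PGL(2, K) :=
  inferInstanceAs (TopologicalSpace (GL (Fin 2) K ⧸ Subgroup.center (GL (Fin 2) K)))

instance instIsTopologicalGroupPGL [IsTopologicalRing K] : IsTopologicalGroup PGL(2, K) :=
  inferInstanceAs (IsTopologicalGroup (GL (Fin 2) K ⧸ Subgroup.center (GL (Fin 2) K)))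

end Topology

/-! ### The local field -/

section Field

variable (K : Type*) [Field K] [ValuativeRel K] [TopologicalSpace K]
  [IsNonarchimedeanLocalField K]

/-- The cardinality `q` of the residue field. -/
def resCard : ℕ := Nat.card 𝓀[K]

theorem resCard_pos : 0 < resCard K := Nat.card_pos

variable {K} in
/-- The normalized (surjective) valuation `v : Kˣ → ℤ`; a uniformizer has `v = 1`. -/
def ord (a : Kˣ) : ℤ :=
  - WithZero.log (IsNonarchimedeanLocalField.valueGroupWithZeroIsoInt K (valuation K (a : K)))

variable {K} in
/-- The normalized absolute value `|a| = q ^ (-v(a))`. -/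
def nabs (a : Kˣ) : ℝ := (resCard K : ℝ) ^ (-ord a)

theorem exists_ord_eq_one : ∃ a : Kˣ, ord a = 1 := by
  obtain ⟨γ, hγ⟩ :=
    (IsNonarchimedeanLocalField.valueGroupWithZeroIsoInt K).surjective (WithZero.exp (-1 : ℤ))
  obtain ⟨x, rfl⟩ := ValuativeRel.valuation_surjective γ
  have hx : x ≠ 0 := by
    rintro rfl
    rw [map_zero, map_zero] at hγ
    exact WithZero.exp_ne_zero hγ.symm
  refine ⟨Units.mk0 x hx, ?_⟩
  change - WithZero.log (IsNonarchimedeanLocalField.valueGroupWithZeroIsoInt K (valuation K x)) = 1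
  rw [show IsNonarchimedeanLocalField.valueGroupWithZeroIsoInt K (valuation K x) =
    WithZero.exp (-1 : ℤ) from hγ, WithZero.log_exp, neg_neg]

/-- A uniformizer. -/
def unif : Kˣ := (exists_ord_eq_one K).choose

theorem ord_unif : ord (unif K) = 1 := (exists_ord_eq_one K).choose_spec

variable {K}

/-- A character of `Kˣ` is unramified if it is trivial on the units of the ring of integers. -/
def IsUnramified (χ : Kˣ →* ℂˣ) : Prop := ∀ u : Kˣ, valuation K (u : K) = 1 → χ u = 1

/-- An additive character has conductor `𝒪[K]`: the largest fractional ideal on which it is trivial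
is the ring of integers. -/
def HasConductorIntegers (ψ : AddChar K Circle) : Prop :=
  ∀ x : K, (∀ y ∈ 𝒪[K], ψ (x * y) = 1) ↔ x ∈ 𝒪[K]

variable (K) in
/-- The local zeta function `ζ_K(s) = (1 - q^{-s})⁻¹`. -/
def localZeta (s : ℂ) : ℂ := (1 - (resCard K : ℂ) ^ (-s))⁻¹

end Field

/-! ### Elements and subsets of `PGL₂(K)` -/

section Group

variable {K : Type*} [Field K]

/-- The class of `diag(a, 1)`. -/
def torus (a : Kˣ) : PGL(2, K) :=
  Matrix.ProjGenLinGroup.mk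
    (Matrix.GeneralLinearGroup.mkOfDetNeZero !![(a : K), 0; 0, 1] (by simp))

/-- The class of `[1, x; 0, 1]`. -/
def unip (x : K) : PGL(2, K) :=
  Matrix.ProjGenLinGroup.mk
    (Matrix.GeneralLinearGroup.mkOfDetNeZero !![1, x; 0, 1] (by simp))

variable (K) in
/-- The class of the Weyl element `[0, 1; -1, 0]`. -/
def weyl : PGL(2, K) :=
  Matrix.ProjGenLinGroup.mk
    (Matrix.GeneralLinearGroup.mkOfDetNeZero !![0, 1; -1, 0] (by simp))

variable (K) in
/-- The upper triangular Borel subset of `PGL₂(K)`. -/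
def borelSet : Set PGL(2, K) :=
  Matrix.ProjGenLinGroup.mk '' {g : GL (Fin 2) K | (g : Matrix (Fin 2) (Fin 2) K) 1 0 = 0}

variable [ValuativeRel K]

variable (K) in
/-- `G(𝒪)`, as a subset of `G(K)`, for `G = PGL₂`. -/
def maxCompact : Set PGL(2, K) :=
  Set.range (Matrix.ProjGenLinGroup.map (n := Fin 2) (algebraMap 𝒪[K] K))

variable (K) in
/-- The standard Iwahori subgroup: the image of the matrices in `GL₂(𝒪)` whose lower left entry
lies in the maximal ideal. -/
def iwahori : Set PGL(2, K) :=
  (fun g : GL (Fin 2) 𝒪[K] =>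
      Matrix.ProjGenLinGroup.mk (Matrix.GeneralLinearGroup.map (algebraMap 𝒪[K] K) g)) ''
    {g | (g : Matrix (Fin 2) (Fin 2) 𝒪[K]) 1 0 ∈ 𝓂[K]}

variable (K) in
/-- The right translate `Iw · w`. -/
def iwahoriWeyl : Set PGL(2, K) := (fun g => g * weyl K) '' iwahori K

end Group

/-! ### The Steinberg representation and its quadratic twists -/

section Steinberg

variable (K : Type*) [Field K]

/-- The action of `PGL₂(K)` by right translation on all complex functions on `PGL₂(K)`. -/
def rightTranslation : Representation ℂ PGL(2, K) (PGL(2, K) → ℂ) where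
  toFun g :=
    { toFun := fun φ h => φ (h * g)
      map_add' := fun _ _ => rfl
      map_smul' := fun _ _ => rfl }
  map_one' := by ext; simp
  map_mul' g g' := by ext; simp [mul_assoc]

variable [TopologicalSpace K] [IsTopologicalRing K]

/-- The locally constant functions on `B \ G = ℙ¹(K)`, viewed as left `B`-invariant functions
on `G`. -/
def projLineFunctions : Submodule ℂ (PGL(2, K) → ℂ) where
  carrier := {φ | IsLocallyConstant φ ∧ ∀ b ∈ borelSet K, ∀ g, φ (b * g) = φ g}
  add_mem' := fun h h' => ⟨h.1.add h'.1, fun b hb g => by simp [h.2 b hb g, h'.2 b hb g]⟩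
  zero_mem' := ⟨IsLocallyConstant.const 0, fun _ _ _ => rfl⟩
  smul_mem' := fun c _ h => ⟨h.1.comp (fun z => c * z), fun b hb g => by simp [h.2 b hb g]⟩

theorem projLineFunctions_le_comap (g : PGL(2, K)) :
    projLineFunctions K ≤ (projLineFunctions K).comap (rightTranslation K g) := fun _ hφ =>
  ⟨hφ.1.comp_continuous (continuous_mul_const g), fun b hb h => by
    simpa [rightTranslation, mul_assoc] using hφ.2 b hb (h * g)⟩

/-- `C^∞(ℙ¹(K))` with `PGL₂(K)` acting by right translation. -/
def projLineRep : Representation ℂ PGL(2, K) (projLineFunctions K) :=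
  (rightTranslation K).subrepresentation (projLineFunctions K) (projLineFunctions_le_comap K)

/-- The constant functions in `C^∞(ℙ¹(K))`. -/
def constFunctions : Submodule ℂ (projLineFunctions K) where
  carrier := {φ | ∃ c : ℂ, ∀ g, (φ : PGL(2, K) → ℂ) g = c}
  add_mem' := by
    rintro φ φ' ⟨c, hc⟩ ⟨c', hc'⟩
    exact ⟨c + c', fun g => by simp [hc g, hc' g]⟩
  zero_mem' := ⟨0, fun _ => rfl⟩
  smul_mem' := by
    rintro a φ ⟨c, hc⟩
    exact ⟨a * c, fun g => by simp [hc g]⟩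

theorem constFunctions_le_comap (g : PGL(2, K)) :
    constFunctions K ≤ (constFunctions K).comap (projLineRep K g) := by
  rintro φ ⟨c, hc⟩
  exact ⟨c, fun h => hc (h * g)⟩

/-- The space `C^∞(ℙ¹(K)) / ℂ` of the Steinberg representation. -/
abbrev SteinbergSpace : Type _ := projLineFunctions K ⧸ constFunctions K

/-- The Steinberg representation of `PGL₂(K)`. -/
def steinberg : Representation ℂ PGL(2, K) (SteinbergSpace K) :=
  (projLineRep K).quotient (constFunctions K) (constFunctions_le_comap K)

variable {K}

/-- For a quadratic character `χ`, the character `χ ∘ det` of `PGL₂(K)`. -/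
def detChar (χ : Kˣ →* ℂˣ) (hχ : χ ^ 2 = 1) : PGL(2, K) →* ℂˣ :=
  Matrix.ProjGenLinGroup.lift (χ.comp Matrix.GeneralLinearGroup.det) (by
    ext u
    have h := DFunLike.congr_fun hχ u
    simp only [MonoidHom.pow_apply, MonoidHom.one_apply] at h
    have hd : Matrix.GeneralLinearGroup.det (Matrix.GeneralLinearGroup.scalar (Fin 2) u) = u ^ 2 := by
      ext
      simp [sq]
    simp [hd, h])

/-- The twist `St_χ = St ⊗ χ` of the Steinberg representation by a quadratic character. -/
def steinbergTwist (χ : Kˣ →* ℂˣ) (hχ : χ ^ 2 = 1) :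
    Representation ℂ PGL(2, K) (SteinbergSpace K) where
  toFun g := (detChar χ hχ g : ℂ) • steinberg K g
  map_one' := by simp
  map_mul' g g' := by
    rw [map_mul, map_mul, Units.val_mul, smul_mul_smul_comm]

end Steinberg

/-! ### Whittaker models -/

section Whittaker

variable {K : Type*} [Field K]

/-- `𝒲` is the `ψ`-Whittaker model of `ρ`: a space of functions `W` on `PGL₂(K)` with
`W([1, x; 0, 1] g) = ψ(x) W(g)`, stable under right translation and isomorphic to `ρ`. -/
structure IsWhittakerModel {V : Type*} [AddCommGroup V] [Module ℂ V] (ψ : AddChar K Circle)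
    (ρ : Representation ℂ PGL(2, K) V) (𝒲 : Subrepresentation (rightTranslation K)) : Prop where
  equivariant : ∀ W ∈ 𝒲.toSubmodule, ∀ (x : K) (g : PGL(2, K)), W (unip x * g) = ψ x * W g
  isoRep : Nonempty (ρ.Equiv 𝒲.toRepresentation)

end Whittaker

/-! ### Weil–Deligne representations with trivial inertia action; their `L`- and `ε`-factors -/

section WeilDeligne

variable (K : Type*) [Field K] [ValuativeRel K] [TopologicalSpace K]
  [IsNonarchimedeanLocalField K]

/-- A Weil–Deligne representation on which inertia acts trivially: a geometric Frobenius `Φ` and a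
nilpotent monodromy operator `N` with `Φ N Φ⁻¹ = q⁻¹ N`. -/
structure UnramWD (V : Type*) [AddCommGroup V] [Module ℂ V] where
  Φ : V ≃ₗ[ℂ] V
  N : Module.End ℂ V
  nilpotent : IsNilpotent N
  comm : ∀ v, N (Φ v) = (resCard K : ℂ) • Φ (N v)

namespace UnramWD

variable {K} {V : Type*} [AddCommGroup V] [Module ℂ V] (D : UnramWD K V)

theorem ker_le_comap : LinearMap.ker D.N ≤ (LinearMap.ker D.N).comap D.Φ.toLinearMap := by
  intro v hv
  have hv' : D.N v = 0 := hv
  change D.N (D.Φ v) = 0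
  rw [D.comm, hv', map_zero, smul_zero]

/-- `L(s, D) = det(1 - q^{-s} Φ | ker N)⁻¹`. -/
def LFactor (s : ℂ) : ℂ :=
  (LinearMap.det (1 - (resCard K : ℂ) ^ (-s) •
    D.Φ.toLinearMap.restrict (p := LinearMap.ker D.N) (q := LinearMap.ker D.N)
      D.ker_le_comap))⁻¹

/-- `ε(s, D, ψ) = det(-q^{-s} Φ | V / ker N)`, for an additive character `ψ` with conductor
`𝒪[K]` and the self-dual Haar measure. -/
def epsFactor (s : ℂ) : ℂ :=
  LinearMap.det (-((resCard K : ℂ) ^ (-s)) •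
    (LinearMap.ker D.N).mapQ (LinearMap.ker D.N) D.Φ.toLinearMap D.ker_le_comap)

/-- The twist of `D` by an unramified character `η`; uniformizers correspond to geometric
Frobenius elements. -/
def twist (η : Kˣ →* ℂˣ) : UnramWD K V where
  Φ := D.Φ.trans (LinearEquiv.smulOfUnit (η (unif K)))
  N := D.N
  nilpotent := D.nilpotent
  comm v := by
    change D.N ((η (unif K) : ℂ) • D.Φ v) =
      (resCard K : ℂ) • ((η (unif K) : ℂ) • D.Φ (D.N v))
    rw [map_smul, D.comm, smul_comm]

/-- The tensor product of `D` with its contragredient, realized on `End(V)`. -/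
def tensorDual : UnramWD K (Module.End ℂ V) where
  Φ := D.Φ.conj
  N := LinearMap.mulLeft ℂ D.N - LinearMap.mulRight ℂ D.N
  nilpotent := by
    refine Commute.isNilpotent_sub (LinearMap.commute_mulLeft_right (R := ℂ) D.N D.N) ?_ ?_
    · exact (LinearMap.isNilpotent_mulLeft_iff ℂ D.N).2 D.nilpotent
    · exact (LinearMap.isNilpotent_mulRight_iff ℂ D.N).2 D.nilpotent
  comm X := by
    have hs : ∀ v, D.Φ.symm (D.N v) = (resCard K : ℂ) • D.N (D.Φ.symm v) := by
      intro v
      apply D.Φ.injective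
      rw [map_smul, ← D.comm]
      simp
    ext v
    simp [LinearEquiv.conj_apply, D.comm, hs, smul_sub]

end UnramWD

variable {K} in
/-- The Weil–Deligne representation `χ|·|^{-1/2} ⊗ sp(2)` for unramified `χ`: the Langlands
parameter of `St ⊗ χ`. -/
def steinbergParam (χ : Kˣ →* ℂˣ) : UnramWD K (ℂ × ℂ) :=
  UnramWD.twist
    { Φ := LinearEquiv.prodCongr
        (LinearEquiv.smulOfNeZero ℂ ℂ ((√(resCard K : ℝ) : ℝ) : ℂ) (by
          exact_mod_cast (Real.sqrt_pos.2 (by exact_mod_cast resCard_pos K)).ne'))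
        (LinearEquiv.smulOfNeZero ℂ ℂ ((√(resCard K : ℝ) : ℝ) : ℂ)⁻¹ (inv_ne_zero (by
          exact_mod_cast (Real.sqrt_pos.2 (by exact_mod_cast resCard_pos K)).ne')))
      N := (LinearMap.inr ℂ ℂ ℂ).comp (LinearMap.fst ℂ ℂ ℂ)
      nilpotent := ⟨2, by ext <;> simp [pow_two]⟩
      comm := by
        rintro ⟨x, y⟩
        have h : ((√(resCard K : ℝ) : ℝ) : ℂ) ≠ 0 := by
          exact_mod_cast (Real.sqrt_pos.2 (by exact_mod_cast resCard_pos K)).ne'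
        have h2 : (resCard K : ℂ) = ((√(resCard K : ℝ) : ℝ) : ℂ) * ((√(resCard K : ℝ) : ℝ) : ℂ) := by
          rw [← Complex.ofReal_mul, Real.mul_self_sqrt (Nat.cast_nonneg _)]
          simp
        ext
        · simp
        · simp only [LinearMap.comp_apply, LinearMap.fst_apply, LinearMap.inr_apply,
            LinearEquiv.prodCongr_apply, LinearEquiv.smulOfNeZero_apply, smul_eq_mul,
            Prod.smul_mk]
          rw [h2]
          field_simp }
    χ

end WeilDeligne

/-! ### The local spherical character -/

section Spherical

variable {K : Type*} [Field K] [ValuativeRel K] [TopologicalSpace K]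
  [IsNonarchimedeanLocalField K]

/-- The operator `π(f)` on functions on `PGL₂(K)`, for right translation and the Haar
measure `μ`. -/
def hecke [MeasurableSpace PGL(2, K)] (μ : Measure PGL(2, K)) (f W : PGL(2, K) → ℂ) :
    PGL(2, K) → ℂ :=
  fun h => ∫ g, f g * W (h * g) ∂μ

/-- The integrand `W(diag(a, 1)) η(a) |a|^s`. -/
def torusIntegrand (η : Kˣ →* ℂˣ) (W : PGL(2, K) → ℂ) (s : ℂ) (a : Kˣ) : ℂ :=
  W (torus a) * (η a : ℂ) * (nabs a : ℂ) ^ s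

/-- `Λ` is the normalized zeta integral `s ↦ λ♮(W, η, s)`: the entire function of `s` that is given
by `L(s + 1/2)⁻¹ ∫ W(diag(a, 1)) η(a) |a|^s d^×a`, absolutely convergent, for `Re s` large. -/
def IsNormalizedPeriod [MeasurableSpace Kˣ] (ν : Measure Kˣ) (L : ℂ → ℂ) (η : Kˣ →* ℂˣ)
    (W : PGL(2, K) → ℂ) (Λ : ℂ → ℂ) : Prop :=
  Differentiable ℂ Λ ∧ ∃ σ : ℝ, ∀ s : ℂ, σ < s.re →
    Integrable (torusIntegrand η W s) ν ∧
      Λ s = (L (s + 1 / 2))⁻¹ * ∫ a, torusIntegrand η W s a ∂ν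

open Classical in
/-- The value `λ♮(W, η, s)`, defined by analytic continuation from `Re s` large; here `L` stands
for the function `s ↦ L(π ⊗ η, s)`. -/
def period [MeasurableSpace Kˣ] (ν : Measure Kˣ) (L : ℂ → ℂ) (η : Kˣ →* ℂˣ)
    (W : PGL(2, K) → ℂ) (s : ℂ) : ℂ :=
  if h : ∃ Λ : ℂ → ℂ, IsNormalizedPeriod ν L η W Λ then h.choose s else 0

/-- The normalized inner product
`θ♮(W, W') = L(π × π~, 1)⁻¹ ∫ W(diag(a, 1)) conj(W'(diag(a, 1))) d^×a`;
here `L₁` stands for `L(π × π~, 1)`. -/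
def innerForm [MeasurableSpace Kˣ] (ν : Measure Kˣ) (L₁ : ℂ) (W W' : PGL(2, K) → ℂ) : ℂ :=
  L₁⁻¹ * ∫ a : Kˣ, W (torus a) * (starRingEnd ℂ) (W' (torus a)) ∂ν

variable {V : Type*} [AddCommGroup V] [Module ℂ V] {ι : Type*}

/-- The basis `b` of a Whittaker model is orthogonal for `θ♮`; `D` is the Langlands parameter
of `π`. -/
def IsOrthogonalBasis [MeasurableSpace Kˣ] (ν : Measure Kˣ) (D : UnramWD K V)
    {𝒲 : Subrepresentation (rightTranslation K)} (b : Module.Basis ι ℂ 𝒲.toSubmodule) : Prop :=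
  ∀ i j, i ≠ j → innerForm ν (D.tensorDual.LFactor 1) (b i : PGL(2, K) → ℂ) (b j) = 0

/-- The summand, at the vector `W`, of the local spherical character of a representation `π` with
Langlands parameter `D`:
`λ♮(π(f) W, 1, s₁ + s₂) λ♮(conj W, η, s₁ - s₂) / θ♮(W, W)`. -/
def sphericalTerm [MeasurableSpace Kˣ] [MeasurableSpace PGL(2, K)] (ν : Measure Kˣ)
    (μ : Measure PGL(2, K)) (D : UnramWD K V) (η : Kˣ →* ℂˣ) (f : PGL(2, K) → ℂ) (s₁ s₂ : ℂ)
    (W : PGL(2, K) → ℂ) : ℂ :=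
  period ν D.LFactor 1 (hecke μ f W) (s₁ + s₂) *
      period ν (D.twist η).LFactor η (fun g => (starRingEnd ℂ) (W g)) (s₁ - s₂) /
    innerForm ν (D.tensorDual.LFactor 1) W W

/-- The local spherical character `𝕁_π(f, s₁, s₂)` takes the value `J` when computed with the basis
`b` of the Whittaker model: all but finitely many terms vanish, and their sum is `J`. -/
def HasSphericalCharacter [MeasurableSpace Kˣ] [MeasurableSpace PGL(2, K)] (ν : Measure Kˣ)
    (μ : Measure PGL(2, K)) (D : UnramWD K V) (η : Kˣ →* ℂˣ)
    {𝒲 : Subrepresentation (rightTranslation K)} (b : Module.Basis ι ℂ 𝒲.toSubmodule)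
    (f : PGL(2, K) → ℂ) (s₁ s₂ J : ℂ) : Prop :=
  (Function.support fun i => sphericalTerm ν μ D η f s₁ s₂ (b i)).Finite ∧
    ∑ᶠ i, sphericalTerm ν μ D η f s₁ s₂ (b i) = J

end Spherical

end

end LocalSpherical

namespace LocalSpherical

noncomputable section

set_option linter.unusedSectionVars false

/-! ### The normalized valuation, balls and residue classes. -/

section FieldFacts

variable {K : Type*} [Field K] [ValuativeRel K] [TopologicalSpace K]
  [IsNonarchimedeanLocalField K]

/-! Notation: a(t) = `torus t`, n(x) = `unip x`, w = `weyl K`, ϖ = `unif K`, ε = χ(ϖ), β = ε/q.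

Everything is governed by one vector v, the class of the indicator function of 𝒪 in ℙ¹(K), carried
into the Whittaker model by the given isomorphism. What is used of it is packaged in `IsCellVector`.
It is Iwahori-invariant. The partition of 𝒪 into residue classes gives v = ε Σ_b n(b)a(ϖ)v. Two
cells that are complementary in ℙ¹ have indicator functions opposite modulo constants, which gives
wv = -ε a(ϖ)v. The translates of v by the n(x)a(t) span.

Together with ψ-equivariance, the partition relation computes the Kirillov function of v: it is
v(1)β^{ord y} for y integral and 0 otherwise. By spanning, every W restricts on the torus to a
function that vanishes near infinity and is β-homogeneous near 0. The factor L(s+1/2)⁻¹ = 1 -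
βη'(ϖ)q^{-s} therefore turns f(y) into f(y) - βf(y/ϖ), which lives on finitely many shells. This
gives the entire continuation as an explicit integral, `regularPeriod`.

The central fact, `hecke_iwahori`, is that π(1_Iw) is vol(Iw) times the orthogonal projection to the
line of v. It is proved without invariance of θ under the whole group. For fixed x, both W ↦
(π(1_Iw)W)(x) and W ↦ θ(W, v) are linear forms invariant under n(𝒪) and a(𝒪ˣ). Such a form is
determined by its values on a(ϖ^{-k})v for k ≥ 0 (`linearMap_eq_zero`), and for both forms these
values are geometric of ratio β. For Iw·w, the Atkin-Lehner element τ = w a(ϖ) normalizes Iw and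
acts on v by -ε. Since Iw·w = τ Iw a(ϖ)⁻¹, the operator is W ↦ vol(Iw) θ(W, wv)/θ(v, v) · v
(`hecke_iwahoriWeyl`).

For an operator W ↦ V θ(W, w₁)/θ(v, v) · v, expanding w₁ in an orthogonal basis collapses the sum to
V λ(v) λ(conj w₁)/θ♮(v, v), whatever the basis; this is `hasSphericalCharacter_of_hecke`. It remains
to insert λ(v) = v(1), θ♮(v, v) = (1 - q⁻¹)|v(1)|², vol(G(𝒪)) = (q+1) vol(Iw), and for w₁ = wv the
factor -ε η(ϖ) q^{s₁-s₂}, whose constant -ε η(ϖ) is the ε-factor at 1/2. -/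

theorem ord_mul (a b : Kˣ) : ord (a * b) = ord a + ord b := by
  unfold ord
  rw [Units.val_mul, map_mul, map_mul, WithZero.log_mul]
  · ring
  · simp
  · simp

/-- The normalized valuation as a homomorphism to the additive group of integers. -/
def ordHom : Kˣ →* Multiplicative ℤ where
  toFun a := Multiplicative.ofAdd (ord a)
  map_one' := by
    have := ord_mul (1 : Kˣ) 1
    rw [mul_one] at this
    simpa using this
  map_mul' a b := by rw [ord_mul, ofAdd_add]

@[simp] theorem ord_one : ord (1 : Kˣ) = 0 := ordHom.map_one

@[simp] theorem ord_inv (a : Kˣ) : ord a⁻¹ = -ord a := ordHom.map_inv a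

@[simp] theorem ord_zpow (a : Kˣ) (n : ℤ) : ord (a ^ n) = n * ord a :=
  ordHom.map_zpow a n

theorem ord_unif_zpow (n : ℤ) : ord (unif K ^ n) = n := by
  rw [ord_zpow, ord_unif, mul_one]

theorem valuation_le_iff (a b : Kˣ) :
    valuation K (a : K) ≤ valuation K (b : K) ↔ ord b ≤ ord a := by
  unfold ord
  rw [neg_le_neg_iff, WithZero.log_le_log (by simp) (by simp), OrderIsoClass.map_le_map_iff]

theorem valuation_lt_iff (a b : Kˣ) :
    valuation K (a : K) < valuation K (b : K) ↔ ord b < ord a := by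
  rw [← not_le, valuation_le_iff, not_le]

theorem valuation_le_one_iff (a : Kˣ) : valuation K (a : K) ≤ 1 ↔ 0 ≤ ord a := by
  simpa using valuation_le_iff a 1

theorem valuation_lt_one_iff (a : Kˣ) : valuation K (a : K) < 1 ↔ 0 < ord a := by
  simpa using valuation_lt_iff a 1

theorem valuation_eq_one_iff (a : Kˣ) : valuation K (a : K) = 1 ↔ ord a = 0 := by
  rw [le_antisymm_iff, valuation_le_one_iff, ← not_lt (b := (1 : ValueGroupWithZero K)),
    valuation_lt_one_iff]
  omega

/-- Discreteness of the value group: no absolute value lies strictly between |cϖ| and |c|. Strict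
inequalities become closed ones, so that the complement of a cell is again a cell. -/
theorem valuation_lt_iff_le_mul_unif (x : K) (c : Kˣ) :
    valuation K x < valuation K (c : K) ↔ valuation K x ≤ valuation K ((c * unif K : Kˣ) : K) := by
  rcases eq_or_ne x 0 with rfl | hx
  · simp [zero_lt_iff]
  · have h1 := valuation_lt_iff (Units.mk0 x hx) c
    have h2 := valuation_le_iff (Units.mk0 x hx) (c * unif K)
    rw [Units.val_mk0] at h1 h2
    rw [h1, h2, ord_mul, ord_unif]
    omega

theorem IsUnramified.eq_zpow {χ : Kˣ →* ℂˣ} (hχ : IsUnramified χ) (a : Kˣ) :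
    χ a = χ (unif K) ^ ord a := by
  have h : χ (a * (unif K ^ ord a)⁻¹) = 1 := by
    apply hχ
    rw [valuation_eq_one_iff, ord_mul, ord_inv, ord_unif_zpow, add_neg_cancel]
  rwa [map_mul, map_inv, mul_inv_eq_one, map_zpow] at h

theorem one_lt_resCard : 1 < resCard K := Finite.one_lt_card

theorem nabs_pos (a : Kˣ) : 0 < nabs a :=
  zpow_pos (by exact_mod_cast resCard_pos K) _

theorem nabs_mul (a b : Kˣ) : nabs (a * b) = nabs a * nabs b := by
  unfold nabs
  rw [ord_mul, neg_add, zpow_add₀ (by exact_mod_cast (resCard_pos K).ne')]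

open scoped WithZeroTopology in
theorem isOpen_valuation_eq (a : Kˣ) : IsOpen {x : K | valuation K x = valuation K (a : K)} := by
  have : IsOpen ({valuation K (a : K)} : Set (ValueGroupWithZero K)) := by
    apply WithZeroTopology.isOpen_iff.mpr
    left
    exact fun h => (valuation K).ne_zero_iff.2 a.ne_zero h.symm
  exact this.preimage IsValuativeTopology.continuous_valuation

theorem isLocallyConstant_ord : IsLocallyConstant (ord : Kˣ → ℤ) := by
  rw [IsLocallyConstant.iff_eventually_eq]
  intro a
  have h : {y : Kˣ | valuation K (y : K) = valuation K (a : K)} ∈ nhds a :=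
    ((isOpen_valuation_eq a).preimage Units.continuous_val).mem_nhds rfl
  filter_upwards [h] with y hy
  have h1 := (valuation_le_iff y a).1 (le_of_eq hy)
  have h2 := (valuation_le_iff a y).1 (ge_of_eq hy)
  omega

theorem continuous_ord : Continuous (ord : Kˣ → ℤ) := isLocallyConstant_ord.continuous

variable (K) in
/-- Representatives in `𝒪[K]` of the residue classes. -/
def resRep (b : 𝓀[K]) : 𝒪[K] := (IsLocalRing.residue_surjective b).choose

theorem residue_resRep (b : 𝓀[K]) : IsLocalRing.residue 𝒪[K] (resRep K b) = b :=
  (IsLocalRing.residue_surjective b).choose_spec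

theorem mem_maximalIdeal_iff (x : 𝒪[K]) : x ∈ 𝓂[K] ↔ valuation K (x : K) < 1 := by
  rw [IsLocalRing.mem_maximalIdeal, mem_nonunits_iff,
    (Valuation.integer.integers (valuation K)).isUnit_iff_valuation_eq_one]
  exact ⟨fun h => lt_of_le_of_ne x.2 h, fun h => h.ne⟩

theorem valuation_resRep_le (b : 𝓀[K]) : valuation K (resRep K b : K) ≤ 1 := (resRep K b).2

/-- Exactly one representative moves x into the maximal ideal; sums of indicator functions over
residue classes then have a single nonzero term. -/
theorem valuation_add_resRep_lt_iff {x : K} (hx : valuation K x ≤ 1) (b : 𝓀[K]) :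
    valuation K (x + resRep K b) < 1 ↔ b = -IsLocalRing.residue 𝒪[K] ⟨x, hx⟩ := by
  have := mem_maximalIdeal_iff ((⟨x, hx⟩ : 𝒪[K]) + resRep K b)
  rw [Subring.coe_add] at this
  rw [← this, ← IsLocalRing.residue_eq_zero_iff, map_add, residue_resRep, add_comm,
    add_eq_zero_iff_eq_neg]

theorem valuation_resRep_lt_one_iff (b : 𝓀[K]) : valuation K (resRep K b : K) < 1 ↔ b = 0 := by
  rw [← mem_maximalIdeal_iff, ← IsLocalRing.residue_eq_zero_iff, residue_resRep]

instance instFintypeResidueField : Fintype 𝓀[K] := Fintype.ofFinite _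

theorem card_residueField : Fintype.card 𝓀[K] = resCard K := (Nat.card_eq_fintype_card).symm

open scoped WithZeroTopology in
theorem isOpen_valuation_lt (γ : ValueGroupWithZero K) : IsOpen {x : K | valuation K x < γ} := by
  exact isOpen_Iio.preimage IsValuativeTopology.continuous_valuation

/-- By discreteness this closed ball is the open ball of radius |a/ϖ|. -/
theorem isOpen_valuation_le (a : Kˣ) : IsOpen {x : K | valuation K x ≤ valuation K (a : K)} := by
  have h (x : K) := valuation_lt_iff_le_mul_unif x (a * (unif K)⁻¹)
  simp only [inv_mul_cancel_right] at h
  simpa only [← h] using isOpen_valuation_lt _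

instance instT2Space : T2Space K := by
  have : IsClosed ({0} : Set K) := by
    have h : ({0} : Set K)ᶜ = ⋃ a : Kˣ, {x : K | valuation K x = valuation K (a : K)} := by
      ext x
      simp only [Set.mem_compl_iff, Set.mem_singleton_iff, Set.mem_iUnion]
      refine ⟨fun hx => ⟨Units.mk0 x hx, rfl⟩, ?_⟩
      rintro ⟨a, ha⟩ rfl
      exact (valuation K).ne_zero_iff.2 a.ne_zero (ha.symm.trans (map_zero _))
    rw [← isOpen_compl_iff, h]
    exact isOpen_iUnion isOpen_valuation_eq
  have := IsTopologicalAddGroup.t1Space K this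
  infer_instance

end FieldFacts

/-! ### Matrix identities in the projective group. -/

section GroupIdentities

variable {K : Type*} [Field K]

theorem mk_eq_mk_of_smul {g g' : GL (Fin 2) K} (u : Kˣ)
    (h : ∀ i j, (u : K) * g i j = g' i j) :
    Matrix.ProjGenLinGroup.mk g = Matrix.ProjGenLinGroup.mk g' := by
  rw [Matrix.ProjGenLinGroup.mk_eq_mk_iff]
  refine ⟨u, ?_⟩
  ext i j
  rw [← h]
  simp [mul_comm, Matrix.scalar_apply]

/-- The class of `[1, 0; z, 1]`. -/
def lowerUnip (z : K) : PGL(2, K) :=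
  Matrix.ProjGenLinGroup.mk
    (Matrix.GeneralLinearGroup.mkOfDetNeZero !![1, 0; z, 1] (by simp))

theorem weyl_mul_weyl : weyl K * weyl K = 1 := by
  rw [weyl, ← map_mul, ← map_one Matrix.ProjGenLinGroup.mk]
  refine mk_eq_mk_of_smul (-1) fun i j => ?_
  fin_cases i <;> fin_cases j <;>
    simp [Matrix.GeneralLinearGroup.mkOfDetNeZero, Matrix.mul_apply]

theorem torus_mul (a b : Kˣ) : torus (a * b) = torus a * torus b := by
  rw [torus, torus, torus, ← map_mul]
  congr 1
  ext i j
  fin_cases i <;> fin_cases j <;>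
    simp [Matrix.GeneralLinearGroup.mkOfDetNeZero, Matrix.mul_apply]

theorem torus_one : torus (1 : Kˣ) = 1 := by
  rw [torus, ← map_one Matrix.ProjGenLinGroup.mk]
  congr 1
  ext i j
  fin_cases i <;> fin_cases j <;> simp [Matrix.GeneralLinearGroup.mkOfDetNeZero]

theorem torus_inv (a : Kˣ) : torus a⁻¹ = (torus a)⁻¹ := by
  rw [eq_inv_iff_mul_eq_one, ← torus_mul, inv_mul_cancel, torus_one]

theorem unip_add (x y : K) : unip (x + y) = unip x * unip y := by
  rw [unip, unip, unip, ← map_mul]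
  congr 1
  ext i j
  fin_cases i <;> fin_cases j <;>
    simp [Matrix.GeneralLinearGroup.mkOfDetNeZero, Matrix.mul_apply, add_comm]

theorem unip_zero : unip (0 : K) = 1 := by
  rw [unip, ← map_one Matrix.ProjGenLinGroup.mk]
  congr 1
  ext i j
  fin_cases i <;> fin_cases j <;> simp [Matrix.GeneralLinearGroup.mkOfDetNeZero]

theorem torus_mul_unip (t : Kˣ) (x : K) : torus t * unip x = unip (t * x) * torus t := by
  rw [torus, unip, unip, ← map_mul, ← map_mul]
  congr 1
  ext i j
  fin_cases i <;> fin_cases j <;>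
    simp [Matrix.GeneralLinearGroup.mkOfDetNeZero, Matrix.mul_apply]

/-- Conjugation by w swaps diagonal entries, and diag(1, t) is diag(t⁻¹, 1) up to a scalar. -/
theorem weyl_mul_torus (t : Kˣ) : weyl K * torus t = torus t⁻¹ * weyl K := by
  rw [torus, torus, weyl, ← map_mul, ← map_mul]
  refine mk_eq_mk_of_smul t⁻¹ fun i j => ?_
  fin_cases i <;> fin_cases j <;>
    simp [Matrix.GeneralLinearGroup.mkOfDetNeZero, Matrix.mul_apply]

theorem weyl_mul_unip (x : K) : weyl K * unip x = lowerUnip (-x) * weyl K := by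
  rw [lowerUnip, unip, weyl, ← map_mul, ← map_mul]
  congr 1
  ext i j
  fin_cases i <;> fin_cases j <;>
    simp [Matrix.GeneralLinearGroup.mkOfDetNeZero, Matrix.mul_apply]

theorem torus_mul_lowerUnip (t : Kˣ) (z : K) :
    torus t * lowerUnip z = lowerUnip ((t⁻¹ : Kˣ) * z) * torus t := by
  rw [torus, lowerUnip, lowerUnip, ← map_mul, ← map_mul]
  congr 1
  ext i j
  fin_cases i <;> fin_cases j <;>
    simp [Matrix.GeneralLinearGroup.mkOfDetNeZero, Matrix.mul_apply, mul_comm]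

theorem detChar_unip (χ : Kˣ →* ℂˣ) (hχ : χ ^ 2 = 1) (x : K) : detChar χ hχ (unip x) = 1 := by
  have h : Matrix.GeneralLinearGroup.det
      (Matrix.GeneralLinearGroup.mkOfDetNeZero !![1, x; 0, 1] (by simp)) = 1 := by
    ext; simp [Matrix.GeneralLinearGroup.mkOfDetNeZero]
  simp [detChar, unip, h]

theorem detChar_torus (χ : Kˣ →* ℂˣ) (hχ : χ ^ 2 = 1) (t : Kˣ) :
    detChar χ hχ (torus t) = χ t := by
  have h : Matrix.GeneralLinearGroup.det
      (Matrix.GeneralLinearGroup.mkOfDetNeZero !![(t : K), 0; 0, 1] (by simp)) = t := by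
    ext; simp [Matrix.GeneralLinearGroup.mkOfDetNeZero]
  simp [detChar, torus, h]

theorem detChar_weyl (χ : Kˣ →* ℂˣ) (hχ : χ ^ 2 = 1) : detChar χ hχ (weyl K) = 1 := by
  have h : Matrix.GeneralLinearGroup.det
      (Matrix.GeneralLinearGroup.mkOfDetNeZero !![(0 : K), 1; -1, 0] (by simp)) = 1 := by
    ext; simp [Matrix.GeneralLinearGroup.mkOfDetNeZero]
  simp [detChar, weyl, h]

end GroupIdentities

/-! ### The Iwahori subgroup and the cell it stabilizes. -/

section Iwahori

variable {K : Type*} [Field K] [ValuativeRel K]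

/-- The integral matrices of unit determinant that are upper triangular modulo `𝓂[K]`. -/
def IsIwahoriMatrix (g : GL (Fin 2) K) : Prop :=
  (∀ i j, valuation K (g i j) ≤ 1) ∧ valuation K (g 1 0) < 1 ∧
    valuation K ((g : Matrix (Fin 2) (Fin 2) K).det) = 1

theorem exists_map_eq_of_integral {g : GL (Fin 2) K} (hg : ∀ i j, valuation K (g i j) ≤ 1)
    (hd : valuation K ((g : Matrix (Fin 2) (Fin 2) K).det) = 1) :
    ∃ g' : GL (Fin 2) 𝒪[K], Matrix.GeneralLinearGroup.map (algebraMap 𝒪[K] K) g' = g := by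
  let A : Matrix (Fin 2) (Fin 2) 𝒪[K] := fun i j => ⟨g i j, hg i j⟩
  have hA : (algebraMap 𝒪[K] K).mapMatrix A = (g : Matrix (Fin 2) (Fin 2) K) := rfl
  have hdet : algebraMap 𝒪[K] K A.det = (g : Matrix (Fin 2) (Fin 2) K).det := by
    rw [RingHom.map_det, hA]
  have hu : IsUnit A.det := by
    rw [(Valuation.integer.integers (valuation K)).isUnit_iff_valuation_eq_one, hdet, hd]
  refine ⟨Matrix.GeneralLinearGroup.mk'' A hu, ?_⟩
  ext i j
  rfl

theorem valuation_det_map (g : GL (Fin 2) 𝒪[K]) :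
    valuation K ((Matrix.GeneralLinearGroup.map (algebraMap 𝒪[K] K) g :
      Matrix (Fin 2) (Fin 2) K).det) = 1 := by
  have h : ((Matrix.GeneralLinearGroup.map (algebraMap 𝒪[K] K) g : GL (Fin 2) K) :
      Matrix (Fin 2) (Fin 2) K).det = algebraMap 𝒪[K] K (g : Matrix (Fin 2) (Fin 2) 𝒪[K]).det := by
    rw [RingHom.map_det]; rfl
  rw [h, ← (Valuation.integer.integers (valuation K)).isUnit_iff_valuation_eq_one]
  exact (Matrix.isUnit_iff_isUnit_det _).1 g.isUnit

theorem iwahori_eq_image :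
    iwahori K = Matrix.ProjGenLinGroup.mk '' {g : GL (Fin 2) K | IsIwahoriMatrix g} := by
  ext x
  constructor
  · rintro ⟨g, hg, rfl⟩
    refine ⟨Matrix.GeneralLinearGroup.map (algebraMap 𝒪[K] K) g, ⟨fun i j => ((g : Matrix (Fin 2) (Fin 2) 𝒪[K]) i j).2, ?_, valuation_det_map g⟩, rfl⟩
    by_contra hcon
    refine hg ((Valuation.integer.integers (valuation K)).isUnit_iff_valuation_eq_one.2 ?_)
    exact le_antisymm ((g : Matrix (Fin 2) (Fin 2) 𝒪[K]) 1 0).2 (not_lt.1 hcon)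
  · rintro ⟨g, ⟨h1, h2, h3⟩, rfl⟩
    obtain ⟨g', rfl⟩ := exists_map_eq_of_integral h1 h3
    refine ⟨g', ?_, rfl⟩
    change _ ∈ nonunits _
    rw [mem_nonunits_iff, (Valuation.integer.integers (valuation K)).isUnit_iff_valuation_eq_one]
    exact h2.ne

variable (K) in
/-- The Iwahori subgroup as a subgroup. -/
def iwahoriSubgroup : Subgroup PGL(2, K) where
  carrier := iwahori K
  one_mem' := by
    rw [iwahori_eq_image]
    refine ⟨1, ⟨fun i j => ?_, by simp, by simp⟩, map_one _⟩
    fin_cases i <;> fin_cases j <;> simp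
  mul_mem' := by
    rw [iwahori_eq_image]
    rintro _ _ ⟨g, ⟨h1, h2, h3⟩, rfl⟩ ⟨g', ⟨h1', h2', h3'⟩, rfl⟩
    refine ⟨g * g', ⟨fun i j => ?_, ?_, ?_⟩, map_mul _ _ _⟩
    · rw [Units.val_mul, Matrix.mul_apply, Fin.sum_univ_two]
      refine (valuation K).map_add_le ?_ ?_ <;> rw [map_mul] <;> exact mul_le_one' (h1 _ _) (h1' _ _)
    · rw [Units.val_mul, Matrix.mul_apply, Fin.sum_univ_two]
      refine (valuation K).map_add_lt ?_ ?_ <;> rw [map_mul]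
      · exact mul_lt_one_of_lt_of_le h2 (h1' _ _)
      · exact (mul_comm (valuation K (g 1 1)) _).trans_lt (mul_lt_one_of_lt_of_le h2' (h1 _ _))
    · rw [Units.val_mul, Matrix.det_mul, map_mul, h3, h3', one_mul]
  inv_mem' := by
    rw [iwahori_eq_image]
    rintro _ ⟨g, ⟨h1, h2, h3⟩, rfl⟩
    have hv : valuation K (Ring.inverse (g : Matrix (Fin 2) (Fin 2) K).det) = 1 := by
      rw [Ring.inverse_eq_inv', map_inv₀, h3, inv_one]
    refine ⟨g⁻¹, ⟨fun i j => ?_, ?_, ?_⟩, map_inv _ _⟩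
    · rw [Matrix.coe_units_inv, Matrix.inv_def, Matrix.smul_apply, smul_eq_mul, map_mul, hv, one_mul,
        Matrix.adjugate_fin_two]
      fin_cases i <;> fin_cases j <;> simp [h1]
    · rw [Matrix.coe_units_inv, Matrix.inv_def, Matrix.smul_apply, smul_eq_mul, map_mul, hv, one_mul,
        Matrix.adjugate_fin_two]
      simpa using h2
    · rw [Matrix.coe_units_inv, Matrix.det_nonsing_inv, hv]

theorem coe_iwahoriSubgroup : (iwahoriSubgroup K : Set PGL(2, K)) = iwahori K := rfl

theorem mem_iwahori_of_entries {A : Matrix (Fin 2) (Fin 2) K} (hA : A.det ≠ 0)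
    (h : ∀ i j, valuation K (A i j) ≤ 1) (h10 : valuation K (A 1 0) < 1)
    (hd : valuation K A.det = 1) :
    Matrix.ProjGenLinGroup.mk (Matrix.GeneralLinearGroup.mkOfDetNeZero A hA) ∈ iwahori K := by
  rw [iwahori_eq_image]
  exact ⟨_, ⟨h, h10, hd⟩, rfl⟩

theorem unip_mem_iwahori {x : K} (hx : valuation K x ≤ 1) : unip x ∈ iwahori K := by
  refine mem_iwahori_of_entries _ (fun i j => ?_) (by simp) (by simp)
  fin_cases i <;> fin_cases j <;> simp [hx]

theorem lowerUnip_mem_iwahori {x : K} (hx : valuation K x < 1) : lowerUnip x ∈ iwahori K := by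
  refine mem_iwahori_of_entries _ (fun i j => ?_) (by simpa) (by simp)
  fin_cases i <;> fin_cases j <;> simp [hx.le]

theorem torus_mem_iwahori {t : Kˣ} (ht : valuation K (t : K) = 1) : torus t ∈ iwahori K := by
  refine mem_iwahori_of_entries _ (fun i j => ?_) (by simp) (by simpa)
  fin_cases i <;> fin_cases j <;> simp [ht.le]

variable (K) in
/-- The points `(c : d)` of the projective line with `|d| ≤ |c|`, pulled back to `PGL₂(K)` by the
bottom row. -/
def bigCell : Set PGL(2, K) :=
  Matrix.ProjGenLinGroup.mk '' {g : GL (Fin 2) K | valuation K (g 1 1) ≤ valuation K (g 1 0)}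

theorem mk_mem_bigCell {g : GL (Fin 2) K} :
    Matrix.ProjGenLinGroup.mk g ∈ bigCell K ↔ valuation K (g 1 1) ≤ valuation K (g 1 0) := by
  refine ⟨?_, fun h => ⟨g, h, rfl⟩⟩
  rintro ⟨g', h', h⟩
  obtain ⟨u, rfl⟩ := Matrix.ProjGenLinGroup.mk_eq_mk_iff.1 h
  have hu : (0 : ValueGroupWithZero K) < valuation K (u : K) :=
    zero_lt_iff.2 ((valuation K).ne_zero_iff.2 u.ne_zero)
  have h' : valuation K (g' 1 1) ≤ valuation K (g' 1 0) := h'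
  simpa [Matrix.scalar_apply, hu] using h'

theorem borel_mul_mem_bigCell {b : PGL(2, K)} (hb : b ∈ borelSet K) (g : PGL(2, K)) :
    b * g ∈ bigCell K ↔ g ∈ bigCell K := by
  obtain ⟨b, hb, rfl⟩ := hb
  have hb : b 1 0 = 0 := hb
  induction g using Matrix.ProjGenLinGroup.induction_on with | mk g =>
  have h11 : b 1 1 ≠ 0 := by
    intro h
    have := ((Matrix.isUnit_iff_isUnit_det _).1 b.isUnit).ne_zero
    rw [Matrix.det_fin_two, hb, h] at this
    simp at this
  have hu : (0 : ValueGroupWithZero K) < valuation K (b 1 1) :=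
    zero_lt_iff.2 ((valuation K).ne_zero_iff.2 h11)
  rw [← map_mul, mk_mem_bigCell, mk_mem_bigCell]
  simp [Matrix.mul_apply, hb, hu]

theorem mul_weyl_mem_bigCell (g : GL (Fin 2) K) :
    Matrix.ProjGenLinGroup.mk g * weyl K ∈ bigCell K ↔
      valuation K (g 1 0) ≤ valuation K (g 1 1) := by
  rw [weyl, ← map_mul, mk_mem_bigCell]
  simp [Matrix.GeneralLinearGroup.mkOfDetNeZero, Matrix.mul_apply]

theorem mul_unip_torus_mem_bigCell (g : GL (Fin 2) K) (x : K) (t : Kˣ) :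
    Matrix.ProjGenLinGroup.mk g * (unip x * torus t) ∈ bigCell K ↔
      valuation K (g 1 0 * x + g 1 1) ≤ valuation K (g 1 0 * t) := by
  rw [unip, torus, ← map_mul, ← map_mul, mk_mem_bigCell]
  simp [Matrix.GeneralLinearGroup.mkOfDetNeZero, Matrix.mul_apply]

/-- Let (c, d) be the bottom row of g. The new first entry c k₀₀ + d k₁₀ keeps the absolute value
|c|, because |k₀₀| = 1, |k₁₀| < 1 and |d| ≤ |c|; the new second entry is at most |c| by integrality.
-/
theorem mul_mem_bigCell_of_mem_iwahori {g k : PGL(2, K)} (hg : g ∈ bigCell K)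
    (hk : k ∈ iwahori K) : g * k ∈ bigCell K := by
  rw [iwahori_eq_image] at hk
  obtain ⟨k, ⟨h1, h2, h3⟩, rfl⟩ := hk
  induction g using Matrix.ProjGenLinGroup.induction_on with | mk g =>
  rw [mk_mem_bigCell] at hg
  rw [← map_mul, mk_mem_bigCell]
  have hk00 : valuation K (k 0 0) = 1 := by
    refine le_antisymm (h1 0 0) (not_lt.1 fun hlt => h3.not_lt ?_)
    rw [Matrix.det_fin_two]
    refine (valuation K).map_sub_lt ?_ ?_ <;> rw [map_mul]
    · exact mul_lt_one_of_lt_of_le hlt (h1 _ _)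
    · exact (mul_comm _ _).trans_lt (mul_lt_one_of_lt_of_le h2 (h1 _ _))
  have hc : g 1 0 ≠ 0 := by
    intro h
    have := ((Matrix.isUnit_iff_isUnit_det _).1 g.isUnit).ne_zero
    rw [h, map_zero, le_zero_iff, map_eq_zero] at hg
    rw [Matrix.det_fin_two, hg, h] at this
    simp at this
  have hpos : (0 : ValueGroupWithZero K) < valuation K (g 1 0) :=
    zero_lt_iff.2 ((valuation K).ne_zero_iff.2 hc)
  simp only [Units.val_mul, Matrix.mul_apply, Fin.sum_univ_two]
  have e : valuation K (g 1 0 * k 0 0 + g 1 1 * k 1 0) = valuation K (g 1 0) := by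
    rw [Valuation.map_add_eq_of_lt_left, map_mul, hk00, mul_one]
    rw [map_mul, map_mul, hk00, mul_one]
    calc valuation K (g 1 1) * valuation K (k 1 0) ≤ valuation K (g 1 0) * valuation K (k 1 0) := by
          gcongr
      _ < valuation K (g 1 0) * 1 := by
          exact mul_lt_mul_of_pos_left h2 hpos
      _ = _ := mul_one _
  rw [e]
  refine (valuation K).map_add_le ?_ ?_ <;> rw [map_mul]
  · exact mul_le_of_le_one_right' (h1 _ _)
  · exact (mul_le_of_le_one_right' (h1 _ _)).trans hg

theorem mul_mem_bigCell_iff {g k : PGL(2, K)} (hk : k ∈ iwahori K) :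
    g * k ∈ bigCell K ↔ g ∈ bigCell K := by
  refine ⟨fun h => ?_, fun h => mul_mem_bigCell_of_mem_iwahori h hk⟩
  have := mul_mem_bigCell_of_mem_iwahori h ((iwahoriSubgroup K).inv_mem hk)
  rwa [mul_inv_cancel_right] at this

end Iwahori

/-! ### The cell is clopen; the Iwahori subgroup is compact and open. -/

section GroupTopology

variable {K : Type*} [Field K] [ValuativeRel K] [TopologicalSpace K]
  [IsNonarchimedeanLocalField K]

theorem continuous_mk :
    Continuous (Matrix.ProjGenLinGroup.mk : GL (Fin 2) K → PGL(2, K)) :=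
  continuous_quot_mk

theorem isOpenMap_mk :
    IsOpenMap (Matrix.ProjGenLinGroup.mk : GL (Fin 2) K → PGL(2, K)) :=
  QuotientGroup.isOpenMap_coe

theorem isQuotientMap_mk :
    Topology.IsQuotientMap (Matrix.ProjGenLinGroup.mk : GL (Fin 2) K → PGL(2, K)) :=
  isOpenMap_mk.isQuotientMap continuous_mk Matrix.ProjGenLinGroup.mk_surjective

theorem continuous_entry (i j : Fin 2) : Continuous fun g : GL (Fin 2) K => g i j :=
  Units.continuous_val.matrix_elem i j

theorem continuous_mk_mkOfDetNeZero {X : Type*} [TopologicalSpace X]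
    {A : X → Matrix (Fin 2) (Fin 2) K} (hA : Continuous A) (h : ∀ x, (A x).det ≠ 0) :
    Continuous fun x => Matrix.ProjGenLinGroup.mk
      (Matrix.GeneralLinearGroup.mkOfDetNeZero (A x) (h x)) := by
  refine continuous_mk.comp (Units.continuous_iff.2 ⟨hA, ?_⟩)
  have h2 : (fun x => ((Matrix.GeneralLinearGroup.mkOfDetNeZero (A x) (h x))⁻¹ :
      GL (Fin 2) K).1) = fun x => (A x).det⁻¹ • (A x).adjugate := by
    ext1 x
    rw [Matrix.coe_units_inv, Matrix.inv_def, Ring.inverse_eq_inv']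
    rfl
  rw [h2]
  exact (hA.matrix_det.inv₀ h).smul hA.matrix_adjugate

theorem continuous_unip : Continuous (unip : K → PGL(2, K)) := by
  refine continuous_mk_mkOfDetNeZero (continuous_matrix fun i j => ?_) _
  fin_cases i <;> fin_cases j <;> simp <;> fun_prop

theorem continuous_lowerUnip : Continuous (lowerUnip : K → PGL(2, K)) := by
  refine continuous_mk_mkOfDetNeZero (continuous_matrix fun i j => ?_) _
  fin_cases i <;> fin_cases j <;> simp <;> fun_prop

theorem isOpen_bigCell : IsOpen (bigCell K) := by
  rw [← isQuotientMap_mk.isOpen_preimage]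
  have : Matrix.ProjGenLinGroup.mk ⁻¹' bigCell K =
      {g : GL (Fin 2) K | g 1 0 ≠ 0} ∩ (fun g => g 1 1 / g 1 0) ⁻¹' {x | valuation K x ≤ 1} := by
    ext g
    rw [Set.mem_preimage, mk_mem_bigCell]
    by_cases h : g 1 0 = 0
    · have h0 : g 1 1 ≠ 0 := by
        intro h'
        have := ((Matrix.isUnit_iff_isUnit_det _).1 g.isUnit).ne_zero
        rw [Matrix.det_fin_two, h', h] at this
        simp at this
      simp [h, h0]
    · have hpos : (0 : ValueGroupWithZero K) < valuation K (g 1 0) :=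
        zero_lt_iff.2 ((valuation K).ne_zero_iff.2 h)
      simp [h, div_le_one₀ hpos]
  rw [this]
  refine ContinuousOn.isOpen_inter_preimage ?_
    (isOpen_ne_fun (continuous_entry 1 0) continuous_const) ?_
  · exact (continuous_entry 1 1).continuousOn.div (continuous_entry 1 0).continuousOn fun g hg => hg
  · simpa using isOpen_valuation_le (1 : Kˣ)

/-- The condition |c| < |d| is |c/ϖ| ≤ |d|, so the complement is a right translate of the cell
itself. This yields both the closedness of the cell and the Weyl relation in the Steinberg
representation. -/
theorem compl_bigCell :
    (bigCell K)ᶜ = {g | g * torus (unif K)⁻¹ * weyl K ∈ bigCell K} := by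
  ext g
  induction g using Matrix.ProjGenLinGroup.induction_on with | mk g =>
  have e : Matrix.ProjGenLinGroup.mk g * torus (unif K)⁻¹ * weyl K ∈ bigCell K ↔
      valuation K (g 1 0 * (unif K)⁻¹) ≤ valuation K (g 1 1) := by
    rw [torus, ← map_mul, mul_weyl_mem_bigCell]
    simp [Matrix.GeneralLinearGroup.mkOfDetNeZero, Matrix.mul_apply]
  rw [Set.mem_compl_iff, mk_mem_bigCell, not_le, Set.mem_ofPred_eq, e]
  have hpos : (0 : ValueGroupWithZero K) < valuation K (unif K : K) :=
    zero_lt_iff.2 ((valuation K).ne_zero_iff.2 (unif K).ne_zero)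
  by_cases h0 : g 1 1 = 0
  · have h1 : g 1 0 ≠ 0 := by
      intro h'
      have := ((Matrix.isUnit_iff_isUnit_det _).1 g.isUnit).ne_zero
      rw [Matrix.det_fin_two, h', h0] at this
      simp at this
    simp [h0, h1]
  · have := valuation_lt_iff_le_mul_unif (g 1 0) (Units.mk0 _ h0)
    rw [Units.val_mul, Units.val_mk0, map_mul] at this
    rw [this, Units.val_inv_eq_inv_val, map_mul, map_inv₀, mul_inv_le_iff₀ hpos]

theorem isClopen_bigCell : IsClopen (bigCell K) := by
  refine ⟨⟨?_⟩, isOpen_bigCell⟩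
  rw [compl_bigCell]
  exact isOpen_bigCell.preimage ((continuous_mul_const _).comp (continuous_mul_const _))

theorem isOpen_iwahori : IsOpen (iwahori K) := by
  rw [iwahori_eq_image]
  refine isOpenMap_mk _ ?_
  have h1 : IsOpen {x : K | valuation K x ≤ 1} := by simpa using isOpen_valuation_le (1 : Kˣ)
  have h2 : IsOpen {x : K | valuation K x = 1} := by simpa using isOpen_valuation_eq (1 : Kˣ)
  have : {g : GL (Fin 2) K | IsIwahoriMatrix g} =
      (⋂ i, ⋂ j, (fun g : GL (Fin 2) K => g i j) ⁻¹' {x | valuation K x ≤ 1}) ∩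
      ((fun g : GL (Fin 2) K => g 1 0) ⁻¹' {x | valuation K x < 1} ∩
      (fun g : GL (Fin 2) K => (g : Matrix (Fin 2) (Fin 2) K).det) ⁻¹' {x | valuation K x = 1}) := by
    ext g
    simp [IsIwahoriMatrix]
  rw [this]
  refine IsOpen.inter (isOpen_iInter_of_finite fun i => isOpen_iInter_of_finite fun j =>
    h1.preimage (continuous_entry i j)) (((isOpen_valuation_lt 1).preimage
      (continuous_entry 1 0)).inter (h2.preimage ?_))
  exact Continuous.matrix_det Units.continuous_val

/-- It is the continuous image of a closed subset of GL₂(𝒪), which is compact because 𝒪 is. -/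
theorem isCompact_iwahori : IsCompact (iwahori K) := by
  have hc : IsClosed {g : GL (Fin 2) 𝒪[K] | (g : Matrix (Fin 2) (Fin 2) 𝒪[K]) 1 0 ∈ 𝓂[K]} := by
    have : {g : GL (Fin 2) 𝒪[K] | (g : Matrix (Fin 2) (Fin 2) 𝒪[K]) 1 0 ∈ 𝓂[K]} =
        ((fun g : GL (Fin 2) 𝒪[K] => ((g : Matrix (Fin 2) (Fin 2) 𝒪[K]) 1 0 : K)) ⁻¹'
          {x : K | valuation K x = 1})ᶜ := by
      ext g
      simp only [Set.mem_ofPred_eq, Set.mem_compl_iff, Set.mem_preimage]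
      rw [mem_maximalIdeal_iff]
      exact ⟨fun h => h.ne, fun h => lt_of_le_of_ne ((g : Matrix (Fin 2) (Fin 2) 𝒪[K]) 1 0).2 h⟩
    rw [this]
    refine (IsOpen.preimage ?_ (by simpa using isOpen_valuation_eq (1 : Kˣ))).isClosed_compl
    exact continuous_subtype_val.comp (Units.continuous_val.matrix_elem 1 0)
  have hT : T1Space (Matrix (Fin 2) (Fin 2) 𝒪[K]) := inferInstanceAs (T1Space (Fin 2 → Fin 2 → 𝒪[K]))
  have hC : CompactSpace (Matrix (Fin 2) (Fin 2) 𝒪[K]) :=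
    inferInstanceAs (CompactSpace (Fin 2 → Fin 2 → 𝒪[K]))
  have : CompactSpace (GL (Fin 2) 𝒪[K]) :=
    inferInstanceAs (CompactSpace (Matrix (Fin 2) (Fin 2) 𝒪[K])ˣ)
  refine hc.isCompact.image (continuous_mk.comp ?_)
  refine Continuous.units_map (RingHom.mapMatrix (m := Fin 2) (algebraMap 𝒪[K] K) :
    Matrix (Fin 2) (Fin 2) 𝒪[K] →* Matrix (Fin 2) (Fin 2) K) ?_
  exact Continuous.matrix_map continuous_id continuous_subtype_val

end GroupTopology

/-! ### The cell vector in the Steinberg representation. -/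

section CellVector

variable (K : Type*) [Field K] [ValuativeRel K] [TopologicalSpace K]
  [IsNonarchimedeanLocalField K]

/-- The indicator function of `𝒪[K]` inside the projective line. -/
def cellFn : projLineFunctions K :=
  ⟨(bigCell K).indicator 1, (LocallyConstant.charFn ℂ isClopen_bigCell).isLocallyConstant, fun b hb g => by
    by_cases hg : g ∈ bigCell K
    · rw [Set.indicator_of_mem hg, Set.indicator_of_mem ((borel_mul_mem_bigCell hb g).2 hg)]; rfl
    · rw [Set.indicator_of_notMem hg,
        Set.indicator_of_notMem (mt (borel_mul_mem_bigCell hb g).1 hg)]⟩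

/-- The class of the indicator function of `𝒪[K]` in the Steinberg representation. -/
def cellVec : SteinbergSpace K := (constFunctions K).mkQ (cellFn K)

variable {K}

theorem cellFn_apply (g : PGL(2, K)) [Decidable (g ∈ bigCell K)] :
    (cellFn K : PGL(2, K) → ℂ) g = if g ∈ bigCell K then 1 else 0 := by
  change (bigCell K).indicator 1 g = _
  by_cases h : g ∈ bigCell K <;> simp [h]

theorem steinberg_mkQ (g : PGL(2, K)) (φ : projLineFunctions K) :
    steinberg K g ((constFunctions K).mkQ φ) = (constFunctions K).mkQ (projLineRep K g φ) := rfl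

theorem projLineRep_apply (g : PGL(2, K)) (φ : projLineFunctions K) (h : PGL(2, K)) :
    (projLineRep K g φ : PGL(2, K) → ℂ) h = (φ : PGL(2, K) → ℂ) (h * g) := rfl

theorem steinberg_iwahori {k : PGL(2, K)} (hk : k ∈ iwahori K) :
    steinberg K k (cellVec K) = cellVec K := by
  classical
  rw [cellVec, steinberg_mkQ]
  congr 1
  ext h
  simp only [projLineRep_apply, cellFn_apply, mul_mem_bigCell_iff hk]

/-- The translates of the cell by w and by a(ϖ) are {|c| ≤ |d|} and {|d| < |c|}. Their indicator
functions add up to the constant 1, which is zero in the quotient. -/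
theorem steinberg_weyl :
    steinberg K (weyl K) (cellVec K) = -steinberg K (torus (unif K)) (cellVec K) := by
  classical
  rw [cellVec, steinberg_mkQ, steinberg_mkQ, eq_neg_iff_add_eq_zero, ← map_add,
    Submodule.mkQ_apply, Submodule.Quotient.mk_eq_zero]
  refine ⟨1, fun g => ?_⟩
  have h := @compl_bigCell K _ _ _ _
  rw [Submodule.coe_add, Pi.add_apply, projLineRep_apply, projLineRep_apply, cellFn_apply,
    cellFn_apply]
  have h2 : g * torus (unif K) ∈ (bigCell K)ᶜ ↔ g * weyl K ∈ bigCell K := by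
    rw [h, Set.mem_ofPred_eq, mul_assoc g, ← torus_mul, mul_inv_cancel, torus_one, mul_one]
  rw [← h2, Set.mem_compl_iff]
  by_cases h3 : g * torus (unif K) ∈ bigCell K <;> simp [h3]

/-- In the affine coordinate d/c this is the partition of 𝒪 into the q cosets of the maximal ideal;
it holds already for functions, before passing to the quotient. -/
theorem cellVec_eq_sum :
    cellVec K = ∑ b : 𝓀[K], steinberg K (unip (resRep K b : K) * torus (unif K)) (cellVec K) := by
  classical
  simp only [cellVec, steinberg_mkQ]
  rw [← map_sum]
  congr 1
  ext g
  rw [Submodule.coe_sum, Finset.sum_apply]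
  simp only [projLineRep_apply, cellFn_apply]
  induction g using Matrix.ProjGenLinGroup.induction_on with | mk g =>
  simp only [mul_unip_torus_mem_bigCell, mk_mem_bigCell]
  by_cases hc : g 1 0 = 0
  · have h0 : g 1 1 ≠ 0 := by
      intro h'
      have := ((Matrix.isUnit_iff_isUnit_det _).1 g.isUnit).ne_zero
      rw [Matrix.det_fin_two, h', hc] at this
      simp at this
    simp [hc, h0]
  · have key (y : K) : valuation K y ≤ valuation K (g 1 0 * (unif K : K)) ↔
        valuation K (y / g 1 0) < 1 := by
      have := valuation_lt_iff_le_mul_unif y (Units.mk0 _ hc)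
      rw [Units.val_mul, Units.val_mk0] at this
      rw [← this, map_div₀, div_lt_one₀ (zero_lt_iff.2 ((valuation K).ne_zero_iff.2 hc))]
    have key2 : valuation K (g 1 1) ≤ valuation K (g 1 0) ↔ valuation K (g 1 1 / g 1 0) ≤ 1 := by
      rw [map_div₀, div_le_one₀ (zero_lt_iff.2 ((valuation K).ne_zero_iff.2 hc))]
    have e (b : 𝓀[K]) : (g 1 0 * resRep K b + g 1 1) / g 1 0 = g 1 1 / g 1 0 + resRep K b := by
      field_simp; ring
    simp only [key, key2, e]
    by_cases hx : valuation K (g 1 1 / g 1 0) ≤ 1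
    · simp only [valuation_add_resRep_lt_iff hx, hx, if_true, Finset.sum_ite_eq', Finset.mem_univ]
    · rw [if_neg hx]
      refine (Finset.sum_eq_zero fun b _ => if_neg fun h => hx ?_).symm
      have := (valuation K).map_sub_le h.le (valuation_resRep_le b)
      rwa [add_sub_cancel_right] at this

/-- The indicator function is not constant: it is 0 at the point at infinity, the class of 1, and 1
at the origin, the class of w. -/
theorem cellVec_ne_zero : cellVec K ≠ 0 := by
  classical
  rw [cellVec, Submodule.mkQ_apply, Ne, Submodule.Quotient.mk_eq_zero]
  rintro ⟨c, hc⟩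
  have h1 := hc 1
  have h2 := hc (weyl K)
  rw [cellFn_apply] at h1 h2
  have e1 : (1 : PGL(2, K)) ∉ bigCell K := by
    rw [← map_one Matrix.ProjGenLinGroup.mk, mk_mem_bigCell]
    simp
  have e2 : weyl K ∈ bigCell K := by
    have := mul_weyl_mem_bigCell (1 : GL (Fin 2) K)
    rw [map_one, one_mul] at this
    rw [this]
    simp
  rw [if_neg e1] at h1
  rw [if_pos e2, ← h1] at h2
  exact one_ne_zero h2

end CellVector

/-! ### Translates of the cell vector by the upper triangular group span. -/

section Spanning

variable {K : Type*} [Field K] [ValuativeRel K] [TopologicalSpace K]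
  [IsNonarchimedeanLocalField K]

theorem IsLocallyConstant.exists_forall_valuation_le {F : K → ℂ} (hF : IsLocallyConstant F)
    (x : K) : ∃ t : Kˣ, ∀ z, valuation K z ≤ valuation K (t : K) → F (x + z) = F x := by
  have h := ((IsLocallyConstant.iff_eventually_eq F).1 hF) x
  have h2 : ∀ᶠ z in nhds (0 : K), F (x + z) = F x := by
    have : Filter.Tendsto (fun z => x + z) (nhds 0) (nhds x) := by
      simpa using (continuous_const_add x).tendsto 0
    exact this.eventually h
  obtain ⟨γ, hγ, hs⟩ := (IsValuativeTopology.hasBasis_nhds_zero' K).eventually_iff.1 h2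
  obtain ⟨y, rfl⟩ := ValuativeRel.valuation_surjective γ
  have hy : y ≠ 0 := by rintro rfl; exact hγ (map_zero _)
  refine ⟨Units.mk0 y hy * unif K, fun z hz => hs ?_⟩
  exact (valuation_lt_iff_le_mul_unif z (Units.mk0 y hy)).2 hz

theorem exists_uniform_of_locallyConstant {F : K → ℂ} (hF : IsLocallyConstant F) {S : Set K}
    (hS : IsCompact S) :
    ∃ t : Kˣ, ∀ x ∈ S, ∀ z, valuation K z ≤ valuation K (t : K) → F (x + z) = F x := by
  refine hS.induction_on (p := fun S => ∃ t : Kˣ, ∀ x ∈ S, ∀ z,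
    valuation K z ≤ valuation K (t : K) → F (x + z) = F x) ⟨1, by simp⟩ ?_ ?_ ?_
  · rintro s s' hss ⟨t, ht⟩
    exact ⟨t, fun x hx => ht x (hss hx)⟩
  · rintro s s' ⟨t, ht⟩ ⟨t', ht'⟩
    rcases le_total (valuation K (t : K)) (valuation K (t' : K)) with h | h
    · refine ⟨t, ?_⟩
      rintro x (hx | hx) z hz
      exacts [ht x hx z hz, ht' x hx z (hz.trans h)]
    · refine ⟨t', ?_⟩
      rintro x (hx | hx) z hz
      exacts [ht x hx z (hz.trans h), ht' x hx z hz]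
  · intro x _
    obtain ⟨t, ht⟩ := IsLocallyConstant.exists_forall_valuation_le hF x
    -- In an ultrametric ball every point is a centre: for y within |t| of x and |z| ≤ |t|, both y
    -- and y + z are within |t| of x, so one t serves a whole neighbourhood.
    refine ⟨{y | valuation K (y - x) ≤ valuation K (t : K)}, mem_nhdsWithin_of_mem_nhds ?_, t, ?_⟩
    · refine ((isOpen_valuation_le t).preimage (continuous_sub_right x)).mem_nhds ?_
      simp
    · intro y hy z hz
      have h1 := ht (y - x) hy
      have h2 := ht (y - x + z) ((valuation K).map_add_le hy hz)
      rw [← add_assoc, add_sub_cancel] at h2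
      rw [add_sub_cancel] at h1
      rw [h1, h2]

/-- The fractional ideal `t 𝒪[K]` as an additive subgroup. -/
def ballSubgroup (t : Kˣ) : AddSubgroup K where
  carrier := {z | valuation K z ≤ valuation K (t : K)}
  add_mem' := by
    intro a b h h'
    rw [Set.mem_ofPred_eq] at h h' ⊢
    exact (valuation K).map_add_le h h'
  zero_mem' := by simp
  neg_mem' := by simp

theorem mem_ballSubgroup {t : Kˣ} {z : K} :
    z ∈ ballSubgroup t ↔ valuation K z ≤ valuation K (t : K) := Iff.rfl

theorem finite_quotient_image (t : Kˣ) {S : Set K} (hS : IsCompact S) :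
    ((QuotientAddGroup.mk : K → K ⧸ ballSubgroup t) '' S).Finite := by
  have : DiscreteTopology (K ⧸ ballSubgroup t) :=
    QuotientAddGroup.discreteTopology (isOpen_valuation_le t)
  exact (hS.image QuotientAddGroup.continuous_mk).finite_of_discrete

/-- Away from infinity a point of B\G is determined by the affine coordinate d/c of its bottom row,
and w n(x) has coordinate x. -/
theorem mk_eq_borel_mul {g : GL (Fin 2) K} (hg : g 1 0 ≠ 0) :
    ∃ b ∈ borelSet K,
      Matrix.ProjGenLinGroup.mk g = b * (weyl K * unip (g 1 1 / g 1 0)) := by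
  refine ⟨Matrix.ProjGenLinGroup.mk g * (unip (-(g 1 1 / g 1 0)) * weyl K), ?_, ?_⟩
  · rw [unip, weyl, ← map_mul, ← map_mul]
    refine ⟨_, ?_, rfl⟩
    simp [Matrix.GeneralLinearGroup.mkOfDetNeZero, Matrix.mul_apply]
    field_simp
    simp
  · rw [mul_assoc, mul_assoc, ← mul_assoc (weyl K), weyl_mul_weyl, one_mul, ← unip_add,
      neg_add_cancel, unip_zero, mul_one]

theorem weyl_mul_unip_eq_borel_mul {x : K} (hx : x ≠ 0) :
    ∃ b ∈ borelSet K, weyl K * unip x = b * lowerUnip x⁻¹ := by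
  refine ⟨Matrix.ProjGenLinGroup.mk
    (Matrix.GeneralLinearGroup.mkOfDetNeZero !![-x⁻¹, 1; 0, -x] (by simp [hx])), ⟨_, ?_, rfl⟩, ?_⟩
  · simp [Matrix.GeneralLinearGroup.mkOfDetNeZero]
  · rw [unip, weyl, lowerUnip, ← map_mul, ← map_mul]
    congr 1
    ext i j
    fin_cases i <;> fin_cases j <;>
      simp [Matrix.GeneralLinearGroup.mkOfDetNeZero, Matrix.mul_apply, hx]

theorem projLineFunctions_apply_mk (φ : projLineFunctions K) {g : GL (Fin 2) K} (hg : g 1 0 ≠ 0) :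
    (φ : PGL(2, K) → ℂ) (Matrix.ProjGenLinGroup.mk g) =
      (φ : PGL(2, K) → ℂ) (weyl K * unip (g 1 1 / g 1 0)) := by
  obtain ⟨b, hb, h⟩ := mk_eq_borel_mul hg
  rw [h, φ.2.2 b hb]

theorem projLineFunctions_apply_mk_of_eq_zero (φ : projLineFunctions K) {g : GL (Fin 2) K}
    (hg : g 1 0 = 0) :
    (φ : PGL(2, K) → ℂ) (Matrix.ProjGenLinGroup.mk g) = (φ : PGL(2, K) → ℂ) 1 := by
  have := φ.2.2 (Matrix.ProjGenLinGroup.mk g) ⟨g, hg, rfl⟩ 1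
  rwa [mul_one] at this

/-- Modulo B the point w n(x) is the class of `lowerUnip x⁻¹`, which tends to 1 as x tends to
infinity; local constancy at 1 gives the bound. -/
theorem exists_bound_of_projLineFunctions (φ : projLineFunctions K) :
    ∃ t : Kˣ, ∀ x : K, ¬ valuation K x ≤ valuation K (t : K) →
      (φ : PGL(2, K) → ℂ) (weyl K * unip x) = (φ : PGL(2, K) → ℂ) 1 := by
  obtain ⟨t, ht⟩ := IsLocallyConstant.exists_forall_valuation_le
    (φ.2.1.comp_continuous continuous_lowerUnip) 0
  refine ⟨t⁻¹, fun x hx => ?_⟩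
  have hx0 : x ≠ 0 := by rintro rfl; simp at hx
  obtain ⟨b, hb, h⟩ := weyl_mul_unip_eq_borel_mul hx0
  rw [h, φ.2.2 b hb]
  have e : lowerUnip (0 : K) = 1 := by
    rw [lowerUnip, ← map_one Matrix.ProjGenLinGroup.mk]
    congr 1
    ext i j
    fin_cases i <;> fin_cases j <;> simp [Matrix.GeneralLinearGroup.mkOfDetNeZero]
  have h1 := ht x⁻¹ ?_
  · simpa [e] using h1
  · have h2 := valuation_le_iff (Units.mk0 x hx0)⁻¹ t
    have h3 := valuation_le_iff (Units.mk0 x hx0) t⁻¹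
    rw [Units.val_inv_eq_inv_val, Units.val_mk0] at h2
    rw [Units.val_mk0, ord_inv] at h3
    rw [h3] at hx
    rw [h2, ord_inv]
    omega

/-- After subtracting its value at infinity, which does not change the class, a function φ becomes a
compactly supported locally constant function on K. It is a finite combination of indicator
functions of balls, and the ball with centre a and radius |t| is the translate of 𝒪 by n(-a)a(t). -/
theorem span_borel_cellVec :
    Submodule.span ℂ (Set.range fun p : K × Kˣ =>
      steinberg K (unip p.1 * torus p.2) (cellVec K)) = ⊤ := by
  classical
  rw [eq_top_iff]
  rintro v -
  obtain ⟨φ, rfl⟩ := (constFunctions K).mkQ_surjective v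
  obtain ⟨t₀, h₀⟩ := exists_bound_of_projLineFunctions φ
  have hloc : IsLocallyConstant fun x : K => (φ : PGL(2, K) → ℂ) (weyl K * unip x) :=
    φ.2.1.comp_continuous ((continuous_const_mul _).comp continuous_unip)
  have hcomp := IsNonarchimedeanLocalField.isCompact_closedBall K (valuation K (t₀ : K))
  obtain ⟨t, ht₁⟩ := exists_uniform_of_locallyConstant hloc hcomp
  -- Uniformity on the compact ball extends to all of K: outside it φ equals its value at infinity,
  -- and when only x + z lies inside, the bound is applied there with -z.
  have ht (x z : K) (hz : valuation K z ≤ valuation K (t : K)) :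
      (φ : PGL(2, K) → ℂ) (weyl K * unip (x + z)) = (φ : PGL(2, K) → ℂ) (weyl K * unip x) := by
    by_cases hx : valuation K x ≤ valuation K (t₀ : K)
    · exact ht₁ x hx z hz
    · by_cases hxz : valuation K (x + z) ≤ valuation K (t₀ : K)
      · have := ht₁ (x + z) hxz (-z) (by rwa [Valuation.map_neg])
        rw [add_neg_cancel_right] at this
        exact this.symm
      · rw [h₀ _ hx, h₀ _ hxz]
  let A : Finset (K ⧸ ballSubgroup t) := (finite_quotient_image t hcomp).toFinset
  have hA (x : K) (hx : valuation K x ≤ valuation K (t₀ : K)) :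
      (QuotientAddGroup.mk x : K ⧸ ballSubgroup t) ∈ A := by
    rw [Set.Finite.mem_toFinset]
    exact ⟨x, hx, rfl⟩
  have hout (x : K) : valuation K (-(QuotientAddGroup.mk x : K ⧸ ballSubgroup t).out + x) ≤
      valuation K (t : K) := by
    have := QuotientAddGroup.eq.1 (QuotientAddGroup.out_eq' (QuotientAddGroup.mk x : K ⧸ ballSubgroup t))
    exact this
  have key : φ - ∑ a ∈ A, ((φ : PGL(2, K) → ℂ) (weyl K * unip a.out) - (φ : PGL(2, K) → ℂ) 1) •
      projLineRep K (unip (-a.out) * torus t) (cellFn K) ∈ constFunctions K := by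
    refine ⟨(φ : PGL(2, K) → ℂ) 1, fun g => ?_⟩
    rw [Submodule.coe_sub, Pi.sub_apply, Submodule.coe_sum, Finset.sum_apply]
    simp only [Submodule.coe_smul, Pi.smul_apply, projLineRep_apply, cellFn_apply, smul_eq_mul]
    induction g using Matrix.ProjGenLinGroup.induction_on with | mk g =>
    simp only [mul_unip_torus_mem_bigCell]
    by_cases hc : g 1 0 = 0
    · have h0 : g 1 1 ≠ 0 := by
        intro h'
        have := ((Matrix.isUnit_iff_isUnit_det _).1 g.isUnit).ne_zero
        rw [Matrix.det_fin_two, h', hc] at this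
        simp at this
      rw [projLineFunctions_apply_mk_of_eq_zero φ hc]
      simp [hc, h0]
    · rw [projLineFunctions_apply_mk φ hc]
      have e (a : K ⧸ ballSubgroup t) :
          valuation K (g 1 0 * -a.out + g 1 1) ≤ valuation K (g 1 0 * (t : K)) ↔
            QuotientAddGroup.mk (g 1 1 / g 1 0) = a := by
        have hpos : (0 : ValueGroupWithZero K) < valuation K (g 1 0) :=
          zero_lt_iff.2 ((valuation K).ne_zero_iff.2 hc)
        have e1 : g 1 0 * -a.out + g 1 1 = g 1 0 * (-a.out + g 1 1 / g 1 0) := by field_simp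
        rw [e1, map_mul, map_mul, mul_le_mul_iff_right₀ hpos, ← mem_ballSubgroup,
          ← QuotientAddGroup.eq, QuotientAddGroup.out_eq', eq_comm]
      simp only [e, mul_ite, mul_one, mul_zero, Finset.sum_ite_eq]
      have h1 := ht (QuotientAddGroup.mk (g 1 1 / g 1 0) : K ⧸ ballSubgroup t).out _
        (hout (g 1 1 / g 1 0))
      rw [add_neg_cancel_left] at h1
      by_cases hm : (QuotientAddGroup.mk (g 1 1 / g 1 0) : K ⧸ ballSubgroup t) ∈ A
      · rw [if_pos hm, ← h1]; ring
      · rw [if_neg hm, h₀ _ (mt (hA _) hm), sub_zero]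
  rw [← Submodule.Quotient.mk_eq_zero, ← Submodule.mkQ_apply, map_sub, sub_eq_zero, map_sum] at key
  rw [key]
  refine Submodule.sum_mem _ fun a _ => ?_
  rw [map_smul]
  exact Submodule.smul_mem _ _ (Submodule.subset_span ⟨(-a.out, t), rfl⟩)

end Spanning

/-! ### Relations satisfied by the cell vector, and linear forms determined by them. -/

section Uniqueness

variable {K : Type*} [Field K] [ValuativeRel K] [TopologicalSpace K]
  [IsNonarchimedeanLocalField K] {V : Type*} [AddCommGroup V] [Module ℂ V]

/-- The vector `v` generates `ρ` in the same way as the indicator function of `𝒪[K]` generates the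
Steinberg representation twisted by the unramified character with value `ε` at `unif K`. -/
structure IsCellVector (ρ : Representation ℂ PGL(2, K) V) (ε : ℂ) (v : V) : Prop where
  apply_iwahori : ∀ k ∈ iwahori K, ρ k v = v
  eq_sum : v = ε • ∑ b : 𝓀[K], ρ (unip (resRep K b : K) * torus (unif K)) v
  apply_weyl : ρ (weyl K) v = -(ε • ρ (torus (unif K)) v)
  span : Submodule.span ℂ (Set.range fun p : K × Kˣ => ρ (unip p.1 * torus p.2) v) = ⊤
  ne_zero : v ≠ 0

/-- A function `E n x` on the balls with center `x` and radius `|unif K ^ n|` that satisfies the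
relations of an additive function invariant under the integral affine group vanishes if it vanishes
on the balls containing `𝒪[K]`. -/
theorem eq_zero_of_ball_relations {ε : ℂ} (hε : ε ≠ 0) {E : ℤ → K → ℂ}
    (E1 : ∀ (n : ℤ) (z x : K), valuation K z ≤ 1 → E n (z + x) = E n x)
    (E2 : ∀ (n : ℤ) (u : Kˣ) (x : K), valuation K (u : K) = 1 → E n (u * x) = E n x)
    (E3 : ∀ (n : ℤ) (x z : K), valuation K z ≤ valuation K ((unif K ^ n : Kˣ) : K) →
      E n (x + z) = E n x)
    (E4 : ∀ (n : ℤ) (x : K),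
      E n x = ε * ∑ b : 𝓀[K], E (n + 1) (x + resRep K b * (unif K ^ n : Kˣ)))
    (h0 : ∀ k : ℕ, E (-(k : ℤ)) 0 = 0) (n : ℤ) (x : K) : E n x = 0 := by
  classical
  have hq : (resCard K : ℂ) ≠ 0 := by exact_mod_cast (resCard_pos K).ne'
  have sum_const (n : ℤ) (x : K) (hx : ∀ b : 𝓀[K],
      E (n + 1) (x + resRep K b * (unif K ^ n : Kˣ)) = E (n + 1) x) (h0 : E n x = 0) :
      E (n + 1) x = 0 := by
    rw [E4] at h0
    simp only [hx, Finset.sum_const, Finset.card_univ, card_residueField, nsmul_eq_mul] at h0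
    simpa [hε, hq] using h0
  -- For n ≥ 0 the q balls of radius |ϖ^(n+1)| inside the ball of radius |ϖ^n| about 0 are
  -- translates of each other by elements of 𝒪, so the values for n + 1 and n differ by the nonzero
  -- factor εq.
  have E5 (n : ℤ) : E n 0 = 0 := by
    rcases le_total n 0 with hn | hn
    · obtain ⟨k, rfl⟩ := Int.exists_eq_neg_ofNat hn
      exact h0 k
    · induction n, hn using Int.leInduction with
      | base => exact h0 0
      | succ n hn ih =>
        refine sum_const n 0 (fun b => ?_) ih
        rw [add_comm (0 : K)]
        refine E1 _ _ _ ?_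
        rw [map_mul]
        refine mul_le_one' (valuation_resRep_le b) ?_
        rw [valuation_le_one_iff, ord_unif_zpow]
        exact hn
  have E6 (n : ℤ) (x : Kˣ) (hx : 0 ≤ ord x ∨ n ≤ ord x) : E n x = 0 := by
    rcases hx with hx | hx
    · rw [← add_zero (x : K), E1 _ _ _ ((valuation_le_one_iff x).2 hx), E5]
    · rw [← zero_add (x : K), E3, E5]
      rw [valuation_le_iff, ord_unif_zpow]
      exact hx
  -- Split the ball of radius |x| about 0. The part centred at 0 contributes 0; the other q - 1
  -- parts have centres that are unit multiples of x, so they contribute equally. Hence ε(q - 1)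
  -- times the value is 0.
  have E7 (x : Kˣ) (hx : ord x < 0) : E (ord x + 1) x = 0 := by
    have h1 := E5 (ord x)
    rw [E4] at h1
    have h2 (b : 𝓀[K]) : E (ord x + 1) (0 + resRep K b * (unif K ^ ord x : Kˣ)) =
        if b = 0 then 0 else E (ord x + 1) x := by
      rw [zero_add]
      by_cases hb : b = 0
      · rw [if_pos hb, ← zero_add ((resRep K b : K) * _), E3, E5]
        rw [zpow_add_one, ← valuation_lt_iff_le_mul_unif, map_mul]
        refine mul_lt_of_lt_one_left ?_ ((valuation_resRep_lt_one_iff b).2 hb)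
        exact zero_lt_iff.2 ((valuation K).ne_zero_iff.2 (Units.ne_zero _))
      · rw [if_neg hb]
        have hv : valuation K (resRep K b : K) = 1 :=
          le_antisymm (valuation_resRep_le b)
            (not_lt.1 (mt (valuation_resRep_lt_one_iff b).1 hb))
        have hne : (resRep K b : K) ≠ 0 := by
          intro h
          rw [h, map_zero] at hv
          exact zero_ne_one hv
        have := E2 (ord x + 1) (Units.mk0 _ hne * unif K ^ ord x * x⁻¹) x ?_
        · rwa [← Units.val_mul, inv_mul_cancel_right, Units.val_mul, Units.val_mk0] at this
        · rw [valuation_eq_one_iff, ord_mul, ord_mul, ord_inv, ord_unif_zpow,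
            (valuation_eq_one_iff _).1 hv]
          ring
    simp only [h2] at h1
    rw [Finset.sum_ite, Finset.sum_const_zero, zero_add, Finset.sum_const, nsmul_eq_mul,
      Finset.filter_ne' , Finset.card_erase_of_mem (Finset.mem_univ _), Finset.card_univ,
      card_residueField] at h1
    have hq1 : ((resCard K - 1 : ℕ) : ℂ) ≠ 0 := by
      have := one_lt_resCard (K := K)
      exact_mod_cast (by omega : resCard K - 1 ≠ 0)
    simpa [hε, hq1] using h1
  -- Subdivide further: all centres of the smaller balls have absolute value |x|, so they are unit
  -- multiples of x and the q parts again contribute equally.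
  have E8 (x : Kˣ) (hx : ord x < 0) (n : ℤ) (hn : ord x + 1 ≤ n) : E n x = 0 := by
    induction n, hn using Int.leInduction with
    | base => exact E7 x hx
    | succ n hn ih =>
      refine sum_const n x (fun b => ?_) ih
      have hlt : valuation K ((resRep K b : K) * (unif K ^ n : Kˣ)) < valuation K (x : K) := by
        rw [map_mul]
        refine (mul_le_of_le_one_left' (valuation_resRep_le b)).trans_lt ?_
        rw [valuation_lt_iff, ord_unif_zpow]
        omega
      have hv := Valuation.map_add_eq_of_lt_left _ hlt
      have hne : (x : K) + resRep K b * (unif K ^ n : Kˣ) ≠ 0 := by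
        intro h
        rw [h, map_zero] at hv
        exact x.ne_zero ((map_eq_zero _).1 hv.symm)
      have := E2 (n + 1) (Units.mk0 _ hne * x⁻¹) x ?_
      · rwa [← Units.val_mul, inv_mul_cancel_right, Units.val_mk0] at this
      · rw [Units.val_mul, Units.val_mk0, map_mul, hv, ← map_mul, ← Units.val_mul, mul_inv_cancel,
          Units.val_one, map_one]
  rcases eq_or_ne x 0 with rfl | hx
  · exact E5 n
  · by_cases hc : 0 ≤ ord (Units.mk0 x hx) ∨ n ≤ ord (Units.mk0 x hx)
    · exact E6 n _ hc
    · exact E8 (Units.mk0 x hx) (by omega) n (by omega)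

namespace IsCellVector

variable {ρ : Representation ℂ PGL(2, K) V} {ε : ℂ} {v : V}

/-- A linear form invariant under the integral upper triangular matrices vanishes if it vanishes
on the indicator functions of the fractional ideals containing `𝒪[K]`. -/
theorem linearMap_eq_zero (h : IsCellVector ρ ε v) (hε : ε ≠ 0) (L : V →ₗ[ℂ] ℂ)
    (hN : ∀ x : K, valuation K x ≤ 1 → ∀ w, L (ρ (unip x) w) = L w)
    (hA : ∀ t : Kˣ, valuation K (t : K) = 1 → ∀ w, L (ρ (torus t) w) = L w)
    (h0 : ∀ k : ℕ, L (ρ (torus (unif K ^ (-(k : ℤ)))) v) = 0) : L = 0 := by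
  -- In the Steinberg model this is, up to the twist, the value of L on the indicator function of
  -- the ball -x + ϖ^n 𝒪.
  set E : ℤ → K → ℂ := fun n x => L (ρ (unip x * torus (unif K ^ n)) v) with hE
  have E1 (n : ℤ) (z x : K) (hz : valuation K z ≤ 1) : E n (z + x) = E n x := by
    simp only [hE]
    rw [unip_add, mul_assoc, map_mul, Module.End.mul_apply, hN z hz]
  have E2 (n : ℤ) (u : Kˣ) (x : K) (hu : valuation K (u : K) = 1) : E n (u * x) = E n x := by
    simp only [hE]
    rw [← hA u hu (ρ (unip x * torus (unif K ^ n)) v), ← Module.End.mul_apply, ← map_mul,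
      ← mul_assoc, torus_mul_unip, mul_assoc, ← torus_mul, mul_comm u, torus_mul, ← mul_assoc,
      map_mul _ _ (torus u), Module.End.mul_apply, h.apply_iwahori _ (torus_mem_iwahori hu)]
  have E3 (n : ℤ) (x z : K) (hz : valuation K z ≤ valuation K ((unif K ^ n : Kˣ) : K)) :
      E n (x + z) = E n x := by
    simp only [hE]
    have hz' : valuation K (((unif K ^ n)⁻¹ : Kˣ) * z) ≤ 1 := by
      rw [map_mul, Units.val_inv_eq_inv_val, map_inv₀]
      exact inv_mul_le_one_of_le₀ hz zero_le
    have e : unip (x + z) * torus (unif K ^ n) =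
        unip x * torus (unif K ^ n) * unip (((unif K ^ n)⁻¹ : Kˣ) * z) := by
      rw [mul_assoc, torus_mul_unip, Units.mul_inv_cancel_left, ← mul_assoc, unip_add]
    rw [e, map_mul, Module.End.mul_apply, h.apply_iwahori _ (unip_mem_iwahori hz')]
  have E4 (n : ℤ) (x : K) :
      E n x = ε * ∑ b : 𝓀[K], E (n + 1) (x + resRep K b * (unif K ^ n : Kˣ)) := by
    simp only [hE]
    conv_lhs => rw [h.eq_sum]
    rw [map_smul, map_smul, map_sum, map_sum, smul_eq_mul]
    congr 1
    refine Finset.sum_congr rfl fun b _ => ?_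
    rw [← Module.End.mul_apply, ← map_mul, mul_assoc, ← mul_assoc (torus _), torus_mul_unip,
      mul_assoc, ← torus_mul, ← mul_assoc, ← unip_add, mul_comm _ (resRep K b : K), zpow_add_one]
  have hall := eq_zero_of_ball_relations hε E1 E2 E3 E4 fun k => by
    simp only [hE]
    rw [unip_zero, one_mul]
    exact h0 k
  refine LinearMap.ext_on_range h.span fun p => ?_
  -- Only powers of ϖ are needed: p.2 differs from ϖ^(ord p.2) by a unit, which the
  -- Iwahori-invariance of v absorbs.
  rw [LinearMap.zero_apply, ← hall (ord p.2) p.1]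
  simp only [hE]
  have ht : valuation K ((unif K ^ (-ord p.2) * p.2 : Kˣ) : K) = 1 := by
    rw [valuation_eq_one_iff, ord_mul, ord_unif_zpow, neg_add_cancel]
  have e : torus p.2 = torus (unif K ^ ord p.2) * torus (unif K ^ (-ord p.2) * p.2) := by
    rw [← torus_mul, ← mul_assoc, ← zpow_add, add_neg_cancel, zpow_zero, one_mul]
  rw [e, ← mul_assoc, map_mul, Module.End.mul_apply, h.apply_iwahori _ (torus_mem_iwahori ht)]

/-- Apply w, then a(ϖ^(-(k+1))), to the partition relation. Upper unipotents become lower ones and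
their entries get scaled by ϖ^(k+1), hence fall into the maximal ideal. An Iwahori-invariant linear
form therefore sees q equal terms on the right. -/
theorem smul_torus_unif (h : IsCellVector ρ ε v) (hε : ε ^ 2 = 1) (k : ℕ) :
    ε • ρ (torus (unif K ^ (-(k : ℤ)))) v = ∑ b : 𝓀[K],
      ρ (lowerUnip (-(resRep K b * (unif K ^ ((k : ℤ) + 1) : Kˣ) : K)))
        (ρ (torus (unif K ^ (-((k + 1 : ℕ) : ℤ)))) v) := by
  have h1 := congrArg (ρ (weyl K)) h.eq_sum
  rw [h.apply_weyl, map_smul, map_sum] at h1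
  have h2 (b : 𝓀[K]) : ρ (weyl K) (ρ (unip (resRep K b : K) * torus (unif K)) v) =
      -(ε • ρ (lowerUnip (-(resRep K b : K))) v) := by
    rw [← Module.End.mul_apply, ← map_mul, ← mul_assoc, weyl_mul_unip, mul_assoc, weyl_mul_torus,
      map_mul, map_mul, Module.End.mul_apply, Module.End.mul_apply, h.apply_weyl, map_neg, map_smul,
      ← Module.End.mul_apply (ρ (torus _)), ← map_mul, ← torus_mul, inv_mul_cancel, torus_one,
      map_one, Module.End.one_apply, map_neg, map_smul]
  simp only [h2] at h1
  rw [Finset.sum_neg_distrib, smul_neg, neg_inj, ← Finset.smul_sum, smul_smul, ← pow_two, hε,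
    one_smul] at h1
  have h3 := congrArg (ρ (torus (unif K ^ (-((k + 1 : ℕ) : ℤ))))) h1
  rw [map_smul, map_sum, ← Module.End.mul_apply, ← map_mul, ← torus_mul, ← zpow_add_one] at h3
  have e : (-((k + 1 : ℕ) : ℤ)) + 1 = -(k : ℤ) := by push_cast; ring
  rw [e] at h3
  rw [h3]
  refine Finset.sum_congr rfl fun b _ => ?_
  rw [← Module.End.mul_apply, ← map_mul, torus_mul_lowerUnip, map_mul, Module.End.mul_apply,
    ← zpow_neg, neg_neg]
  congr 4
  push_cast
  ring

end IsCellVector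

theorem detChar_iwahori {χ : Kˣ →* ℂˣ} (hχ : IsUnramified χ) (hχ2 : χ ^ 2 = 1) {k : PGL(2, K)}
    (hk : k ∈ iwahori K) : detChar χ hχ2 k = 1 := by
  rw [iwahori_eq_image] at hk
  obtain ⟨g, ⟨-, -, h⟩, rfl⟩ := hk
  exact hχ _ h

theorem steinbergTwist_apply (χ : Kˣ →* ℂˣ) (hχ2 : χ ^ 2 = 1) (g : PGL(2, K))
    (w : SteinbergSpace K) :
    steinbergTwist χ hχ2 g w = (detChar χ hχ2 g : ℂ) • steinberg K g w := rfl

theorem quadratic_sq {χ : Kˣ →* ℂˣ} (hχ2 : χ ^ 2 = 1) (a : Kˣ) : (χ a : ℂ) ^ 2 = 1 := by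
  have h := DFunLike.congr_fun hχ2 a
  rw [MonoidHom.pow_apply, MonoidHom.one_apply] at h
  rw [← Units.val_pow_eq_pow_val, h, Units.val_one]

/-- The determinant of an Iwahori matrix is a unit, so the twist does not affect invariance; in the
relations each a(ϖ) contributes χ(ϖ), which cancels the displayed coefficient because χ² = 1. -/
theorem isCellVector_steinbergTwist {χ : Kˣ →* ℂˣ} (hχ : IsUnramified χ) (hχ2 : χ ^ 2 = 1) :
    IsCellVector (steinbergTwist χ hχ2) (χ (unif K) : ℂ) (cellVec K) where
  apply_iwahori k hk := by
    rw [steinbergTwist_apply, detChar_iwahori hχ hχ2 hk, Units.val_one, one_smul,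
      steinberg_iwahori hk]
  eq_sum := by
    simp only [steinbergTwist_apply, map_mul (detChar χ hχ2), detChar_unip, detChar_torus, one_mul]
    rw [← Finset.smul_sum, smul_smul, ← pow_two, quadratic_sq hχ2, one_smul, ← cellVec_eq_sum]
  apply_weyl := by
    rw [steinbergTwist_apply, steinbergTwist_apply, detChar_weyl, detChar_torus, smul_smul,
      ← pow_two, quadratic_sq hχ2, one_smul, Units.val_one, one_smul, steinberg_weyl]
  span := by
    rw [eq_top_iff, ← span_borel_cellVec, Submodule.span_le]
    rintro _ ⟨p, rfl⟩
    have h : steinberg K (unip p.1 * torus p.2) (cellVec K) =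
        (χ p.2 : ℂ) • steinbergTwist χ hχ2 (unip p.1 * torus p.2) (cellVec K) := by
      rw [steinbergTwist_apply, map_mul (detChar χ hχ2), detChar_unip, detChar_torus, one_mul,
        smul_smul, ← pow_two, quadratic_sq hχ2, one_smul]
    beta_reduce
    rw [SetLike.mem_coe, h]
    exact Submodule.smul_mem _ _ (Submodule.subset_span ⟨p, rfl⟩)
  ne_zero := cellVec_ne_zero

theorem IsCellVector.equiv {V' : Type*} [AddCommGroup V'] [Module ℂ V']
    {ρ : Representation ℂ PGL(2, K) V} {ρ' : Representation ℂ PGL(2, K) V'} {ε : ℂ} {v : V}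
    (h : IsCellVector ρ ε v) (e : V ≃ₗ[ℂ] V') (he : ∀ g w, e (ρ g w) = ρ' g (e w)) :
    IsCellVector ρ' ε (e v) where
  apply_iwahori k hk := by rw [← he, h.apply_iwahori k hk]
  eq_sum := by
    simp only [← he]
    rw [← map_sum, ← map_smul, ← h.eq_sum]
  apply_weyl := by rw [← he, ← he, h.apply_weyl, map_neg, map_smul]
  span := by
    simp only [← he]
    rw [← Function.comp_def e, Set.range_comp, ← LinearEquiv.coe_coe, ← Submodule.map_span, h.span,
      Submodule.map_top, LinearEquiv.range]
  ne_zero := by simpa using h.ne_zero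

theorem IsWhittakerModel.exists_isCellVector {χ : Kˣ →* ℂˣ} (hχ : IsUnramified χ) {hχ2 : χ ^ 2 = 1}
    {ψ : AddChar K Circle} {𝒲 : Subrepresentation (rightTranslation K)}
    (h : IsWhittakerModel ψ (steinbergTwist χ hχ2) 𝒲) :
    ∃ v : 𝒲.toSubmodule, IsCellVector 𝒲.toRepresentation (χ (unif K) : ℂ) v := by
  obtain ⟨e⟩ := h.isoRep
  exact ⟨_, (isCellVector_steinbergTwist hχ hχ2).equiv e.toLinearEquiv fun g w =>
    DFunLike.congr_fun (e.isIntertwining' g) w⟩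

end Uniqueness

/-! ### The asymptotic class of Kirillov functions. -/

section KirillovClass

variable {K : Type*} [Field K] [ValuativeRel K] [TopologicalSpace K]
  [IsNonarchimedeanLocalField K]

theorem continuous_comp_ord {X : Type*} [TopologicalSpace X] (h : ℤ → X) :
    Continuous fun y : Kˣ => h (ord y) :=
  (continuous_of_discreteTopology (f := h)).comp (continuous_ord (K := K))

theorem IsUnramified.continuous {η : Kˣ →* ℂˣ} (hη : IsUnramified η) :
    Continuous fun y => (η y : ℂ) := by
  have : (fun y => (η y : ℂ)) = fun y => (fun n : ℤ => ((η (unif K) ^ n : ℂˣ) : ℂ)) (ord y) := by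
    ext y
    rw [hη.eq_zpow y]
  rw [this]
  exact continuous_comp_ord fun n : ℤ => ((η (unif K) ^ n : ℂˣ) : ℂ)

theorem norm_quadratic {η : Kˣ →* ℂˣ} (hη2 : η ^ 2 = 1) (y : Kˣ) : ‖(η y : ℂ)‖ = 1 := by
  have := congrArg norm (quadratic_sq hη2 y)
  rw [norm_pow, norm_one] at this
  exact (pow_eq_one_iff_of_nonneg (norm_nonneg _) two_ne_zero).1 this

theorem continuous_nabs_cpow (s : ℂ) : Continuous fun y : Kˣ => (nabs y : ℂ) ^ s :=
  continuous_comp_ord fun n => ((((resCard K : ℝ) ^ (-n) : ℝ)) : ℂ) ^ s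

theorem norm_nabs_cpow (y : Kˣ) (s : ℂ) : ‖(nabs y : ℂ) ^ s‖ = nabs y ^ s.re :=
  Complex.norm_cpow_eq_rpow_re_of_pos (nabs_pos y) s

theorem nabs_rpow (y : Kˣ) (t : ℝ) : nabs y ^ t = ((resCard K : ℝ) ^ (-t)) ^ ord y := by
  have hq : (0 : ℝ) < resCard K := by exact_mod_cast resCard_pos K
  unfold nabs
  rw [← Real.rpow_intCast, ← Real.rpow_mul hq.le, ← Real.rpow_intCast, ← Real.rpow_mul hq.le]
  push_cast
  ring_nf

theorem nabs_unif : nabs (unif K) = (resCard K : ℝ)⁻¹ := by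
  rw [nabs, ord_unif, zpow_neg_one]

/-- The functions on `Kˣ` that behave near `0` like the homogeneous function with factor `β` and
vanish near infinity. -/
def kirillovClass (K : Type*) [Field K] [ValuativeRel K] [TopologicalSpace K]
    [IsNonarchimedeanLocalField K] (β : ℂ) : Submodule ℂ (Kˣ → ℂ) where
  -- The bound by |y| reflects |β| = 1/q in the application; it gives square integrability and
  -- convergence of the zeta integral for Re s > 0.
  carrier := {f | Continuous f ∧ ∃ (C : ℝ) (N : ℕ), (∀ y, ‖f y‖ ≤ C * nabs y) ∧
    (∀ y, ord y < -(N : ℤ) → f y = 0) ∧ ∀ y, (N : ℤ) ≤ ord y → f (y * unif K) = β * f y}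
  add_mem' := by
    rintro f g ⟨hf, C, N, h1, h2, h3⟩ ⟨hg, C', N', h1', h2', h3'⟩
    refine ⟨hf.add hg, C + C', max N N', fun y => ?_, fun y hy => ?_, fun y hy => ?_⟩
    · rw [add_mul]
      exact (norm_add_le _ _).trans (add_le_add (h1 y) (h1' y))
    · rw [Pi.add_apply, h2 y (by omega), h2' y (by omega), add_zero]
    · rw [Pi.add_apply, Pi.add_apply, h3 y (by omega), h3' y (by omega), mul_add]
  zero_mem' := ⟨continuous_const, 0, 0, by simp⟩
  smul_mem' := by
    rintro c f ⟨hf, C, N, h1, h2, h3⟩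
    refine ⟨hf.const_smul c, ‖c‖ * C, N, fun y => ?_, fun y hy => ?_, fun y hy => ?_⟩
    · rw [Pi.smul_apply, norm_smul, mul_assoc]
      exact mul_le_mul_of_nonneg_left (h1 y) (norm_nonneg c)
    · rw [Pi.smul_apply, h2 y hy, smul_zero]
    · rw [Pi.smul_apply, Pi.smul_apply, h3 y hy, smul_eq_mul, smul_eq_mul]; ring

theorem conj_mem_kirillovClass {β : ℂ} (hβ : (starRingEnd ℂ) β = β) {f : Kˣ → ℂ}
    (hf : f ∈ kirillovClass K β) : (fun y => (starRingEnd ℂ) (f y)) ∈ kirillovClass K β := by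
  obtain ⟨hf, C, N, h1, h2, h3⟩ := hf
  refine ⟨Complex.continuous_conj.comp hf, C, N, fun y => ?_, fun y hy => ?_, fun y hy => ?_⟩
  · rw [RCLike.norm_conj]; exact h1 y
  · simp only [h2 y hy, map_zero]
  · simp only [h3 y hy, map_mul, hβ]

end KirillovClass

/-! ### Zeta integrals on the torus and their entire continuation. -/

section TorusMeasure

variable {K : Type*} [Field K] [ValuativeRel K] [TopologicalSpace K]
  [IsNonarchimedeanLocalField K] [MeasurableSpace Kˣ] [BorelSpace Kˣ]

theorem measurable_ord : Measurable (ord : Kˣ → ℤ) := continuous_ord.measurable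

theorem measure_ord_eq {ν : Measure Kˣ} [ν.IsHaarMeasure]
    (hν : ν {u : Kˣ | valuation K (u : K) = 1} = 1) (n : ℤ) : ν {a : Kˣ | ord a = n} = 1 := by
  rw [← hν, ← measure_preimage_mul ν (unif K ^ (-n)) {u : Kˣ | valuation K (u : K) = 1}]
  congr 1
  ext a
  rw [Set.mem_preimage, Set.mem_ofPred_eq, Set.mem_ofPred_eq, valuation_eq_one_iff, ord_mul,
    ord_unif_zpow]
  omega

/-- Every shell is a translate of the unit group, of volume 1, so integrating a function of `ord`
amounts to summing over ℤ. -/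
theorem map_ord {ν : Measure Kˣ} [ν.IsHaarMeasure]
    (hν : ν {u : Kˣ | valuation K (u : K) = 1} = 1) : ν.map ord = Measure.count := by
  refine Measure.ext_of_singleton fun n => ?_
  rw [Measure.map_apply measurable_ord (measurableSet_singleton n), Measure.count_singleton]
  exact measure_ord_eq hν n

theorem integrable_comp_ord {ν : Measure Kˣ} [ν.IsHaarMeasure]
    (hν : ν {u : Kˣ | valuation K (u : K) = 1} = 1) {h : ℤ → ℝ} (hs : Summable h) :
    Integrable (fun a => h (ord a)) ν := by
  have : Integrable h (ν.map ord) := by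
    rw [map_ord hν]
    exact integrable_count_iff.2 hs.norm
  exact this.comp_measurable measurable_ord

theorem summable_geometric_from {r : ℝ} (h0 : 0 < r) (h1 : r < 1) (C : ℝ) (N : ℕ) :
    Summable fun n : ℤ => if -(N : ℤ) ≤ n then C * r ^ n else 0 := by
  have hi : Function.Injective fun k : ℕ => (k : ℤ) - N := fun a b h => by simpa using h
  rw [← hi.summable_iff]
  · have : ((fun n : ℤ => if -(N : ℤ) ≤ n then C * r ^ n else 0) ∘ fun k : ℕ => (k : ℤ) - N) =
        fun k : ℕ => C * r ^ (-(N : ℤ)) * r ^ k := by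
      ext k
      rw [Function.comp_apply, if_pos (by omega), sub_eq_add_neg, add_comm, zpow_add₀ h0.ne',
        zpow_natCast, mul_assoc]
    rw [this]
    exact (summable_geometric_of_lt_one h0.le h1).mul_left _
  · intro n hn
    refine if_neg fun h => hn ⟨(n + N).toNat, ?_⟩
    simp only
    omega

theorem integrable_of_norm_le {ν : Measure Kˣ} [ν.IsHaarMeasure]
    (hν : ν {u : Kˣ | valuation K (u : K) = 1} = 1) {F : Kˣ → ℂ} (hF : Continuous F) {r C : ℝ}
    (h0 : 0 < r) (h1 : r < 1) {N : ℕ} (hb : ∀ y, ‖F y‖ ≤ C * r ^ ord y)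
    (hz : ∀ y, ord y < -(N : ℤ) → F y = 0) : Integrable F ν := by
  refine (integrable_comp_ord hν (summable_geometric_from h0 h1 C N)).mono'
    hF.aestronglyMeasurable (Filter.Eventually.of_forall fun y => ?_)
  split_ifs with h
  · exact hb y
  · rw [hz y (not_le.1 h), norm_zero]

theorem integrable_mul_conj {ν : Measure Kˣ} [ν.IsHaarMeasure]
    (hν : ν {u : Kˣ | valuation K (u : K) = 1} = 1) {β : ℂ} {f g : Kˣ → ℂ}
    (hf : f ∈ kirillovClass K β) (hg : g ∈ kirillovClass K β) :
    Integrable (fun y => f y * (starRingEnd ℂ) (g y)) ν := by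
  obtain ⟨hf, C, N, h1, h2, h3⟩ := hf
  obtain ⟨hg, C', N', h1', h2', h3'⟩ := hg
  have hq : (1 : ℝ) < resCard K := by exact_mod_cast one_lt_resCard (K := K)
  refine integrable_of_norm_le hν (hf.mul (Complex.continuous_conj.comp hg)) (C := C * C')
    (r := (resCard K : ℝ) ^ (-2 : ℝ)) (N := N) (Real.rpow_pos_of_pos (by linarith) _)
    (Real.rpow_lt_one_of_one_lt_of_neg hq (by norm_num)) (fun y => ?_) fun y hy => ?_
  · rw [norm_mul, RCLike.norm_conj, ← nabs_rpow, Real.rpow_two]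
    calc ‖f y‖ * ‖g y‖ ≤ (C * nabs y) * (C' * nabs y) :=
          mul_le_mul (h1 y) (h1' y) (norm_nonneg _) ((norm_nonneg _).trans (h1 y))
      _ = _ := by ring
  · rw [h2 y hy, zero_mul]

theorem integrable_mellin {ν : Measure Kˣ} [ν.IsHaarMeasure]
    (hν : ν {u : Kˣ | valuation K (u : K) = 1} = 1) {β : ℂ} {f : Kˣ → ℂ}
    (hf : f ∈ kirillovClass K β) {η : Kˣ →* ℂˣ} (hη : IsUnramified η) (hη2 : η ^ 2 = 1) {s : ℂ}
    (hs : 0 < s.re) : Integrable (fun y => f y * (η y : ℂ) * (nabs y : ℂ) ^ s) ν := by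
  obtain ⟨hf, C, N, h1, h2, h3⟩ := hf
  have hq : (1 : ℝ) < resCard K := by exact_mod_cast one_lt_resCard (K := K)
  refine integrable_of_norm_le hν ((hf.mul hη.continuous).mul (continuous_nabs_cpow s)) (C := C)
    (r := (resCard K : ℝ) ^ (-(1 + s.re))) (N := N) (Real.rpow_pos_of_pos (by linarith) _)
    (Real.rpow_lt_one_of_one_lt_of_neg hq (by linarith)) (fun y => ?_) fun y hy => ?_
  · rw [norm_mul, norm_mul, norm_quadratic hη2, mul_one, norm_nabs_cpow, ← nabs_rpow,
      Real.rpow_add (nabs_pos y), Real.rpow_one, ← mul_assoc]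
    exact mul_le_mul_of_nonneg_right (h1 y) (Real.rpow_nonneg (nabs_pos y).le _)
  · rw [h2 y hy, zero_mul, zero_mul]

/-- The difference `f(y) - β f(y / unif)`. -/
def euler (β : ℂ) (f : Kˣ → ℂ) (y : Kˣ) : ℂ := f y - β * f (y * (unif K)⁻¹)

theorem euler_smul (β c : ℂ) (f : Kˣ → ℂ) (y : Kˣ) :
    euler β (c • f) y = c * euler β f y := by
  simp only [euler, Pi.smul_apply, smul_eq_mul]; ring

/-- The value of the normalized zeta integral, as an integral over a compact set. -/
def regularPeriod (ν : Measure Kˣ) (β : ℂ) (η : Kˣ →* ℂˣ) (f : Kˣ → ℂ) (s : ℂ) : ℂ :=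
  ∫ y, euler β f y * (η y : ℂ) * (nabs y : ℂ) ^ s ∂ν

/-- The Euler difference removes the geometric tail at 0, where f(y) = βf(y/ϖ), and f already
vanishes near infinity. Homogeneity is applied at y/ϖ, whose order is still at least N when ord y >
N. -/
theorem exists_euler_eq_zero {β : ℂ} {f : Kˣ → ℂ} (hf : f ∈ kirillovClass K β) :
    Continuous (euler β f) ∧
      ∃ N : ℕ, ∀ y, ord y ∉ Finset.Icc (-(N : ℤ)) N → euler β f y = 0 := by
  obtain ⟨hf, C, N, h1, h2, h3⟩ := hf
  refine ⟨hf.sub (continuous_const.mul (hf.comp (continuous_mul_const _))), N, fun y hy => ?_⟩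
  rw [Finset.mem_Icc, not_and_or, not_le, not_le] at hy
  rcases hy with hy | hy
  · rw [euler, h2 y hy, h2 _ (by rw [ord_mul, ord_inv, ord_unif]; omega)]
    ring
  · have := h3 (y * (unif K)⁻¹) (by rw [ord_mul, ord_inv, ord_unif]; omega)
    rw [inv_mul_cancel_right] at this
    rw [euler, this, sub_self]

theorem norm_euler_le {β : ℂ} {f : Kˣ → ℂ} (hf : f ∈ kirillovClass K β) :
    ∃ C : ℝ, ∀ y, ‖euler β f y‖ ≤ C * nabs y := by
  obtain ⟨hf, C, N, h1, h2, h3⟩ := hf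
  refine ⟨C + ‖β‖ * (C * resCard K), fun y => ?_⟩
  refine (norm_sub_le _ _).trans ?_
  rw [add_mul]
  refine add_le_add (h1 y) ?_
  rw [norm_mul, mul_assoc]
  refine mul_le_mul_of_nonneg_left ((h1 _).trans_eq ?_) (norm_nonneg β)
  rw [nabs_mul, nabs, nabs, ord_inv, ord_unif, neg_neg, zpow_one]
  ring

theorem integrable_euler_shell {ν : Measure Kˣ} [ν.IsHaarMeasure]
    (hν : ν {u : Kˣ | valuation K (u : K) = 1} = 1) {β : ℂ} {f : Kˣ → ℂ}
    (hf : f ∈ kirillovClass K β) {η : Kˣ →* ℂˣ} (hη : IsUnramified η) (hη2 : η ^ 2 = 1) :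
    Integrable (fun y => euler β f y * (η y : ℂ)) ν := by
  obtain ⟨hc, N, hz⟩ := exists_euler_eq_zero hf
  obtain ⟨C, hC⟩ := norm_euler_le hf
  have hq : (1 : ℝ) < resCard K := by exact_mod_cast one_lt_resCard (K := K)
  refine integrable_of_norm_le hν (hc.mul hη.continuous) (C := C)
    (r := (resCard K : ℝ) ^ (-(1 : ℝ))) (N := N) (Real.rpow_pos_of_pos (by linarith) _)
    (Real.rpow_lt_one_of_one_lt_of_neg hq (by norm_num)) (fun y => ?_) fun y hy => ?_
  · rw [norm_mul, norm_quadratic hη2, mul_one, ← nabs_rpow, Real.rpow_one]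
    exact hC y
  · rw [hz y (by rw [Finset.mem_Icc]; omega), zero_mul]

/-- On a shell |y|^s is constant in y, so the integrand is a finite sum of exponentials in s with
coefficients independent of s; this is the source of holomorphy on all of ℂ. -/
theorem euler_mellin_eq_sum {β : ℂ} {f : Kˣ → ℂ} {η : Kˣ →* ℂˣ} {N : ℕ}
    (hz : ∀ y, ord y ∉ Finset.Icc (-(N : ℤ)) N → euler β f y = 0) (s : ℂ) (y : Kˣ) :
    euler β f y * (η y : ℂ) * (nabs y : ℂ) ^ s = ∑ n ∈ Finset.Icc (-(N : ℤ)) N,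
      (((resCard K : ℝ) ^ (-n) : ℝ) : ℂ) ^ s *
        {a : Kˣ | ord a = n}.indicator (fun y => euler β f y * (η y : ℂ)) y := by
  by_cases hy : ord y ∈ Finset.Icc (-(N : ℤ)) N
  · rw [Finset.sum_eq_single_of_mem _ hy]
    · rw [Set.indicator_of_mem (by rfl), nabs, mul_comm]
    · intro n _ hn
      rw [Set.indicator_of_notMem (fun h => hn h.symm), mul_zero]
  · rw [hz y hy]
    simp only [zero_mul]
    refine (Finset.sum_eq_zero fun n hn => ?_).symm
    rw [Set.indicator_of_notMem (fun h => hy (by rwa [← show ord y = n from h] at hn)), mul_zero]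

theorem measurableSet_ord_eq (n : ℤ) : MeasurableSet {a : Kˣ | ord a = n} :=
  measurable_ord (measurableSet_singleton n)

theorem integrable_euler_mellin {ν : Measure Kˣ} [ν.IsHaarMeasure]
    (hν : ν {u : Kˣ | valuation K (u : K) = 1} = 1) {β : ℂ} {f : Kˣ → ℂ}
    (hf : f ∈ kirillovClass K β) {η : Kˣ →* ℂˣ} (hη : IsUnramified η) (hη2 : η ^ 2 = 1) (s : ℂ) :
    Integrable (fun y => euler β f y * (η y : ℂ) * (nabs y : ℂ) ^ s) ν := by
  obtain ⟨hc, N, hz⟩ := exists_euler_eq_zero hf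
  simp only [euler_mellin_eq_sum hz s]
  exact integrable_finsetSum _ fun n _ =>
    ((integrable_euler_shell hν hf hη hη2).indicator (measurableSet_ord_eq n)).const_mul _

theorem differentiable_regularPeriod {ν : Measure Kˣ} [ν.IsHaarMeasure]
    (hν : ν {u : Kˣ | valuation K (u : K) = 1} = 1) {β : ℂ} {f : Kˣ → ℂ}
    (hf : f ∈ kirillovClass K β) {η : Kˣ →* ℂˣ} (hη : IsUnramified η) (hη2 : η ^ 2 = 1) :
    Differentiable ℂ (regularPeriod ν β η f) := by
  obtain ⟨hc, N, hz⟩ := exists_euler_eq_zero hf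
  have h : regularPeriod ν β η f = fun s => ∑ n ∈ Finset.Icc (-(N : ℤ)) N,
      (((resCard K : ℝ) ^ (-n) : ℝ) : ℂ) ^ s *
        ∫ y, {a : Kˣ | ord a = n}.indicator (fun y => euler β f y * (η y : ℂ)) y ∂ν := by
    ext s
    unfold regularPeriod
    simp only [euler_mellin_eq_sum hz s]
    rw [integral_finsetSum _ fun n _ =>
      ((integrable_euler_shell hν hf hη hη2).indicator (measurableSet_ord_eq n)).const_mul _]
    refine Finset.sum_congr rfl fun n _ => ?_
    rw [integral_const_mul]
  rw [h]
  refine Differentiable.fun_sum fun n _ => Differentiable.mul_const ?_ _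
  have hq : (0 : ℝ) < resCard K := by exact_mod_cast resCard_pos K
  refine Differentiable.const_cpow differentiable_id (Or.inl ?_)
  exact_mod_cast (zpow_pos hq _).ne'

/-- Replacing y by yϖ in the second term of the Euler difference produces the factor βη(ϖ)q^{-s}. -/
theorem regularPeriod_eq {ν : Measure Kˣ} [ν.IsHaarMeasure]
    (hν : ν {u : Kˣ | valuation K (u : K) = 1} = 1) {β : ℂ} {f : Kˣ → ℂ}
    (hf : f ∈ kirillovClass K β) {η : Kˣ →* ℂˣ} (hη : IsUnramified η) (hη2 : η ^ 2 = 1) {s : ℂ}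
    (hs : 0 < s.re) : regularPeriod ν β η f s =
      (1 - β * (η (unif K) : ℂ) * (resCard K : ℂ) ^ (-s)) *
        ∫ y, f y * (η y : ℂ) * (nabs y : ℂ) ^ s ∂ν := by
  have hI := integrable_mellin hν hf hη hη2 hs
  have hq : (0 : ℝ) < resCard K := by exact_mod_cast resCard_pos K
  have e (y : Kˣ) : euler β f y * (η y : ℂ) * (nabs y : ℂ) ^ s =
      f y * (η y : ℂ) * (nabs y : ℂ) ^ s - β * (η (unif K) : ℂ) * (resCard K : ℂ) ^ (-s) *
        (f (y * (unif K)⁻¹) * (η (y * (unif K)⁻¹) : ℂ) *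
          (nabs (y * (unif K)⁻¹) : ℂ) ^ s) := by
    have h1 : (η y : ℂ) = (η (y * (unif K)⁻¹) : ℂ) * (η (unif K) : ℂ) := by
      rw [← Units.val_mul, ← map_mul, inv_mul_cancel_right]
    have h2 : (nabs y : ℂ) ^ s = (nabs (y * (unif K)⁻¹) : ℂ) ^ s * (resCard K : ℂ) ^ (-s) := by
      have h3 : nabs y = nabs (y * (unif K)⁻¹) * (resCard K : ℝ)⁻¹ := by
        rw [← nabs_unif, ← nabs_mul, inv_mul_cancel_right]
      rw [h3, Complex.ofReal_mul, Complex.mul_cpow_ofReal_nonneg (nabs_pos _).le (inv_pos.2 hq).le,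
        Complex.ofReal_inv, Complex.inv_cpow, Complex.cpow_neg, Complex.ofReal_natCast]
      rw [Complex.ofReal_natCast, Complex.natCast_arg]
      exact Real.pi_pos.ne
    rw [euler, h1, h2]
    ring
  unfold regularPeriod
  simp only [e]
  rw [integral_sub hI ((hI.comp_mul_right (unif K)⁻¹).const_mul _), integral_const_mul,
    integral_mul_right_eq_self (fun y => f y * (η y : ℂ) * (nabs y : ℂ) ^ s) (unif K)⁻¹]
  ring

/-- Identity theorem: two entire functions agreeing on a right half plane are equal. It makes the
choice in `period` harmless. -/
theorem IsNormalizedPeriod.unique {ν : Measure Kˣ} {L : ℂ → ℂ} {η : Kˣ →* ℂˣ}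
    {W : PGL(2, K) → ℂ} {Λ Λ' : ℂ → ℂ} (h : IsNormalizedPeriod ν L η W Λ)
    (h' : IsNormalizedPeriod ν L η W Λ') : Λ = Λ' := by
  obtain ⟨hd, σ, hσ⟩ := h
  obtain ⟨hd', σ', hσ'⟩ := h'
  refine AnalyticOnNhd.eq_of_eventuallyEq (z₀ := ((max σ σ' + 1 : ℝ) : ℂ))
    (fun z _ => hd.analyticAt z) (fun z _ => hd'.analyticAt z) ?_
  have hopen : IsOpen {s : ℂ | max σ σ' < s.re} := isOpen_lt continuous_const Complex.continuous_re
  filter_upwards [hopen.mem_nhds (show max σ σ' < ((max σ σ' + 1 : ℝ) : ℂ).re from lt_add_one _)]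
    with s hs
  rw [(hσ s ((le_max_left _ _).trans_lt hs)).2, (hσ' s ((le_max_right _ _).trans_lt hs)).2]

theorem period_eq_regularPeriod {ν : Measure Kˣ} [ν.IsHaarMeasure]
    (hν : ν {u : Kˣ | valuation K (u : K) = 1} = 1) {β : ℂ} {W : PGL(2, K) → ℂ}
    (hf : (fun y => W (torus y)) ∈ kirillovClass K β) {η : Kˣ →* ℂˣ} (hη : IsUnramified η)
    (hη2 : η ^ 2 = 1) {L : ℂ → ℂ}
    (hL : ∀ s, (L (s + 1 / 2))⁻¹ = 1 - β * (η (unif K) : ℂ) * (resCard K : ℂ) ^ (-s)) (s : ℂ) :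
    period ν L η W s = regularPeriod ν β η (fun y => W (torus y)) s := by
  have h : IsNormalizedPeriod ν L η W (regularPeriod ν β η fun y => W (torus y)) := by
    refine ⟨differentiable_regularPeriod hν hf hη hη2, 0, fun s hs =>
      ⟨integrable_mellin hν hf hη hη2 hs, ?_⟩⟩
    rw [hL, regularPeriod_eq hν hf hη hη2 hs]
    rfl
  have hex : ∃ Λ : ℂ → ℂ, IsNormalizedPeriod ν L η W Λ := ⟨_, h⟩
  rw [period, dif_pos hex, hex.choose_spec.unique h]

end TorusMeasure

/-! ### The Kirillov function of the cell vector. -/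

section Kirillov

variable {K : Type*} [Field K] [ValuativeRel K] [TopologicalSpace K]
  [IsNonarchimedeanLocalField K] {ψ : AddChar K Circle}
  {𝒲 : Subrepresentation (rightTranslation K)} {ε : ℂ} {v : 𝒲.toSubmodule}

theorem toRepresentation_apply (g h : PGL(2, K)) (w : 𝒲.toSubmodule) :
    (𝒲.toRepresentation g w : PGL(2, K) → ℂ) h = (w : PGL(2, K) → ℂ) (h * g) := rfl

theorem HasConductorIntegers.eq_one (hψ : HasConductorIntegers ψ) {x : K} (hx : valuation K x ≤ 1) :
    ψ x = 1 := by
  simpa using (hψ x).2 hx 1 (Subring.one_mem _)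

namespace IsCellVector

theorem apply_mul_iwahori (h : IsCellVector 𝒲.toRepresentation ε v) (g : PGL(2, K))
    {k : PGL(2, K)} (hk : k ∈ iwahori K) :
    (v : PGL(2, K) → ℂ) (g * k) = (v : PGL(2, K) → ℂ) g := by
  rw [← toRepresentation_apply, h.apply_iwahori k hk]

/-- For z in 𝒪, invariance under n(z) gives (ψ(yz) - 1)v(a(y)) = 0, and for y outside 𝒪 the
conductor condition supplies a z with ψ(yz) ≠ 1. -/
theorem apply_torus_of_ord_neg (h : IsCellVector 𝒲.toRepresentation ε v)
    (hψ : HasConductorIntegers ψ)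
    (hW : ∀ W ∈ 𝒲.toSubmodule, ∀ (x : K) (g : PGL(2, K)), W (unip x * g) = ψ x * W g)
    {y : Kˣ} (hy : ord y < 0) : (v : PGL(2, K) → ℂ) (torus y) = 0 := by
  have hy' : ¬ ((y : K) ∈ 𝒪[K]) := by
    change ¬ valuation K (y : K) ≤ 1
    rw [valuation_le_one_iff]
    omega
  rw [← hψ] at hy'
  push Not at hy'
  obtain ⟨z, hz, hne⟩ := hy'
  have h1 := h.apply_mul_iwahori (torus y) (unip_mem_iwahori hz)
  rw [torus_mul_unip, hW _ v.2] at h1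
  have h2 : ((ψ ((y : K) * z) : ℂ) - 1) * (v : PGL(2, K) → ℂ) (torus y) = 0 := by
    rw [sub_mul, h1, one_mul, sub_self]
  refine (mul_eq_zero.1 h2).resolve_left fun h3 => hne ?_
  ext
  rw [sub_eq_zero.1 h3, Circle.coe_one]

/-- Evaluate the partition relation at a(y): for y integral every ψ(yb) is 1, so the q terms
coincide. -/
theorem apply_torus_mul_unif (h : IsCellVector 𝒲.toRepresentation ε v) (hε : ε ^ 2 = 1)
    (hψ : HasConductorIntegers ψ)
    (hW : ∀ W ∈ 𝒲.toSubmodule, ∀ (x : K) (g : PGL(2, K)), W (unip x * g) = ψ x * W g)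
    {y : Kˣ} (hy : 0 ≤ ord y) : (v : PGL(2, K) → ℂ) (torus (y * unif K)) =
      ε * (resCard K : ℂ)⁻¹ * (v : PGL(2, K) → ℂ) (torus y) := by
  have h1 : (v : PGL(2, K) → ℂ) (torus y) =
      ε * (resCard K * (v : PGL(2, K) → ℂ) (torus (y * unif K))) := by
    conv_lhs => rw [h.eq_sum]
    rw [Submodule.coe_smul, Pi.smul_apply, smul_eq_mul, Submodule.coe_sum, Finset.sum_apply]
    congr 1
    rw [← card_residueField, ← nsmul_eq_mul, ← Finset.card_univ, ← Finset.sum_const]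
    refine Finset.sum_congr rfl fun b _ => ?_
    rw [toRepresentation_apply, ← mul_assoc, torus_mul_unip, mul_assoc, ← torus_mul, hW _ v.2,
      hψ.eq_one, Circle.coe_one, one_mul]
    rw [map_mul]
    exact mul_le_one' ((valuation_le_one_iff y).2 hy) (valuation_resRep_le b)
  have hq : (resCard K : ℂ) ≠ 0 := by exact_mod_cast (resCard_pos K).ne'
  rw [h1]
  field_simp
  rw [hε, mul_one]

theorem apply_torus_mul_of_ord_eq_zero (h : IsCellVector 𝒲.toRepresentation ε v) (y : Kˣ) {t : Kˣ}
    (ht : ord t = 0) :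
    (v : PGL(2, K) → ℂ) (torus (y * t)) = (v : PGL(2, K) → ℂ) (torus y) := by
  rw [torus_mul, h.apply_mul_iwahori _ (torus_mem_iwahori ((valuation_eq_one_iff t).2 ht))]

/-- The Kirillov function of the cell vector. -/
theorem apply_torus (h : IsCellVector 𝒲.toRepresentation ε v) (hε : ε ^ 2 = 1)
    (hψ : HasConductorIntegers ψ)
    (hW : ∀ W ∈ 𝒲.toSubmodule, ∀ (x : K) (g : PGL(2, K)), W (unip x * g) = ψ x * W g) (y : Kˣ) :
    (v : PGL(2, K) → ℂ) (torus y) =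
      if 0 ≤ ord y then (v : PGL(2, K) → ℂ) 1 * (ε * (resCard K : ℂ)⁻¹) ^ ord y else 0 := by
  split_ifs with hy
  · have h1 : (v : PGL(2, K) → ℂ) (torus y) = (v : PGL(2, K) → ℂ) (torus (unif K ^ ord y)) := by
      have := h.apply_torus_mul_of_ord_eq_zero (unif K ^ ord y) (t := unif K ^ (-ord y) * y)
        (by rw [ord_mul, ord_unif_zpow]; omega)
      rwa [← mul_assoc, ← zpow_add, add_neg_cancel, zpow_zero, one_mul] at this
    rw [h1]
    obtain ⟨n, hn⟩ := Int.eq_ofNat_of_zero_le hy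
    rw [hn]
    clear hn h1 hy
    induction n with
    | zero => simp [torus_one]
    | succ n ih =>
      have := h.apply_torus_mul_unif hε hψ hW (y := unif K ^ (n : ℤ))
        (by rw [ord_unif_zpow]; omega)
      rw [← zpow_add_one] at this
      rw [Nat.cast_succ, this, ih, zpow_natCast, ← Nat.cast_succ, zpow_natCast, pow_succ]
      ring
  · exact h.apply_torus_of_ord_neg hψ hW (not_le.1 hy)

theorem norm_epsilon (hε : ε ^ 2 = 1) : ‖ε‖ = 1 := by
  have := congrArg norm hε
  rw [norm_pow, norm_one] at this
  exact (pow_eq_one_iff_of_nonneg (norm_nonneg _) two_ne_zero).1 this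

theorem conj_epsilon (hε : ε ^ 2 = 1) : (starRingEnd ℂ) ε = ε := by
  rcases eq_or_eq_neg_of_sq_eq_sq ε 1 (by rw [hε, one_pow]) with h | h <;> simp [h]

/-- Translation by n(x)a(t) replaces v(a(y)) by ψ(yx)v(a(yt)), and ψ(yx) = 1 for y near 0. -/
theorem mem_kirillovClass_borel (h : IsCellVector 𝒲.toRepresentation ε v) (hε : ε ^ 2 = 1)
    (hψc : Continuous ψ) (hψ : HasConductorIntegers ψ)
    (hW : ∀ W ∈ 𝒲.toSubmodule, ∀ (x : K) (g : PGL(2, K)), W (unip x * g) = ψ x * W g)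
    (x : K) (t : Kˣ) :
    (fun y => (𝒲.toRepresentation (unip x * torus t) v : PGL(2, K) → ℂ) (torus y)) ∈
      kirillovClass K (ε * (resCard K : ℂ)⁻¹) := by
  have e (y : Kˣ) : (𝒲.toRepresentation (unip x * torus t) v : PGL(2, K) → ℂ) (torus y) =
      ψ (y * x) * (v : PGL(2, K) → ℂ) (torus (y * t)) := by
    rw [toRepresentation_apply, ← mul_assoc, torus_mul_unip, mul_assoc, ← torus_mul, hW _ v.2]
  simp only [e]
  obtain ⟨n, hn⟩ : ∃ n : ℕ, valuation K x ≤ valuation K ((unif K ^ (-(n : ℤ)) : Kˣ) : K) := by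
    rcases eq_or_ne x 0 with rfl | hx
    · exact ⟨0, by simp⟩
    · refine ⟨(-ord (Units.mk0 x hx)).toNat, ?_⟩
      have := valuation_le_iff (Units.mk0 x hx) (unif K ^ (-((-ord (Units.mk0 x hx)).toNat : ℤ)))
      rw [Units.val_mk0] at this
      rw [this, ord_unif_zpow]
      omega
  have hpsi (y : Kˣ) (hy : (n : ℤ) ≤ ord y) : ψ (y * x) = 1 := by
    refine hψ.eq_one ?_
    rw [map_mul]
    calc valuation K (y : K) * valuation K x
        ≤ valuation K (y : K) * valuation K ((unif K ^ (-(n : ℤ)) : Kˣ) : K) := by gcongr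
      _ = valuation K ((y * unif K ^ (-(n : ℤ)) : Kˣ) : K) := by rw [Units.val_mul, map_mul]
      _ ≤ 1 := by
        rw [valuation_le_one_iff, ord_mul, ord_unif_zpow]
        omega
  have hq : (0 : ℝ) < resCard K := by exact_mod_cast resCard_pos K
  -- Here n makes ψ(yx) trivial once ord y ≥ n, and |ord t| absorbs the shift of the support by t.
  refine ⟨?_, ‖(v : PGL(2, K) → ℂ) 1‖ * nabs t, n + (ord t).natAbs, fun y => ?_, fun y hy => ?_,
    fun y hy => ?_⟩
  · have hcoe : Continuous fun z : Circle => (z : ℂ) := continuous_subtype_val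
    refine Continuous.mul ?_ ?_
    · exact hcoe.comp (hψc.comp (Units.continuous_val.mul continuous_const))
    · simp only [h.apply_torus hε hψ hW]
      exact (continuous_comp_ord fun n : ℤ => if 0 ≤ n then
        (v : PGL(2, K) → ℂ) 1 * (ε * (resCard K : ℂ)⁻¹) ^ n else 0).comp (continuous_mul_const t)
  · rw [norm_mul, Circle.norm_coe, one_mul, h.apply_torus hε hψ hW, mul_assoc, mul_comm (nabs t),
      ← nabs_mul]
    split_ifs
    · rw [norm_mul, norm_zpow, norm_mul, norm_epsilon hε, one_mul, norm_inv, Complex.norm_natCast,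
        nabs, inv_zpow']
    · rw [norm_zero]
      exact mul_nonneg (norm_nonneg _) (nabs_pos _).le
  · beta_reduce
    rw [h.apply_torus_of_ord_neg hψ hW, mul_zero]
    rw [ord_mul]
    omega
  · beta_reduce
    rw [hpsi y (by omega), hpsi _ (by rw [ord_mul, ord_unif]; omega), mul_right_comm y,
      h.apply_torus_mul_unif hε hψ hW (by rw [ord_mul]; omega)]
    ring

variable (𝒲) in
/-- Restriction of Whittaker functions to the diagonal torus. -/
def torusRestriction : 𝒲.toSubmodule →ₗ[ℂ] (Kˣ → ℂ) where
  toFun w y := (w : PGL(2, K) → ℂ) (torus y)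
  map_add' _ _ := rfl
  map_smul' _ _ := rfl

theorem torusRestriction_mem (h : IsCellVector 𝒲.toRepresentation ε v) (hε : ε ^ 2 = 1)
    (hψc : Continuous ψ) (hψ : HasConductorIntegers ψ)
    (hW : ∀ W ∈ 𝒲.toSubmodule, ∀ (x : K) (g : PGL(2, K)), W (unip x * g) = ψ x * W g)
    (w : 𝒲.toSubmodule) : torusRestriction 𝒲 w ∈ kirillovClass K (ε * (resCard K : ℂ)⁻¹) := by
  have : (⊤ : Submodule ℂ 𝒲.toSubmodule) ≤
      (kirillovClass K (ε * (resCard K : ℂ)⁻¹)).comap (torusRestriction 𝒲) := by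
    rw [← h.span, Submodule.span_le]
    rintro _ ⟨p, rfl⟩
    exact h.mem_kirillovClass_borel hε hψc hψ hW p.1 p.2
  exact this trivial

/-- If v(1) = 0, then v vanishes on the torus, so evaluation at 1 kills all n(x)a(t)v and, by
spanning, every W. Applied to the translates of v this gives v = 0. -/
theorem apply_one_ne_zero (h : IsCellVector 𝒲.toRepresentation ε v) (hε : ε ^ 2 = 1)
    (hψ : HasConductorIntegers ψ)
    (hW : ∀ W ∈ 𝒲.toSubmodule, ∀ (x : K) (g : PGL(2, K)), W (unip x * g) = ψ x * W g) :
    (v : PGL(2, K) → ℂ) 1 ≠ 0 := by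
  intro h0
  have h1 : (LinearMap.proj 1 : (PGL(2, K) → ℂ) →ₗ[ℂ] ℂ) ∘ₗ 𝒲.toSubmodule.subtype = 0 := by
    refine LinearMap.ext_on_range h.span fun p => ?_
    change (𝒲.toRepresentation (unip p.1 * torus p.2) v : PGL(2, K) → ℂ) 1 = 0
    rw [toRepresentation_apply, one_mul, hW _ v.2, h.apply_torus hε hψ hW, h0]
    simp
  refine h.ne_zero (Subtype.ext (funext fun g => ?_))
  have := DFunLike.congr_fun h1 (𝒲.toRepresentation g v)
  change (𝒲.toRepresentation g v : PGL(2, K) → ℂ) 1 = 0 at this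
  rwa [toRepresentation_apply, one_mul] at this

end IsCellVector

end Kirillov

/-! ### Explicit periods and inner products on the torus. -/

section Pairing

variable {K : Type*} [Field K] [ValuativeRel K] [TopologicalSpace K]
  [IsNonarchimedeanLocalField K] [MeasurableSpace Kˣ] [BorelSpace Kˣ]

theorem integral_indicator_ord {ν : Measure Kˣ} [ν.IsHaarMeasure]
    (hν : ν {u : Kˣ | valuation K (u : K) = 1} = 1) (a : ℂ) (n : ℤ) :
    ∫ y : Kˣ, (if ord y = n then a else 0) ∂ν = a := by
  have : (fun y : Kˣ => if ord y = n then a else 0) = {y : Kˣ | ord y = n}.indicator fun _ => a := by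
    ext y
    by_cases h : ord y = n
    · rw [if_pos h, Set.indicator_of_mem (by exact h)]
    · rw [if_neg h, Set.indicator_of_notMem (by exact h)]
  rw [this, integral_indicator_const _ (measurableSet_ord_eq n), measureReal_def,
    measure_ord_eq hν, ENNReal.toReal_one, one_smul]

theorem euler_geometric {β : ℂ} (hβ : β ≠ 0) (a : ℂ) (y : Kˣ) :
    euler β (fun y => if 0 ≤ ord y then a * β ^ ord y else 0) y = if ord y = 0 then a else 0 := by
  simp only [euler, ord_mul, ord_inv, ord_unif]
  rcases lt_trichotomy (ord y) 0 with h | h | h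
  · rw [if_neg (by omega), if_neg (by omega), if_neg (by omega)]; ring
  · rw [if_pos (by omega), if_neg (by omega), if_pos h, h]; simp
  · rw [if_pos (by omega), if_pos (by omega), if_neg (by omega), ← sub_eq_add_neg,
      zpow_sub_one₀ hβ]
    field_simp
    simp

theorem IsUnramified.apply_eq_one {η : Kˣ →* ℂˣ} (hη : IsUnramified η) {y : Kˣ} (hy : ord y = 0) :
    η y = 1 := hη y ((valuation_eq_one_iff y).2 hy)

theorem regularPeriod_geometric {ν : Measure Kˣ} [ν.IsHaarMeasure]
    (hν : ν {u : Kˣ | valuation K (u : K) = 1} = 1) {β : ℂ} (hβ : β ≠ 0) (a : ℂ) {η : Kˣ →* ℂˣ}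
    (hη : IsUnramified η) (s : ℂ) :
    regularPeriod ν β η (fun y => if 0 ≤ ord y then a * β ^ ord y else 0) s = a := by
  unfold regularPeriod
  refine Eq.trans ?_ (integral_indicator_ord hν a 0)
  congr 1
  ext y
  rw [euler_geometric hβ]
  by_cases h : ord y = 0
  · rw [if_pos h, hη.apply_eq_one h, nabs, h]
    simp
  · rw [if_neg h, zero_mul, zero_mul]

/-- A change of variable; it produces η(ϖ)⁻¹, which is η(ϖ) because η is quadratic. -/
theorem regularPeriod_mul_unif {ν : Measure Kˣ} [ν.IsHaarMeasure] (β : ℂ) (f : Kˣ → ℂ)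
    {η : Kˣ →* ℂˣ} (hη2 : η ^ 2 = 1) (s : ℂ) :
    regularPeriod ν β η (fun y => f (y * unif K)) s =
      (η (unif K) : ℂ) * (resCard K : ℂ) ^ s * regularPeriod ν β η f s := by
  have hq : (0 : ℝ) < resCard K := by exact_mod_cast resCard_pos K
  unfold regularPeriod
  rw [← integral_const_mul,
    ← integral_mul_right_eq_self (fun y => (η (unif K) : ℂ) * (resCard K : ℂ) ^ s *
      (euler β f y * (η y : ℂ) * (nabs y : ℂ) ^ s)) (unif K)]
  congr 1
  ext y
  have e1 : euler β (fun y => f (y * unif K)) y = euler β f (y * unif K) := by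
    simp only [euler, inv_mul_cancel_right, mul_inv_cancel_right]
  have e2 : (nabs (y * unif K) : ℂ) ^ s * (resCard K : ℂ) ^ s = (nabs y : ℂ) ^ s := by
    have h3 : nabs y = nabs (y * unif K) * resCard K := by
      rw [nabs_mul, nabs_unif, inv_mul_cancel_right₀ hq.ne']
    conv_rhs => rw [h3]
    rw [Complex.ofReal_mul, Complex.mul_cpow_ofReal_nonneg (nabs_pos _).le hq.le,
      Complex.ofReal_natCast]
  have e3 := quadratic_sq hη2 (unif K)
  rw [e1, ← e2, map_mul, Units.val_mul]
  linear_combination (-(euler β f (y * unif K) * (η y : ℂ) * (nabs (y * unif K) : ℂ) ^ s *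
    (resCard K : ℂ) ^ s)) * e3

/-- The inner product of `L²(Kˣ)`. -/
def torusPairing (ν : Measure Kˣ) (f g : Kˣ → ℂ) : ℂ := ∫ y, f y * (starRingEnd ℂ) (g y) ∂ν

theorem torusPairing_mul_right {ν : Measure Kˣ} [ν.IsHaarMeasure] (f g : Kˣ → ℂ) (t : Kˣ) :
    torusPairing ν (fun y => f (y * t)) (fun y => g (y * t)) = torusPairing ν f g :=
  integral_mul_right_eq_self (fun y => f y * (starRingEnd ℂ) (g y)) t

theorem torusPairing_conj (ν : Measure Kˣ) (f g : Kˣ → ℂ) :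
    (starRingEnd ℂ) (torusPairing ν f g) = torusPairing ν g f := by
  unfold torusPairing
  rw [← integral_conj]
  congr 1
  ext y
  rw [map_mul, Complex.conj_conj, mul_comm]

/-- The function f is its part on the unit shell plus β times its shift, and the two have disjoint
supports. Hence its squared norm I satisfies I = |a|² + β²I. -/
theorem torusPairing_self_geometric {ν : Measure Kˣ} [ν.IsHaarMeasure]
    (hν : ν {u : Kˣ | valuation K (u : K) = 1} = 1) {β : ℂ} (hβ : β ≠ 0)
    (hβ' : (starRingEnd ℂ) β = β) (a : ℂ)
    (hf : (fun y : Kˣ => if 0 ≤ ord y then a * β ^ ord y else 0) ∈ kirillovClass K β) :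
    (1 - β ^ 2) * torusPairing ν (fun y : Kˣ => if 0 ≤ ord y then a * β ^ ord y else 0)
      (fun y : Kˣ => if 0 ≤ ord y then a * β ^ ord y else 0) = a * (starRingEnd ℂ) a := by
  set f : Kˣ → ℂ := fun y : Kˣ => if 0 ≤ ord y then a * β ^ ord y else 0 with hfdef
  have hI := integrable_mul_conj hν hf hf
  have h1 := integral_mul_right_eq_self (μ := ν) (fun y => f y * (starRingEnd ℂ) (f y)) (unif K)⁻¹
  have h2 := integral_sub hI ((hI.comp_mul_right (unif K)⁻¹).const_mul (β ^ 2))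
  rw [integral_const_mul, h1] at h2
  unfold torusPairing
  rw [sub_mul, one_mul, ← h2, ← integral_indicator_ord hν (a * (starRingEnd ℂ) a) 0]
  congr 1
  ext y
  have e : f y = (if ord y = 0 then a else 0) + β * f (y * (unif K)⁻¹) := by
    rw [← euler_geometric hβ a y, euler]
    ring
  by_cases h : ord y = 0
  · have e2 : f (y * (unif K)⁻¹) = 0 := by
      rw [hfdef]
      simp only [ord_mul, ord_inv, ord_unif]
      rw [if_neg (by omega)]
    rw [if_pos h] at e ⊢
    rw [e, e2]
    simp
  · rw [if_neg h] at e ⊢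
    rw [e, zero_add, map_mul, hβ']
    ring

variable {𝒲 : Subrepresentation (rightTranslation K)}

theorem regularPeriod_linearCombination {ν : Measure Kˣ} [ν.IsHaarMeasure]
    (hν : ν {u : Kˣ | valuation K (u : K) = 1} = 1) {β : ℂ} {ι : Type*} (s : Finset ι) (c : ι → ℂ)
    {f : ι → Kˣ → ℂ} (hf : ∀ i, f i ∈ kirillovClass K β) {η : Kˣ →* ℂˣ} (hη : IsUnramified η)
    (hη2 : η ^ 2 = 1) (z : ℂ) :
    regularPeriod ν β η (∑ i ∈ s, c i • f i) z = ∑ i ∈ s, c i * regularPeriod ν β η (f i) z := by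
  unfold regularPeriod
  simp only [← integral_const_mul]
  rw [← integral_finsetSum _ fun i _ => (integrable_euler_mellin hν (hf i) hη hη2 z).const_mul _]
  congr 1
  ext y
  have e : euler β (∑ i ∈ s, c i • f i) y = ∑ i ∈ s, c i * euler β (f i) y := by
    simp only [euler, Finset.sum_apply, Pi.smul_apply, smul_eq_mul, mul_sub, Finset.mul_sum,
      Finset.sum_sub_distrib]
    congr 1
    exact Finset.sum_congr rfl fun i _ => by ring
  rw [e, Finset.sum_mul, Finset.sum_mul]
  exact Finset.sum_congr rfl fun i _ => by ring

/-- The pairing of Whittaker functions on the torus with a fixed function, as a linear form. -/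
def torusPairingForm {ν : Measure Kˣ} [ν.IsHaarMeasure]
    (hν : ν {u : Kˣ | valuation K (u : K) = 1} = 1) {β : ℂ}
    (h𝒲 : ∀ w, IsCellVector.torusRestriction 𝒲 w ∈ kirillovClass K β) {g : Kˣ → ℂ}
    (hg : g ∈ kirillovClass K β) : 𝒲.toSubmodule →ₗ[ℂ] ℂ where
  toFun w := torusPairing ν (IsCellVector.torusRestriction 𝒲 w) g
  map_add' w w' := by
    unfold torusPairing
    rw [map_add, ← integral_add (integrable_mul_conj hν (h𝒲 w) hg)
      (integrable_mul_conj hν (h𝒲 w') hg)]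
    congr 1
    ext y
    rw [Pi.add_apply, add_mul]
  map_smul' c w := by
    unfold torusPairing
    rw [map_smul, RingHom.id_apply, smul_eq_mul, ← integral_const_mul]
    congr 1
    ext y
    rw [Pi.smul_apply, smul_eq_mul, mul_assoc]

namespace IsCellVector

variable {ψ : AddChar K Circle} {ε : ℂ} {v : 𝒲.toSubmodule}

/-- On the support of v the variable y is integral, and there n(x) acts through ψ(yx) = 1. -/
theorem torusPairing_unip (h : IsCellVector 𝒲.toRepresentation ε v) (ν : Measure Kˣ)
    (hψ : HasConductorIntegers ψ)
    (hW : ∀ W ∈ 𝒲.toSubmodule, ∀ (x : K) (g : PGL(2, K)), W (unip x * g) = ψ x * W g)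
    {x : K} (hx : valuation K x ≤ 1) (w : 𝒲.toSubmodule) :
    torusPairing ν (torusRestriction 𝒲 (𝒲.toRepresentation (unip x) w)) (torusRestriction 𝒲 v) =
      torusPairing ν (torusRestriction 𝒲 w) (torusRestriction 𝒲 v) := by
  unfold torusPairing
  congr 1
  ext y
  change (𝒲.toRepresentation (unip x) w : PGL(2, K) → ℂ) (torus y) *
    (starRingEnd ℂ) ((v : PGL(2, K) → ℂ) (torus y)) = (w : PGL(2, K) → ℂ) (torus y) *
    (starRingEnd ℂ) ((v : PGL(2, K) → ℂ) (torus y))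
  by_cases hy : ord y < 0
  · rw [h.apply_torus_of_ord_neg hψ hW hy]
    simp
  · rw [toRepresentation_apply, torus_mul_unip, hW _ w.2, hψ.eq_one, Circle.coe_one, one_mul]
    rw [map_mul]
    exact mul_le_one' ((valuation_le_one_iff y).2 (not_lt.1 hy)) hx

theorem torusPairing_torus (ν : Measure Kˣ) [ν.IsHaarMeasure] (t : Kˣ)
    (w w' : 𝒲.toSubmodule) :
    torusPairing ν (torusRestriction 𝒲 (𝒲.toRepresentation (torus t) w))
        (torusRestriction 𝒲 (𝒲.toRepresentation (torus t) w')) =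
      torusPairing ν (torusRestriction 𝒲 w) (torusRestriction 𝒲 w') := by
  rw [← torusPairing_mul_right (torusRestriction 𝒲 w) (torusRestriction 𝒲 w') t]
  simp only [torusRestriction, LinearMap.coe_mk, AddHom.coe_mk, toRepresentation_apply, torus_mul]

/-- Shift both arguments by a(ϖ). The first is supported where ord y ≥ k, in particular on integral
y, and there the shifted second argument is β times the original one. -/
theorem torusPairing_unif_zpow (h : IsCellVector 𝒲.toRepresentation ε v) (hε : ε ^ 2 = 1)
    {ν : Measure Kˣ} [ν.IsHaarMeasure] (hψ : HasConductorIntegers ψ)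
    (hW : ∀ W ∈ 𝒲.toSubmodule, ∀ (x : K) (g : PGL(2, K)), W (unip x * g) = ψ x * W g) (k : ℕ) :
    torusPairing ν
        (torusRestriction 𝒲 (𝒲.toRepresentation (torus (unif K ^ (-((k + 1 : ℕ) : ℤ)))) v))
        (torusRestriction 𝒲 v) =
      ε * (resCard K : ℂ)⁻¹ *
        torusPairing ν (torusRestriction 𝒲 (𝒲.toRepresentation (torus (unif K ^ (-(k : ℤ)))) v))
          (torusRestriction 𝒲 v) := by
  rw [← torusPairing_torus ν (unif K)]
  unfold torusPairing
  rw [← integral_const_mul]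
  congr 1
  ext y
  rw [← Module.End.mul_apply, ← map_mul, ← torus_mul, mul_comm (unif K), ← zpow_add_one]
  have e : (-((k + 1 : ℕ) : ℤ)) + 1 = -(k : ℤ) := by push_cast; ring
  rw [e]
  change (v : PGL(2, K) → ℂ) (torus y * torus (unif K ^ (-(k : ℤ)))) *
    (starRingEnd ℂ) ((v : PGL(2, K) → ℂ) (torus y * torus (unif K))) = _ *
    ((v : PGL(2, K) → ℂ) (torus y * torus (unif K ^ (-(k : ℤ)))) *
    (starRingEnd ℂ) ((v : PGL(2, K) → ℂ) (torus y)))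
  rw [← torus_mul, ← torus_mul]
  by_cases hy : ord y < k
  · rw [h.apply_torus_of_ord_neg hψ hW (y := y * _) (by rw [ord_mul, ord_unif_zpow]; omega)]
    simp
  · rw [h.apply_torus_mul_unif hε hψ hW (by omega), map_mul, map_mul, conj_epsilon hε, map_inv₀,
      map_natCast]
    ring

theorem beta_ne_zero (hε : ε ^ 2 = 1) : ε * (resCard K : ℂ)⁻¹ ≠ 0 := by
  have hq : (resCard K : ℂ) ≠ 0 := by exact_mod_cast (resCard_pos K).ne'
  refine mul_ne_zero (fun h => ?_) (inv_ne_zero hq)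
  rw [h] at hε
  norm_num at hε

theorem conj_beta (hε : ε ^ 2 = 1) :
    (starRingEnd ℂ) (ε * (resCard K : ℂ)⁻¹) = ε * (resCard K : ℂ)⁻¹ := by
  rw [map_mul, conj_epsilon hε, map_inv₀, map_natCast]

theorem torusRestriction_eq (h : IsCellVector 𝒲.toRepresentation ε v) (hε : ε ^ 2 = 1)
    (hψ : HasConductorIntegers ψ)
    (hW : ∀ W ∈ 𝒲.toSubmodule, ∀ (x : K) (g : PGL(2, K)), W (unip x * g) = ψ x * W g) :
    torusRestriction 𝒲 v = fun y =>
      if 0 ≤ ord y then (v : PGL(2, K) → ℂ) 1 * (ε * (resCard K : ℂ)⁻¹) ^ ord y else 0 :=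
  funext (h.apply_torus hε hψ hW)

theorem torusPairing_self (h : IsCellVector 𝒲.toRepresentation ε v) (hε : ε ^ 2 = 1)
    {ν : Measure Kˣ} [ν.IsHaarMeasure] (hν : ν {u : Kˣ | valuation K (u : K) = 1} = 1)
    (hψc : Continuous ψ) (hψ : HasConductorIntegers ψ)
    (hW : ∀ W ∈ 𝒲.toSubmodule, ∀ (x : K) (g : PGL(2, K)), W (unip x * g) = ψ x * W g) :
    (1 - (resCard K : ℂ)⁻¹ ^ 2) *
        torusPairing ν (torusRestriction 𝒲 v) (torusRestriction 𝒲 v) =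
      (v : PGL(2, K) → ℂ) 1 * (starRingEnd ℂ) ((v : PGL(2, K) → ℂ) 1) := by
  have hm := h.torusRestriction_mem hε hψc hψ hW v
  rw [h.torusRestriction_eq hε hψ hW] at hm ⊢
  rw [← torusPairing_self_geometric hν (beta_ne_zero hε) (conj_beta hε) _ hm, mul_pow, hε, one_mul]

end IsCellVector

end Pairing

/-! ### The elements needed have trivial modular character. -/

section Unimodular

variable {K : Type*} [Field K] [ValuativeRel K] [TopologicalSpace K]
  [IsNonarchimedeanLocalField K]

theorem isClopen_iwahori : IsClopen (iwahori K) :=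
  ⟨(iwahoriSubgroup K).isClosed_of_isOpen isOpen_iwahori, isOpen_iwahori⟩

instance instLocallyCompactSpacePGL : LocallyCompactSpace PGL(2, K) :=
  isCompact_iwahori.locallyCompactSpace_of_mem_nhds_of_group (x := 1)
    (isOpen_iwahori.mem_nhds (iwahoriSubgroup K).one_mem)

theorem mul_mem_iwahori_iff {g k : PGL(2, K)} (hk : k ∈ iwahori K) :
    g * k ∈ iwahori K ↔ g ∈ iwahori K :=
  (iwahoriSubgroup K).mul_mem_cancel_right hk

variable [MeasurableSpace PGL(2, K)] [BorelSpace PGL(2, K)]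

theorem integral_mul_right_real (μ : Measure PGL(2, K)) [μ.IsHaarMeasure] (k : PGL(2, K))
    {f : PGL(2, K) → ℝ} (hf : Continuous f) (hf' : HasCompactSupport f) :
    ∫ g, f (g * k) ∂μ = Measure.modularCharacter k * ∫ g, f g ∂μ := by
  have h := Measure.integral_isMulLeftInvariant_eq_smul_of_hasCompactSupport
    (μ.map (· * k)) μ hf hf'
  rw [integral_map (measurable_mul_const k).aemeasurable hf.aestronglyMeasurable,
    ← Measure.modularCharacterFun_eq_haarScalarFactor, integral_smul_nnreal_measure] at h
  exact h

theorem iwahori_indicator_mul {k : PGL(2, K)} (hk : k ∈ iwahori K) {M : Type*} [Zero M] [One M]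
    (g : PGL(2, K)) :
    (iwahori K).indicator (1 : PGL(2, K) → M) (g * k) = (iwahori K).indicator 1 g := by
  by_cases hg : g ∈ iwahori K
  · rw [Set.indicator_of_mem hg, Set.indicator_of_mem ((mul_mem_iwahori_iff hk).2 hg)]; rfl
  · rw [Set.indicator_of_notMem hg, Set.indicator_of_notMem (mt (mul_mem_iwahori_iff hk).1 hg)]

theorem measure_iwahori_pos (μ : Measure PGL(2, K)) [μ.IsHaarMeasure] :
    0 < (μ (iwahori K)).toReal :=
  ENNReal.toReal_pos
    (isOpen_iwahori.measure_pos μ ⟨1, (iwahoriSubgroup K).one_mem⟩).ne' isCompact_iwahori.measure_ne_top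

/-- Right translation by k preserves the Iwahori subgroup, whose volume is finite and nonzero. -/
theorem modularCharacter_iwahori {k : PGL(2, K)} (hk : k ∈ iwahori K) :
    Measure.modularCharacter k = 1 := by
  have hc : Continuous ((iwahori K).indicator (1 : PGL(2, K) → ℝ)) :=
    (LocallyConstant.charFn ℝ isClopen_iwahori).continuous
  have h := integral_mul_right_real Measure.haar k hc
    (HasCompactSupport.intro isCompact_iwahori fun x hx => Set.indicator_of_notMem hx _)
  simp only [iwahori_indicator_mul hk] at h
  rw [integral_indicator_one isOpen_iwahori.measurableSet, measureReal_def] at h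
  have hpos := measure_iwahori_pos (K := K) Measure.haar
  have := mul_right_cancel₀ hpos.ne' ((one_mul _).trans h)
  exact_mod_cast this.symm

theorem modularCharacter_weyl : Measure.modularCharacter (weyl K) = 1 := by
  have h := map_mul (Measure.modularCharacter (G := PGL(2, K))) (weyl K) (weyl K)
  rw [weyl_mul_weyl, map_one, ← pow_two] at h
  exact (pow_eq_one_iff_of_nonneg zero_le two_ne_zero).1 h.symm

/-- Conjugation by w inverts a(t), so its modular value is a nonnegative number equal to its own
inverse. -/
theorem modularCharacter_torus (t : Kˣ) : Measure.modularCharacter (torus t) = 1 := by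
  have h := congrArg (Measure.modularCharacter (G := PGL(2, K))) (weyl_mul_torus t)
  rw [map_mul, map_mul, modularCharacter_weyl, one_mul, mul_one] at h
  have h2 := map_mul (Measure.modularCharacter (G := PGL(2, K))) (torus t) (torus t⁻¹)
  rw [← torus_mul, mul_inv_cancel, torus_one, map_one, ← h, ← pow_two] at h2
  exact (pow_eq_one_iff_of_nonneg zero_le two_ne_zero).1 h2.symm

theorem integral_mul_right_of_modularCharacter (μ : Measure PGL(2, K)) [μ.IsHaarMeasure]
    {k : PGL(2, K)} (hk : Measure.modularCharacter k = 1)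
    {f : PGL(2, K) → ℂ} (hf : Continuous f) (hf' : HasCompactSupport f) :
    ∫ g, f (g * k) ∂μ = ∫ g, f g ∂μ := by
  have hi := hf.integrable_of_hasCompactSupport (μ := μ) hf'
  have hi' : Integrable (fun g => f (g * k)) μ :=
    (hf.comp (continuous_mul_const k)).integrable_of_hasCompactSupport
      (hf'.comp_homeomorph (Homeomorph.mulRight k))
  have hre := integral_mul_right_real μ k (Complex.continuous_re.comp hf)
    (hf'.comp_left Complex.zero_re)
  have him := integral_mul_right_real μ k (Complex.continuous_im.comp hf)
    (hf'.comp_left Complex.zero_im)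
  rw [hk, NNReal.coe_one, one_mul] at hre him
  apply Complex.ext
  · exact (integral_re hi').symm.trans (hre.trans (integral_re hi))
  · exact (integral_im hi').symm.trans (him.trans (integral_im hi))

end Unimodular

/-! ### The Atkin-Lehner involution. -/

section AtkinLehner

variable {K : Type*} [Field K] [ValuativeRel K] [TopologicalSpace K]
  [IsNonarchimedeanLocalField K]

variable (K) in
/-- The Atkin-Lehner element, the class of `[0, 1; -unif, 0]`. -/
def atkinLehner : PGL(2, K) := weyl K * torus (unif K)

theorem torus_mul_weyl (t : Kˣ) : torus t * weyl K = weyl K * torus t⁻¹ := by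
  rw [weyl_mul_torus, inv_inv]

theorem atkinLehner_mul_self : atkinLehner K * atkinLehner K = 1 := by
  rw [atkinLehner, mul_assoc, ← mul_assoc (torus _), torus_mul_weyl, mul_assoc, ← torus_mul,
    inv_mul_cancel, torus_one, mul_one, weyl_mul_weyl]

/-- Conjugation swaps the diagonal entries and, up to sign, moves g₁₀/ϖ to the upper right and ϖg₀₁
to the lower left. The first is integral because g₁₀ lies in the maximal ideal; the second lies in
the maximal ideal. -/
theorem atkinLehner_conj_mem {g : PGL(2, K)} (hg : g ∈ iwahori K) :
    atkinLehner K * g * atkinLehner K ∈ iwahori K := by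
  rw [iwahori_eq_image] at hg
  obtain ⟨g, ⟨h1, h2, h3⟩, rfl⟩ := hg
  have hu : (unif K : K) ≠ 0 := (unif K).ne_zero
  have hdet : (!![g 1 1, -(g 1 0 / unif K); -(unif K * g 0 1), g 0 0] :
      Matrix (Fin 2) (Fin 2) K).det = (g : Matrix (Fin 2) (Fin 2) K).det := by
    rw [Matrix.det_fin_two, Matrix.det_fin_two]
    simp
    field_simp
  have hdet0 : (g : Matrix (Fin 2) (Fin 2) K).det ≠ 0 :=
    ((Matrix.isUnit_iff_isUnit_det _).1 g.isUnit).ne_zero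
  have hpos : (0 : ValueGroupWithZero K) < valuation K (unif K : K) :=
    zero_lt_iff.2 ((valuation K).ne_zero_iff.2 hu)
  have hlt : valuation K (unif K : K) < 1 := by
    rw [valuation_lt_one_iff, ord_unif]; norm_num
  have e : atkinLehner K * Matrix.ProjGenLinGroup.mk g * atkinLehner K =
      Matrix.ProjGenLinGroup.mk (Matrix.GeneralLinearGroup.mkOfDetNeZero
        !![g 1 1, -(g 1 0 / unif K); -(unif K * g 0 1), g 0 0] (by rwa [hdet])) := by
    rw [atkinLehner, weyl, torus, ← map_mul, ← map_mul, ← map_mul]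
    symm
    refine mk_eq_mk_of_smul (-unif K) fun i j => ?_
    fin_cases i <;> fin_cases j <;>
      simp [Matrix.GeneralLinearGroup.mkOfDetNeZero, Matrix.mul_apply, Matrix.vecMul,
        dotProduct] <;> field_simp
  rw [e]
  refine mem_iwahori_of_entries _ (fun i j => ?_) ?_ (by rw [hdet, h3])
  · fin_cases i <;> fin_cases j
    · simpa using h1 1 1
    · have := (valuation_lt_iff_le_mul_unif (g 1 0) (1 : Kˣ)).1 (by simpa using h2)
      rw [one_mul] at this
      simpa [div_le_one₀ hpos] using this
    · simpa using mul_le_one' hlt.le (h1 0 1)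
    · simpa using h1 0 0
  · simpa using mul_lt_one_of_lt_of_le hlt (h1 0 1)

/-- This is Iw·w = τ Iw a(ϖ)⁻¹: conjugating τgw by the involution τ gives g a(ϖ). -/
theorem atkinLehner_mul_mem_iwahoriWeyl_iff (g : PGL(2, K)) :
    atkinLehner K * g ∈ iwahoriWeyl K ↔ g * torus (unif K) ∈ iwahori K := by
  have h1 : atkinLehner K * g ∈ iwahoriWeyl K ↔ atkinLehner K * g * weyl K ∈ iwahori K := by
    constructor
    · rintro ⟨k, hk, h⟩
      rw [← h]
      beta_reduce
      rwa [mul_assoc, weyl_mul_weyl, mul_one]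
    · intro h
      exact ⟨_, h, by beta_reduce; rw [mul_assoc, weyl_mul_weyl, mul_one]⟩
  rw [h1]
  have h2 : torus (unif K) * atkinLehner K = weyl K := by
    rw [atkinLehner, ← mul_assoc, torus_mul_weyl, mul_assoc, ← torus_mul, inv_mul_cancel,
      torus_one, mul_one]
  have h3 : weyl K * atkinLehner K = torus (unif K) := by
    rw [atkinLehner, ← mul_assoc, weyl_mul_weyl, one_mul]
  constructor
  · intro h
    have := atkinLehner_conj_mem h
    rwa [← mul_assoc, ← mul_assoc, atkinLehner_mul_self, one_mul, mul_assoc, h3] at this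
  · intro h
    have := atkinLehner_conj_mem h
    rwa [← mul_assoc, mul_assoc _ (torus _), h2] at this

end AtkinLehner

/-! ### The operators of the two test functions. -/

section Hecke

variable {K : Type*} [Field K] [ValuativeRel K] [TopologicalSpace K]
  [IsNonarchimedeanLocalField K] [MeasurableSpace PGL(2, K)] [BorelSpace PGL(2, K)]
  {𝒲 : Subrepresentation (rightTranslation K)} {ε : ℂ} {v : 𝒲.toSubmodule}

theorem continuous_iwahori_mul {W : PGL(2, K) → ℂ} (hW : Continuous W) (h : PGL(2, K)) :
    Continuous (fun g => (iwahori K).indicator 1 g * W (h * g)) :=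
  (LocallyConstant.charFn ℂ isClopen_iwahori).continuous.mul (hW.comp (continuous_const_mul h))

theorem hasCompactSupport_iwahori_mul (W : PGL(2, K) → ℂ) (h : PGL(2, K)) :
    HasCompactSupport (fun g => (iwahori K).indicator 1 g * W (h * g)) :=
  HasCompactSupport.intro isCompact_iwahori fun g hg => by
    rw [Set.indicator_of_notMem hg, zero_mul]

theorem integrable_iwahori_mul (μ : Measure PGL(2, K)) [μ.IsHaarMeasure] {W : PGL(2, K) → ℂ}
    (hW : Continuous W) (h : PGL(2, K)) :
    Integrable (fun g => (iwahori K).indicator 1 g * W (h * g)) μ :=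
  (continuous_iwahori_mul hW h).integrable_of_hasCompactSupport (hasCompactSupport_iwahori_mul W h)

/-- The value at `h` of the Iwahori average, as a linear form. -/
def heckeForm (μ : Measure PGL(2, K)) [μ.IsHaarMeasure]
    (hc : ∀ w : 𝒲.toSubmodule, Continuous (w : PGL(2, K) → ℂ)) (h : PGL(2, K)) :
    𝒲.toSubmodule →ₗ[ℂ] ℂ where
  toFun w := hecke μ ((iwahori K).indicator 1) w h
  map_add' w w' := by
    unfold hecke
    rw [← integral_add (integrable_iwahori_mul μ (hc w) h) (integrable_iwahori_mul μ (hc w') h)]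
    congr 1
    ext g
    rw [Submodule.coe_add, Pi.add_apply, mul_add]
  map_smul' c w := by
    unfold hecke
    rw [RingHom.id_apply, smul_eq_mul, ← integral_const_mul]
    congr 1
    ext g
    rw [Submodule.coe_smul, Pi.smul_apply, smul_eq_mul, mul_left_comm]

theorem hecke_iwahori_translate (μ : Measure PGL(2, K)) [μ.IsHaarMeasure] {w : 𝒲.toSubmodule}
    (hc : Continuous (w : PGL(2, K) → ℂ)) (h : PGL(2, K)) {k : PGL(2, K)} (hk : k ∈ iwahori K) :
    hecke μ ((iwahori K).indicator 1) (𝒲.toRepresentation k w) h =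
      hecke μ ((iwahori K).indicator 1) w h := by
  have := integral_mul_right_of_modularCharacter μ (modularCharacter_iwahori hk)
    (continuous_iwahori_mul hc h) (hasCompactSupport_iwahori_mul _ h)
  unfold hecke
  rw [← this]
  congr 1
  ext g
  rw [iwahori_indicator_mul hk, toRepresentation_apply, mul_assoc]

namespace IsCellVector

/-- Right Iwahori-invariance makes v locally constant; continuity passes to translates and, by
spanning, to the whole model. -/
theorem continuous_of_mem (h : IsCellVector 𝒲.toRepresentation ε v) (w : 𝒲.toSubmodule) :
    Continuous (w : PGL(2, K) → ℂ) := by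
  have hv : Continuous (v : PGL(2, K) → ℂ) := by
    refine IsLocallyConstant.continuous ?_
    rw [IsLocallyConstant.iff_eventually_eq]
    intro g
    have hn : (g⁻¹ * ·) ⁻¹' iwahori K ∈ nhds g :=
      (isOpen_iwahori.preimage (continuous_const_mul g⁻¹)).mem_nhds (by
        rw [Set.mem_preimage, inv_mul_cancel]
        exact (iwahoriSubgroup K).one_mem)
    filter_upwards [hn] with g' hg'
    have := h.apply_mul_iwahori g hg'
    rwa [mul_inv_cancel_left] at this
  have hw : w ∈ Submodule.span ℂ (Set.range fun p : K × Kˣ =>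
      𝒲.toRepresentation (unip p.1 * torus p.2) v) := h.span ▸ trivial
  induction hw using Submodule.span_induction with
  | mem w hw =>
    obtain ⟨p, rfl⟩ := hw
    exact hv.comp (continuous_mul_const (unip p.1 * torus p.2))
  | zero => exact continuous_const
  | add w w' _ _ h1 h2 => exact h1.add h2
  | smul c w _ h1 => exact continuous_const.mul h1

theorem hecke_self (h : IsCellVector 𝒲.toRepresentation ε v) (μ : Measure PGL(2, K))
    (x : PGL(2, K)) :
    hecke μ ((iwahori K).indicator 1) v x =
      (μ (iwahori K)).toReal * (v : PGL(2, K) → ℂ) x := by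
  have e (g : PGL(2, K)) : (iwahori K).indicator (1 : PGL(2, K) → ℂ) g *
      (v : PGL(2, K) → ℂ) (x * g) =
      (iwahori K).indicator (fun _ => (v : PGL(2, K) → ℂ) x) g := by
    by_cases hg : g ∈ iwahori K
    · rw [Set.indicator_of_mem hg, Set.indicator_of_mem hg, h.apply_mul_iwahori x hg, Pi.one_apply,
        one_mul]
    · rw [Set.indicator_of_notMem hg, Set.indicator_of_notMem hg, zero_mul]
  unfold hecke
  simp only [e]
  rw [integral_indicator_const _ isOpen_iwahori.measurableSet, measureReal_def, Complex.real_smul]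

/-- In the lower unipotent relation all q terms have the same Iwahori average, and ε⁻¹ = ε. -/
theorem hecke_unif_zpow (h : IsCellVector 𝒲.toRepresentation ε v) (hε : ε ^ 2 = 1)
    (μ : Measure PGL(2, K)) [μ.IsHaarMeasure] (x : PGL(2, K)) (k : ℕ) :
    heckeForm μ h.continuous_of_mem x (𝒲.toRepresentation (torus (unif K ^ (-((k + 1 : ℕ) : ℤ)))) v) =
      ε * (resCard K : ℂ)⁻¹ *
        heckeForm μ h.continuous_of_mem x (𝒲.toRepresentation (torus (unif K ^ (-(k : ℤ)))) v) := by
  have h1 := congrArg (heckeForm μ h.continuous_of_mem x) (h.smul_torus_unif hε k)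
  have h2 (b : 𝓀[K]) : heckeForm μ h.continuous_of_mem x (𝒲.toRepresentation
      (lowerUnip (-(resRep K b * (unif K ^ ((k : ℤ) + 1) : Kˣ) : K)))
        (𝒲.toRepresentation (torus (unif K ^ (-((k + 1 : ℕ) : ℤ)))) v)) =
      heckeForm μ h.continuous_of_mem x
        (𝒲.toRepresentation (torus (unif K ^ (-((k + 1 : ℕ) : ℤ)))) v) := by
    refine hecke_iwahori_translate μ (h.continuous_of_mem _) x (lowerUnip_mem_iwahori ?_)
    rw [Valuation.map_neg, map_mul]
    refine (mul_le_of_le_one_left' (valuation_resRep_le b)).trans_lt ?_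
    rw [valuation_lt_one_iff, ord_unif_zpow]
    omega
  rw [map_smul, map_sum] at h1
  simp only [h2, Finset.sum_const, Finset.card_univ, card_residueField, nsmul_eq_mul,
    smul_eq_mul] at h1
  have hq : (resCard K : ℂ) ≠ 0 := by exact_mod_cast (resCard_pos K).ne'
  rw [mul_right_comm, h1]
  field_simp

variable [MeasurableSpace Kˣ] [BorelSpace Kˣ] {ψ : AddChar K Circle}

theorem torusPairing_self_ne_zero (h : IsCellVector 𝒲.toRepresentation ε v) (hε : ε ^ 2 = 1)
    {ν : Measure Kˣ} [ν.IsHaarMeasure] (hν : ν {u : Kˣ | valuation K (u : K) = 1} = 1)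
    (hψc : Continuous ψ) (hψ : HasConductorIntegers ψ)
    (hW : ∀ W ∈ 𝒲.toSubmodule, ∀ (x : K) (g : PGL(2, K)), W (unip x * g) = ψ x * W g) :
    torusPairing ν (torusRestriction 𝒲 v) (torusRestriction 𝒲 v) ≠ 0 := by
  intro h0
  have := h.torusPairing_self hε hν hψc hψ hW
  rw [h0, mul_zero, eq_comm, Complex.mul_conj, Complex.ofReal_eq_zero, Complex.normSq_eq_zero] at this
  exact h.apply_one_ne_zero hε hψ hW this

/-- The Iwahori average is the orthogonal projection to the line of the cell vector. -/
theorem hecke_iwahori (h : IsCellVector 𝒲.toRepresentation ε v) (hε : ε ^ 2 = 1)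
    {ν : Measure Kˣ} [ν.IsHaarMeasure] (hν : ν {u : Kˣ | valuation K (u : K) = 1} = 1)
    (μ : Measure PGL(2, K)) [μ.IsHaarMeasure]
    (hψc : Continuous ψ) (hψ : HasConductorIntegers ψ)
    (hW : ∀ W ∈ 𝒲.toSubmodule, ∀ (x : K) (g : PGL(2, K)), W (unip x * g) = ψ x * W g)
    (w : 𝒲.toSubmodule) (x : PGL(2, K)) :
    hecke μ ((iwahori K).indicator 1) w x =
      (μ (iwahori K)).toReal * torusPairing ν (torusRestriction 𝒲 w) (torusRestriction 𝒲 v) /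
        torusPairing ν (torusRestriction 𝒲 v) (torusRestriction 𝒲 v) *
          (v : PGL(2, K) → ℂ) x := by
  have hm := h.torusRestriction_mem hε hψc hψ hW
  have hne := h.torusPairing_self_ne_zero hε hν hψc hψ hW
  set I := torusPairing ν (torusRestriction 𝒲 v) (torusRestriction 𝒲 v) with hI
  set Lθ := torusPairingForm hν hm (hm v) with hLθ
  have happly (w : 𝒲.toSubmodule) :
      Lθ w = torusPairing ν (torusRestriction 𝒲 w) (torusRestriction 𝒲 v) := rfl
  have hε0 : ε ≠ 0 := fun h0 => by rw [h0] at hε; norm_num at hε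
  -- Both forms are invariant under the integral upper triangular matrices, so it suffices to
  -- compare them on a(ϖ^(-k))v. For k = 0 the constants are chosen to match, and both sides are
  -- multiplied by β when k increases by one.
  have key : heckeForm μ h.continuous_of_mem x -
      ((μ (iwahori K)).toReal / I * (v : PGL(2, K) → ℂ) x) • Lθ = 0 := by
    refine h.linearMap_eq_zero hε0 _ (fun z hz w => ?_) (fun t ht w => ?_) fun k => ?_
    · rw [LinearMap.sub_apply, LinearMap.sub_apply, LinearMap.smul_apply, LinearMap.smul_apply,
        happly, happly, h.torusPairing_unip ν hψ hW hz]
      congr 1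
      exact hecke_iwahori_translate μ (h.continuous_of_mem _) x (unip_mem_iwahori hz)
    · rw [LinearMap.sub_apply, LinearMap.sub_apply, LinearMap.smul_apply, LinearMap.smul_apply,
        happly, happly, ← torusPairing_torus ν t w, h.apply_iwahori _ (torus_mem_iwahori ht)]
      congr 1
      exact hecke_iwahori_translate μ (h.continuous_of_mem _) x (torus_mem_iwahori ht)
    · induction k with
      | zero =>
        rw [Nat.cast_zero, neg_zero, zpow_zero, torus_one, map_one, Module.End.one_apply,
          LinearMap.sub_apply, LinearMap.smul_apply, happly]
        change hecke μ ((iwahori K).indicator 1) v x - _ = 0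
        rw [h.hecke_self, smul_eq_mul, ← hI]
        field_simp
        ring
      | succ k ih =>
        rw [LinearMap.sub_apply, LinearMap.smul_apply, happly, h.hecke_unif_zpow hε,
          h.torusPairing_unif_zpow hε hψ hW, smul_eq_mul]
        rw [LinearMap.sub_apply, LinearMap.smul_apply, happly, smul_eq_mul] at ih
        linear_combination (ε * (resCard K : ℂ)⁻¹) * ih
  have := DFunLike.congr_fun key w
  rw [LinearMap.sub_apply, LinearMap.smul_apply, happly, LinearMap.zero_apply, smul_eq_mul,
    sub_eq_zero] at this
  refine Eq.trans this ?_
  ring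

theorem torus_unif_eq (h : IsCellVector 𝒲.toRepresentation ε v) (hε : ε ^ 2 = 1) :
    𝒲.toRepresentation (torus (unif K)) v = -(ε • 𝒲.toRepresentation (weyl K) v) := by
  rw [h.apply_weyl, smul_neg, neg_neg, smul_smul, ← pow_two, hε, one_smul]

/-- Since a(ϖ)v = -ε wv and w² = 1 in the projective group, v is an eigenvector of the Atkin-Lehner
element. -/
theorem apply_mul_atkinLehner (h : IsCellVector 𝒲.toRepresentation ε v) (hε : ε ^ 2 = 1)
    (x : PGL(2, K)) :
    (v : PGL(2, K) → ℂ) (x * atkinLehner K) = -(ε * (v : PGL(2, K) → ℂ) x) := by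
  rw [← toRepresentation_apply, atkinLehner, map_mul, Module.End.mul_apply, h.torus_unif_eq hε,
    map_neg, map_smul, ← Module.End.mul_apply, ← map_mul, weyl_mul_weyl, map_one,
    Module.End.one_apply]
  rfl

/-- Substituting through Iw·w = τ Iw a(ϖ)⁻¹ reduces to the Iwahori average of a(ϖ)⁻¹w evaluated at
xτ. -/
theorem hecke_iwahoriWeyl (h : IsCellVector 𝒲.toRepresentation ε v) (hε : ε ^ 2 = 1)
    {ν : Measure Kˣ} [ν.IsHaarMeasure] (hν : ν {u : Kˣ | valuation K (u : K) = 1} = 1)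
    (μ : Measure PGL(2, K)) [μ.IsHaarMeasure]
    (hψc : Continuous ψ) (hψ : HasConductorIntegers ψ)
    (hW : ∀ W ∈ 𝒲.toSubmodule, ∀ (x : K) (g : PGL(2, K)), W (unip x * g) = ψ x * W g)
    (w : 𝒲.toSubmodule) (x : PGL(2, K)) :
    hecke μ ((iwahoriWeyl K).indicator 1) w x =
      (μ (iwahori K)).toReal * torusPairing ν (torusRestriction 𝒲 w)
          (torusRestriction 𝒲 (𝒲.toRepresentation (weyl K) v)) /
        torusPairing ν (torusRestriction 𝒲 v) (torusRestriction 𝒲 v) *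
          (v : PGL(2, K) → ℂ) x := by
  set w' := 𝒲.toRepresentation (torus (unif K)⁻¹) w with hw'
  have h1 : hecke μ ((iwahoriWeyl K).indicator 1) w x =
      hecke μ ((iwahori K).indicator 1) w' (x * atkinLehner K) := by
    have h2 := integral_mul_right_of_modularCharacter μ (modularCharacter_torus (unif K))
      (continuous_iwahori_mul (h.continuous_of_mem w') (x * atkinLehner K))
      (hasCompactSupport_iwahori_mul _ _)
    unfold hecke
    rw [← h2, ← integral_mul_left_eq_self _ (atkinLehner K)]
    congr 1
    ext g
    have e : x * atkinLehner K * (g * torus (unif K)) * torus (unif K)⁻¹ =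
        x * (atkinLehner K * g) := by
      rw [torus_inv]; group
    rw [hw', toRepresentation_apply, e]
    congr 1
    by_cases hg : g * torus (unif K) ∈ iwahori K
    · rw [Set.indicator_of_mem hg,
        Set.indicator_of_mem ((atkinLehner_mul_mem_iwahoriWeyl_iff g).2 hg)]
      rfl
    · rw [Set.indicator_of_notMem hg,
        Set.indicator_of_notMem (mt (atkinLehner_mul_mem_iwahoriWeyl_iff g).1 hg)]
  -- Invariance of the pairing under the torus moves a(ϖ)⁻¹ to the other side as a(ϖ), and a(ϖ)v =
  -- -ε wv. This sign cancels against the Atkin-Lehner eigenvalue because ε² = 1.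
  have h3 : torusPairing ν (torusRestriction 𝒲 w') (torusRestriction 𝒲 v) =
      -(ε * torusPairing ν (torusRestriction 𝒲 w)
        (torusRestriction 𝒲 (𝒲.toRepresentation (weyl K) v))) := by
    rw [← torusPairing_torus ν (unif K), hw', ← Module.End.mul_apply, ← map_mul, ← torus_mul,
      mul_inv_cancel, torus_one, map_one, Module.End.one_apply, h.torus_unif_eq hε, map_neg,
      map_smul]
    unfold torusPairing
    rw [← integral_const_mul, ← integral_neg]
    congr 1
    ext y
    rw [Pi.neg_apply, Pi.smul_apply, smul_eq_mul, map_neg, map_mul, conj_epsilon hε]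
    ring
  rw [h1, h.hecke_iwahori hε hν μ hψc hψ hW, h.apply_mul_atkinLehner hε, h3]
  linear_combination ((μ (iwahori K)).toReal * torusPairing ν (torusRestriction 𝒲 w)
    (torusRestriction 𝒲 (𝒲.toRepresentation (weyl K) v)) /
        torusPairing ν (torusRestriction 𝒲 v) (torusRestriction 𝒲 v) *
          (v : PGL(2, K) → ℂ) x) * hε

end IsCellVector

end Hecke

/-! ### The index of the Iwahori subgroup in the maximal compact subgroup. -/

section Volume

open scoped Pointwise

variable {K : Type*} [Field K] [ValuativeRel K]

/-- Two representatives differ by a scalar u; as both determinants are units, u² and hence u is a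
unit, which does not affect the conditions on the entries. -/
theorem isIwahoriMatrix_of_mk_mem {g : GL (Fin 2) K}
    (hg : Matrix.ProjGenLinGroup.mk g ∈ iwahori K)
    (hd : valuation K ((g : Matrix (Fin 2) (Fin 2) K).det) = 1) : IsIwahoriMatrix g := by
  rw [iwahori_eq_image] at hg
  obtain ⟨g', ⟨h1, h2, h3⟩, h⟩ := hg
  obtain ⟨u, rfl⟩ := Matrix.ProjGenLinGroup.mk_eq_mk_iff.1 h
  have hu : valuation K (u : K) = 1 := by
    have : ((g' * Matrix.GeneralLinearGroup.scalar (Fin 2) u : GL (Fin 2) K) :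
        Matrix (Fin 2) (Fin 2) K).det = (g' : Matrix (Fin 2) (Fin 2) K).det * (u : K) ^ 2 := by
      rw [Units.val_mul, Matrix.det_mul]
      simp
    rw [this, map_mul, h3, one_mul, map_pow] at hd
    exact (pow_eq_one_iff_of_nonneg zero_le two_ne_zero).1 hd
  have e (i j : Fin 2) : (g' * Matrix.GeneralLinearGroup.scalar (Fin 2) u : GL (Fin 2) K) i j =
      g' i j * u := by
    simp [Matrix.scalar_apply]
  exact ⟨fun i j => by rw [e, map_mul, hu, mul_one]; exact h1 i j,
    by rw [e, map_mul, hu, mul_one]; exact h2, hd⟩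

theorem maxCompact_eq_image : maxCompact K = Matrix.ProjGenLinGroup.mk ''
    {g : GL (Fin 2) K | (∀ i j, valuation K (g i j) ≤ 1) ∧
      valuation K ((g : Matrix (Fin 2) (Fin 2) K).det) = 1} := by
  ext x
  constructor
  · rintro ⟨g, rfl⟩
    induction g using Matrix.ProjGenLinGroup.induction_on with | mk g =>
    exact ⟨Matrix.GeneralLinearGroup.map (algebraMap 𝒪[K] K) g,
      ⟨fun i j => ((g : Matrix (Fin 2) (Fin 2) 𝒪[K]) i j).2, valuation_det_map g⟩, rfl⟩
  · rintro ⟨g, ⟨h1, h2⟩, rfl⟩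
    obtain ⟨g', rfl⟩ := exists_map_eq_of_integral h1 h2
    exact ⟨Matrix.ProjGenLinGroup.mk g', rfl⟩

theorem lowerUnip_mem_iwahori_iff (z : K) : lowerUnip z ∈ iwahori K ↔ valuation K z < 1 := by
  refine ⟨fun h => ?_, lowerUnip_mem_iwahori⟩
  simpa [Matrix.GeneralLinearGroup.mkOfDetNeZero] using
    (isIwahoriMatrix_of_mk_mem h (by simp [Matrix.GeneralLinearGroup.mkOfDetNeZero])).2.1

theorem weyl_notMem_iwahori : weyl K ∉ iwahori K := fun h => by
  simpa [Matrix.GeneralLinearGroup.mkOfDetNeZero] using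
    (isIwahoriMatrix_of_mk_mem h (by simp [Matrix.GeneralLinearGroup.mkOfDetNeZero])).2.1

variable [TopologicalSpace K] [IsNonarchimedeanLocalField K]

variable (K) in
/-- Representatives of the cosets of the Iwahori subgroup in `G(𝒪)`. -/
def cosetRep : Option 𝓀[K] → PGL(2, K)
  | none => 1
  | some b => unip (resRep K b : K) * weyl K

theorem weyl_mul_unip_mul_weyl (x : K) : weyl K * (unip x * weyl K) = lowerUnip (-x) := by
  rw [← mul_assoc, weyl_mul_unip, mul_assoc, weyl_mul_weyl, mul_one]

theorem inv_weyl : (weyl K)⁻¹ = weyl K := inv_eq_of_mul_eq_one_left weyl_mul_weyl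

theorem unip_neg (x : K) : unip (-x) = (unip x)⁻¹ := by
  rw [eq_inv_iff_mul_eq_one, ← unip_add, neg_add_cancel, unip_zero]

theorem inv_cosetRep_mul_mem_iff (i j : Option 𝓀[K]) :
    (cosetRep K i)⁻¹ * cosetRep K j ∈ iwahori K ↔ i = j := by
  refine ⟨fun h => ?_, fun h => by rw [h, inv_mul_cancel]; exact (iwahoriSubgroup K).one_mem⟩
  have hsome (b : 𝓀[K]) : unip (resRep K b : K) * weyl K ∉ iwahori K := by
    intro h
    have := (iwahoriSubgroup K).mul_mem
      ((iwahoriSubgroup K).inv_mem (unip_mem_iwahori (valuation_resRep_le b))) h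
    rw [inv_mul_cancel_left] at this
    exact weyl_notMem_iwahori this
  match i, j with
  | none, none => rfl
  | none, some b =>
    refine (hsome b ?_).elim
    simpa [cosetRep] using h
  | some b, none =>
    refine (hsome b ?_).elim
    have := (iwahoriSubgroup K).inv_mem h
    rw [← SetLike.mem_coe, coe_iwahoriSubgroup] at this
    simpa [cosetRep] using this
  | some b, some b' =>
    have e : (cosetRep K (some b))⁻¹ * cosetRep K (some b') =
        lowerUnip (-(-(resRep K b : K) + resRep K b')) := by
      rw [← weyl_mul_unip_mul_weyl, unip_add, unip_neg]
      simp only [cosetRep, mul_inv_rev, inv_weyl]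
      group
    rw [e, lowerUnip_mem_iwahori_iff, Valuation.map_neg,
      valuation_add_resRep_lt_iff (by rw [Valuation.map_neg]; exact valuation_resRep_le b)] at h
    have h2 : (⟨-(resRep K b : K), by
        rw [Valuation.mem_integer_iff, Valuation.map_neg]; exact valuation_resRep_le b⟩ : 𝒪[K]) =
        -resRep K b := rfl
    rw [h2, map_neg, neg_neg, residue_resRep] at h
    rw [h]

/-- Bruhat decomposition over the residue field: either the lower left entry vanishes modulo the
maximal ideal, or some n(b)w clears it. -/
theorem maxCompact_eq_iUnion : maxCompact K = ⋃ i, cosetRep K i • iwahori K := by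
  ext x
  rw [Set.mem_iUnion]
  constructor
  · intro hx
    rw [maxCompact_eq_image] at hx
    obtain ⟨g, ⟨h1, h2⟩, rfl⟩ := hx
    by_cases hc : valuation K (g 1 0) < 1
    · refine ⟨none, ?_⟩
      rw [cosetRep, one_smul, iwahori_eq_image]
      exact ⟨g, ⟨h1, hc, h2⟩, rfl⟩
    · have hc1 : valuation K (g 1 0) = 1 := le_antisymm (h1 1 0) (not_lt.1 hc)
      have hc0 : g 1 0 ≠ 0 := fun h => by rw [h, map_zero] at hc1; exact zero_ne_one hc1
      have hx : valuation K (-(g 0 0 / g 1 0)) ≤ 1 := by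
        rw [Valuation.map_neg, map_div₀, hc1, div_one]; exact h1 0 0
      -- The class of g₀₀/g₁₀, chosen so that the lower left entry of (n(b)w)⁻¹g lies in the maximal
      -- ideal.
      set b := -IsLocalRing.residue 𝒪[K] ⟨_, hx⟩ with hb
      have hlt := (valuation_add_resRep_lt_iff hx b).2 hb
      refine ⟨some b, ?_⟩
      rw [Set.mem_smul_set_iff_inv_smul_mem, smul_eq_mul, cosetRep, mul_inv_rev, inv_weyl,
        ← unip_neg, weyl, unip, ← map_mul, ← map_mul, iwahori_eq_image]
      refine ⟨_, ⟨fun i j => ?_, ?_, ?_⟩, rfl⟩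
      · have hb1 := valuation_resRep_le b
        fin_cases i <;> fin_cases j
        · simpa [Matrix.GeneralLinearGroup.mkOfDetNeZero, Matrix.mul_apply] using h1 1 0
        · simpa [Matrix.GeneralLinearGroup.mkOfDetNeZero, Matrix.mul_apply] using h1 1 1
        · simpa [Matrix.GeneralLinearGroup.mkOfDetNeZero, Matrix.mul_apply, Matrix.vecMul,
            dotProduct] using (valuation K).map_add_le (by simpa using h1 0 0)
              (by simpa using mul_le_one' hb1 (h1 1 0))
        · simpa [Matrix.GeneralLinearGroup.mkOfDetNeZero, Matrix.mul_apply, Matrix.vecMul,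
            dotProduct] using (valuation K).map_add_le (by simpa using h1 0 1)
              (by simpa using mul_le_one' hb1 (h1 1 1))
      · have e : -g 0 0 + resRep K b * g 1 0 = g 1 0 * (-(g 0 0 / g 1 0) + resRep K b) := by
          field_simp
        have h := congrArg (valuation K) e
        rw [map_mul, hc1, one_mul] at h
        rw [← h] at hlt
        simpa [Matrix.GeneralLinearGroup.mkOfDetNeZero, Matrix.mul_apply, Matrix.vecMul,
          dotProduct, add_comm] using hlt
      · rw [Units.val_mul, Units.val_mul, Matrix.det_mul, Matrix.det_mul, map_mul, h2]
        simp [Matrix.GeneralLinearGroup.mkOfDetNeZero]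
  · rintro ⟨i, k, hk, rfl⟩
    have hcoe : maxCompact K =
        ((Matrix.ProjGenLinGroup.map (n := Fin 2) (algebraMap 𝒪[K] K)).range : Set PGL(2, K)) := by
      rw [MonoidHom.coe_range]; rfl
    have hIw : iwahori K ⊆ maxCompact K := by
      rw [iwahori_eq_image, maxCompact_eq_image]
      exact Set.image_mono fun g hg => ⟨hg.1, hg.2.2⟩
    have hw : weyl K ∈ maxCompact K := by
      rw [maxCompact_eq_image]
      refine ⟨_, ⟨fun i j => ?_, ?_⟩, rfl⟩
      · fin_cases i <;> fin_cases j <;> simp [Matrix.GeneralLinearGroup.mkOfDetNeZero]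
      · simp [Matrix.GeneralLinearGroup.mkOfDetNeZero]
    have hk' := hIw hk
    beta_reduce
    rw [smul_eq_mul]
    rw [hcoe, SetLike.mem_coe] at hw hk' ⊢
    refine Subgroup.mul_mem _ ?_ hk'
    match i with
    | none => exact Subgroup.one_mem _
    | some b =>
      refine Subgroup.mul_mem _ ?_ hw
      have := hIw (unip_mem_iwahori (valuation_resRep_le b))
      rwa [hcoe] at this

theorem measure_maxCompact [MeasurableSpace PGL(2, K)] [BorelSpace PGL(2, K)]
    (μ : Measure PGL(2, K)) [μ.IsHaarMeasure] :
    (μ (maxCompact K)).toReal = (resCard K + 1) * (μ (iwahori K)).toReal := by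
  have hm (i : Option 𝓀[K]) : MeasurableSet (cosetRep K i • iwahori K) :=
    (isOpen_iwahori.smul (cosetRep K i)).measurableSet
  rw [maxCompact_eq_iUnion, measure_iUnion ?_ hm, tsum_fintype]
  · simp only [measure_smul, Finset.sum_const, Finset.card_univ, Fintype.card_option,
      card_residueField, nsmul_eq_mul]
    rw [ENNReal.toReal_mul, ENNReal.toReal_natCast, Nat.cast_add, Nat.cast_one]
  · intro i j hij
    rw [Function.onFun, Set.disjoint_left]
    intro x hi hj
    rw [Set.mem_smul_set_iff_inv_smul_mem, smul_eq_mul] at hi hj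
    refine hij ((inv_cosetRep_mul_mem_iff i j).1 ?_)
    have := (iwahoriSubgroup K).mul_mem hi ((iwahoriSubgroup K).inv_mem hj)
    rwa [mul_inv_rev, inv_inv, mul_assoc, mul_inv_cancel_left] at this

end Volume

/-! ### Local factors of the special parameter. -/

section LocalFactors

variable {K : Type*} [Field K] [ValuativeRel K] [TopologicalSpace K]
  [IsNonarchimedeanLocalField K]

theorem det_one_sub_smul_of_eigenbasis {S : Type*} [AddCommGroup S] [Module ℂ S]
    (F : Module.End ℂ S) {u u' : S} (hli : ∀ s t : ℂ, s • u + t • u' = 0 → s = 0 ∧ t = 0)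
    (hsp : ∀ x, ∃ s t : ℂ, s • u + t • u' = x) {c c' : ℂ} (hu : F u = c • u)
    (hu' : F u' = c' • u') (k : ℂ) :
    LinearMap.det (1 - k • F) = (1 - k * c) * (1 - k * c') := by
  have hspan : ⊤ ≤ Submodule.span ℂ (Set.range ![u, u']) := by
    intro x _
    obtain ⟨s, t, rfl⟩ := hsp x
    refine (Submodule.mem_span_range_iff_exists_fun ℂ).2 ⟨![s, t], ?_⟩
    rw [Fin.sum_univ_two]
    rfl
  obtain ⟨B, hB⟩ : ∃ B : Module.Basis (Fin 2) ℂ S, ∀ i, B i = ![u, u'] i :=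
    ⟨.mk (LinearIndependent.pair_iff.2 hli) hspan, fun i => by simp⟩
  have e : LinearMap.toMatrix B B (1 - k • F) =
      Matrix.diagonal ![1 - k * c, 1 - k * c'] := by
    ext i j
    have hF : (1 - k • F) (B j) = ![1 - k * c, 1 - k * c'] j • B j := by
      rw [hB, LinearMap.sub_apply, LinearMap.smul_apply, Module.End.one_apply]
      fin_cases j
      · change u - k • F u = (1 - k * c) • u
        rw [hu, smul_smul, sub_smul, one_smul]
      · change u' - k • F u' = (1 - k * c') • u'
        rw [hu', smul_smul, sub_smul, one_smul]
    rw [LinearMap.toMatrix_apply, hF, map_smul, Module.Basis.repr_self, Finsupp.smul_single,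
      Matrix.diagonal_apply, Finsupp.single_apply, smul_eq_mul, mul_one]
    by_cases hij : i = j
    · simp [hij]
    · simp [hij, Ne.symm hij]
  rw [← LinearMap.det_toMatrix B, e, Matrix.det_diagonal, Fin.prod_univ_two]
  rfl

theorem UnramWD.inv_LFactor_of_eigenbasis {V : Type*} [AddCommGroup V] [Module ℂ V]
    (D : UnramWD K V) {u u' : V} (hu : D.N u = 0) (hu' : D.N u' = 0)
    (hli : ∀ s t : ℂ, s • u + t • u' = 0 → s = 0 ∧ t = 0)
    (hsp : ∀ x, D.N x = 0 → ∃ s t : ℂ, s • u + t • u' = x) {c c' : ℂ}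
    (h : D.Φ u = c • u) (h' : D.Φ u' = c' • u') (s : ℂ) :
    (D.LFactor s)⁻¹ =
      (1 - (resCard K : ℂ) ^ (-s) * c) * (1 - (resCard K : ℂ) ^ (-s) * c') := by
  rw [UnramWD.LFactor, inv_inv]
  refine det_one_sub_smul_of_eigenbasis (u := ⟨u, hu⟩) (u' := ⟨u', hu'⟩) _
    (fun s t hst => hli s t (congrArg Subtype.val hst)) (fun x => ?_) (Subtype.ext h)
    (Subtype.ext h') _
  obtain ⟨s, t, hx⟩ := hsp x x.2
  exact ⟨s, t, Subtype.ext hx⟩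

/-- The two-dimensional parameter with Frobenius eigenvalues `a` and `b` and monodromy mapping the
first eigenline onto the second. -/
structure UnramWD.IsSpecial (D : UnramWD K (ℂ × ℂ)) (a b : ℂ) : Prop where
  frob : ∀ x y, D.Φ (x, y) = (a * x, b * y)
  mono : ∀ x y, D.N (x, y) = (0, x)

namespace UnramWD.IsSpecial

variable {D : UnramWD K (ℂ × ℂ)} {a b : ℂ}

theorem ker_eq (h : D.IsSpecial a b) :
    LinearMap.ker D.N = LinearMap.range (LinearMap.inr ℂ ℂ ℂ) := by
  ext ⟨x, y⟩
  rw [LinearMap.mem_ker, h.mono]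
  constructor
  · intro hx
    refine ⟨y, ?_⟩
    rw [LinearMap.inr_apply, (Prod.mk.inj hx).2]
  · rintro ⟨z, hz⟩
    rw [LinearMap.inr_apply, Prod.mk.injEq] at hz
    rw [← hz.1]
    rfl

theorem finrank_ker (h : D.IsSpecial a b) : Module.finrank ℂ (LinearMap.ker D.N) = 1 := by
  rw [h.ker_eq, LinearMap.finrank_range_of_inj LinearMap.inr_injective, Module.finrank_self]

theorem finrank_quotient (h : D.IsSpecial a b) :
    Module.finrank ℂ ((ℂ × ℂ) ⧸ LinearMap.ker D.N) = 1 := by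
  have := Submodule.finrank_quotient_add_finrank (LinearMap.ker D.N)
  rw [h.finrank_ker, Module.finrank_prod, Module.finrank_self] at this
  omega

theorem LFactor_eq (h : D.IsSpecial a b) (s : ℂ) :
    D.LFactor s = (1 - (resCard K : ℂ) ^ (-s) * b)⁻¹ := by
  have e : (1 : Module.End ℂ (LinearMap.ker D.N)) - (resCard K : ℂ) ^ (-s) •
      D.Φ.toLinearMap.restrict (p := LinearMap.ker D.N) (q := LinearMap.ker D.N) D.ker_le_comap =
      (1 - (resCard K : ℂ) ^ (-s) * b) • LinearMap.id := by
    ext ⟨⟨x, y⟩, hx⟩ : 2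
    have hx0 : x = 0 := by
      rw [LinearMap.mem_ker, h.mono] at hx
      exact (Prod.mk.inj hx).2
    subst hx0
    have := h.frob 0 y
    simp only [mul_zero] at this
    ext <;> simp [this, sub_mul, mul_assoc]
  rw [UnramWD.LFactor, e, LinearMap.det_smul, h.finrank_ker, LinearMap.det_id, pow_one, mul_one]

theorem epsFactor_eq (h : D.IsSpecial a b) (s : ℂ) :
    D.epsFactor s = -((resCard K : ℂ) ^ (-s)) * a := by
  have e : (LinearMap.ker D.N).mapQ (LinearMap.ker D.N) D.Φ.toLinearMap D.ker_le_comap =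
      a • LinearMap.id := by
    refine Submodule.linearMap_qext _ (LinearMap.ext fun ⟨x, y⟩ => ?_)
    rw [LinearMap.comp_apply, LinearMap.comp_apply, Submodule.mkQ_apply, Submodule.mapQ_apply,
      LinearMap.smul_apply, LinearMap.id_apply, ← Submodule.Quotient.mk_smul,
      Submodule.Quotient.eq, LinearMap.mem_ker, LinearEquiv.coe_coe, h.frob, Prod.smul_mk,
      Prod.mk_sub_mk, h.mono, smul_eq_mul, sub_self]
    rfl
  rw [UnramWD.epsFactor, e, smul_smul, LinearMap.det_smul, h.finrank_quotient, LinearMap.det_id,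
    pow_one, mul_one]

/-- The kernel of the monodromy on End(V) is the centralizer of N, spanned by 1 and N; Frobenius
acts on them by 1 and q⁻¹. -/
theorem inv_tensorDual_LFactor (h : D.IsSpecial a b) :
    (D.tensorDual.LFactor 1)⁻¹ =
      (1 - (resCard K : ℂ)⁻¹) * (1 - (resCard K : ℂ)⁻¹ ^ 2) := by
  have hq : (resCard K : ℂ) ≠ 0 := by exact_mod_cast (resCard_pos K).ne'
  have hmem (X : Module.End ℂ (ℂ × ℂ)) : D.tensorDual.N X = 0 ↔ D.N * X = X * D.N :=
    sub_eq_zero (a := D.N * X)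
  have h0 : D.tensorDual.Φ 1 = (1 : ℂ) • (1 : Module.End ℂ (ℂ × ℂ)) := by
    rw [one_smul]
    exact LinearEquiv.conj_id _
  have h1 : D.tensorDual.Φ D.N = (resCard K : ℂ)⁻¹ • D.N := by
    change D.Φ.conj D.N = (resCard K : ℂ)⁻¹ • D.N
    refine LinearMap.ext fun w => ?_
    rw [LinearEquiv.conj_apply_apply, LinearMap.smul_apply]
    have := D.comm (D.Φ.symm w)
    rw [LinearEquiv.apply_symm_apply] at this
    rw [this, smul_smul, inv_mul_cancel₀ hq, one_smul]
  rw [D.tensorDual.inv_LFactor_of_eigenbasis ((hmem 1).2 (by rw [mul_one, one_mul]))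
    ((hmem D.N).2 rfl) ?_ ?_ h0 h1, Complex.cpow_neg_one, mul_one, pow_two]
  · intro s t hst
    have h2 := LinearMap.congr_fun hst (1, 0)
    rw [LinearMap.add_apply, LinearMap.smul_apply, LinearMap.smul_apply, h.mono,
      Module.End.one_apply] at h2
    simpa using h2
  · intro X hX
    refine ⟨(X (1, 0)).1, (X (1, 0)).2, ?_⟩
    have h01 : X (0, 1) = (0, (X (1, 0)).1) := by
      have := LinearMap.congr_fun ((hmem X).1 hX) (1, 0)
      rw [Module.End.mul_apply, Module.End.mul_apply, h.mono 1 0] at this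
      exact this.symm.trans (h.mono (X (1, 0)).1 (X (1, 0)).2)
    refine LinearMap.ext fun ⟨x, y⟩ => ?_
    have hxy : X (x, y) = x • X (1, 0) + y • X (0, 1) := by
      rw [← map_smul, ← map_smul, ← map_add]
      simp
    rw [hxy, h01, LinearMap.add_apply, LinearMap.smul_apply, LinearMap.smul_apply, h.mono,
      Module.End.one_apply]
    ext
    · simp [mul_comm]
    · simp; ring

end UnramWD.IsSpecial

theorem isSpecial_steinbergParam (χ : Kˣ →* ℂˣ) :
    (steinbergParam χ).IsSpecial ((χ (unif K) : ℂ) * ((√(resCard K : ℝ) : ℝ) : ℂ))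
      ((χ (unif K) : ℂ) * ((√(resCard K : ℝ) : ℝ) : ℂ)⁻¹) where
  frob x y := by
    rw [mul_assoc, mul_assoc]
    rfl
  mono x y := rfl

theorem UnramWD.IsSpecial.twist {D : UnramWD K (ℂ × ℂ)} {a b : ℂ} (h : D.IsSpecial a b)
    (η : Kˣ →* ℂˣ) : (D.twist η).IsSpecial ((η (unif K) : ℂ) * a) ((η (unif K) : ℂ) * b) where
  frob x y := by
    change (η (unif K) : ℂ) • D.Φ (x, y) = _
    rw [h.frob, Prod.smul_mk, smul_eq_mul, smul_eq_mul, mul_assoc, mul_assoc]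
  mono := h.mono

theorem cpow_half : (resCard K : ℂ) ^ (-(1 / 2 : ℂ)) = ((√(resCard K : ℝ) : ℝ) : ℂ)⁻¹ := by
  rw [Complex.cpow_neg, Real.sqrt_eq_rpow, Complex.ofReal_cpow (Nat.cast_nonneg _)]
  push_cast
  rfl

theorem sqrt_inv_mul_sqrt_inv :
    ((√(resCard K : ℝ) : ℝ) : ℂ)⁻¹ * ((√(resCard K : ℝ) : ℝ) : ℂ)⁻¹ = (resCard K : ℂ)⁻¹ := by
  rw [← mul_inv, ← Complex.ofReal_mul, Real.mul_self_sqrt (Nat.cast_nonneg _),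
    Complex.ofReal_natCast]

/-- The half-integral shift in s and the factor q^{-1/2} in the Frobenius eigenvalue combine to q⁻¹,
giving the same constant β as in the Kirillov asymptotics. -/
theorem inv_LFactor_add_half {D : UnramWD K (ℂ × ℂ)} {a β : ℂ}
    (h : D.IsSpecial a (β * ((√(resCard K : ℝ) : ℝ) : ℂ)⁻¹)) (s : ℂ) :
    (D.LFactor (s + 1 / 2))⁻¹ = 1 - β * (resCard K : ℂ)⁻¹ * (resCard K : ℂ) ^ (-s) := by
  have hq : (resCard K : ℂ) ≠ 0 := by exact_mod_cast (resCard_pos K).ne'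
  rw [h.LFactor_eq, inv_inv, neg_add, Complex.cpow_add _ _ hq, cpow_half, ← sqrt_inv_mul_sqrt_inv]
  ring

end LocalFactors

/-! ### Evaluation of the spherical character. -/

section Character

variable {K : Type*} [Field K] [ValuativeRel K] [TopologicalSpace K]
  [IsNonarchimedeanLocalField K] [MeasurableSpace Kˣ] [BorelSpace Kˣ]
  [MeasurableSpace PGL(2, K)] [BorelSpace PGL(2, K)]
  {𝒲 : Subrepresentation (rightTranslation K)} {ε : ℂ} {v : 𝒲.toSubmodule}
  {ψ : AddChar K Circle}

open IsCellVector

/-- A continuous function of zero L²-norm vanishes, because Haar measure charges every nonempty open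
set. -/
theorem eq_zero_of_torusPairing_self {ν : Measure Kˣ} [ν.IsHaarMeasure]
    (hν : ν {u : Kˣ | valuation K (u : K) = 1} = 1) {β : ℂ} {f : Kˣ → ℂ}
    (hf : f ∈ kirillovClass K β) (h : torusPairing ν f f = 0) : f = 0 := by
  have hi := integrable_mul_conj hν hf hf
  unfold torusPairing at h
  have e (y : Kˣ) : f y * (starRingEnd ℂ) (f y) = ((Complex.normSq (f y) : ℝ) : ℂ) :=
    Complex.mul_conj _
  simp only [e] at h hi
  rw [integral_complex_ofReal, Complex.ofReal_eq_zero] at h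
  have hi' : Integrable (fun y => Complex.normSq (f y)) ν := by simpa using hi.re
  rw [integral_eq_zero_iff_of_nonneg (fun y => Complex.normSq_nonneg _) hi'] at h
  have h2 := (Continuous.ae_eq_iff_eq ν (Complex.continuous_normSq.comp hf.1)
    (continuous_const (y := (0 : ℝ)))).1 h
  ext y
  exact Complex.normSq_eq_zero.1 (congrFun h2 y)

theorem regularPeriod_zero (ν : Measure Kˣ) (β : ℂ) (η : Kˣ →* ℂˣ) (s : ℂ) :
    regularPeriod ν β η 0 s = 0 := by
  simp [regularPeriod, euler]

/-- The spherical character of a test function acting through the cell vector. -/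
theorem hasSphericalCharacter_of_hecke {χ : Kˣ →* ℂˣ} (hχ2 : χ ^ 2 = 1)
    (h : IsCellVector 𝒲.toRepresentation (χ (unif K) : ℂ) v)
    {ν : Measure Kˣ} [ν.IsHaarMeasure] (hν : ν {u : Kˣ | valuation K (u : K) = 1} = 1)
    (μ : Measure PGL(2, K)) (hψc : Continuous ψ) (hψ : HasConductorIntegers ψ)
    (hW : ∀ W ∈ 𝒲.toSubmodule, ∀ (x : K) (g : PGL(2, K)), W (unip x * g) = ψ x * W g)
    {η : Kˣ →* ℂˣ} (hη : IsUnramified η) (hη2 : η ^ 2 = 1)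
    {ι : Type*} (b : Module.Basis ι ℂ 𝒲.toSubmodule)
    (hb : IsOrthogonalBasis ν (steinbergParam χ) b) (s₁ s₂ : ℂ) (f : PGL(2, K) → ℂ) (V : ℂ)
    (w₁ : 𝒲.toSubmodule)
    (hf : ∀ (w : 𝒲.toSubmodule) (x : PGL(2, K)), hecke μ f w x =
      V * torusPairing ν (torusRestriction 𝒲 w) (torusRestriction 𝒲 w₁) /
        torusPairing ν (torusRestriction 𝒲 v) (torusRestriction 𝒲 v) * (v : PGL(2, K) → ℂ) x) :
    HasSphericalCharacter ν μ (steinbergParam χ) η b f s₁ s₂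
      (V * (v : PGL(2, K) → ℂ) 1 * regularPeriod ν ((χ (unif K) : ℂ) * (resCard K : ℂ)⁻¹) η
        (fun y => (starRingEnd ℂ) (torusRestriction 𝒲 w₁ y)) (s₁ - s₂) /
        ((1 - (resCard K : ℂ)⁻¹) * (1 - (resCard K : ℂ)⁻¹ ^ 2) *
          torusPairing ν (torusRestriction 𝒲 v) (torusRestriction 𝒲 v))) := by
  have hε : (χ (unif K) : ℂ) ^ 2 = 1 := quadratic_sq hχ2 _
  have hm := h.torusRestriction_mem hε hψc hψ hW
  have hIv := h.torusPairing_self_ne_zero hε hν hψc hψ hW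
  set ε : ℂ := (χ (unif K) : ℂ) with hεdef
  set β : ℂ := ε * (resCard K : ℂ)⁻¹ with hβ
  set P : ℂ := (1 - (resCard K : ℂ)⁻¹) * (1 - (resCard K : ℂ)⁻¹ ^ 2) with hP
  set Iv := torusPairing ν (torusRestriction 𝒲 v) (torusRestriction 𝒲 v) with hIvdef
  have hconj (w : 𝒲.toSubmodule) :
      (fun y => (starRingEnd ℂ) (torusRestriction 𝒲 w y)) ∈ kirillovClass K β :=
    conj_mem_kirillovClass (conj_beta hε) (hm w)
  have hsp := isSpecial_steinbergParam χ
  have hinner (w w' : 𝒲.toSubmodule) :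
      innerForm ν ((steinbergParam χ).tensorDual.LFactor 1) (w : PGL(2, K) → ℂ) w' =
        P * torusPairing ν (torusRestriction 𝒲 w) (torusRestriction 𝒲 w') := by
    rw [innerForm, hsp.inv_tensorDual_LFactor]
    rfl
  have hP0 : P ≠ 0 := by
    have hq : (1 : ℝ) < resCard K := by exact_mod_cast one_lt_resCard (K := K)
    have h1 : ((resCard K : ℝ))⁻¹ < 1 := inv_lt_one_of_one_lt₀ hq
    have h2 : ((resCard K : ℝ))⁻¹ ^ 2 < 1 := pow_lt_one₀ (by positivity) h1 two_ne_zero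
    have h3 : (1 - ((resCard K : ℝ))⁻¹) * (1 - ((resCard K : ℝ))⁻¹ ^ 2) ≠ 0 :=
      (mul_pos (by linarith) (by linarith)).ne'
    rw [hP]
    have := Complex.ofReal_ne_zero.2 h3
    push_cast at this
    exact this
  have horth (i j : ι) (hij : i ≠ j) :
      torusPairing ν (torusRestriction 𝒲 (b i)) (torusRestriction 𝒲 (b j)) = 0 := by
    have := hb i j hij
    rw [hinner] at this
    exact (mul_eq_zero.1 this).resolve_left hP0
  set c := b.repr w₁ with hc
  -- By orthogonality, pairing b i with w₁ isolates the conjugate i-th coordinate; the norm of b i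
  -- then cancels the denominator of the spherical term.
  have hcoef (i : ι) : torusPairing ν (torusRestriction 𝒲 (b i)) (torusRestriction 𝒲 w₁) =
      (starRingEnd ℂ) (c i) *
        torusPairing ν (torusRestriction 𝒲 (b i)) (torusRestriction 𝒲 (b i)) := by
    have h1 : torusPairingForm hν hm (hm (b i)) w₁ =
        c i * torusPairing ν (torusRestriction 𝒲 (b i)) (torusRestriction 𝒲 (b i)) := by
      conv_lhs => rw [← b.linearCombination_repr w₁, Finsupp.linearCombination_apply, Finsupp.sum,
        map_sum]
      rw [Finset.sum_eq_single i]
      · rw [map_smul, smul_eq_mul]; rfl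
      · intro j _ hji
        rw [map_smul, smul_eq_mul]
        exact mul_eq_zero_of_right _ (horth j i hji)
      · intro hi
        rw [Finsupp.notMem_support_iff.1 hi, zero_smul, map_zero]
    rw [← torusPairing_conj ν (torusRestriction 𝒲 w₁)]
    refine (congrArg (starRingEnd ℂ) h1).trans ?_
    rw [map_mul, torusPairing_conj]
  have hper1 (i : ι) : period ν (steinbergParam χ).LFactor 1 (hecke μ f (b i)) (s₁ + s₂) =
      V * torusPairing ν (torusRestriction 𝒲 (b i)) (torusRestriction 𝒲 w₁) / Iv *
        (v : PGL(2, K) → ℂ) 1 := by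
    have e : (fun y => hecke μ f (b i) (torus y)) =
        (V * torusPairing ν (torusRestriction 𝒲 (b i)) (torusRestriction 𝒲 w₁) / Iv) •
          torusRestriction 𝒲 v := funext fun y => hf (b i) (torus y)
    rw [period_eq_regularPeriod hν (β := β) (by rw [e]; exact Submodule.smul_mem _ _ (hm v))
      (fun _ _ => rfl) (one_pow 2) fun s => ?_, e, h.torusRestriction_eq hε hψ hW]
    · have e2 : ((V * torusPairing ν (torusRestriction 𝒲 (b i)) (torusRestriction 𝒲 w₁) / Iv) •
          fun y : Kˣ => if 0 ≤ ord y then (v : PGL(2, K) → ℂ) 1 * β ^ ord y else 0) =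
          fun y => if 0 ≤ ord y then
            V * torusPairing ν (torusRestriction 𝒲 (b i)) (torusRestriction 𝒲 w₁) / Iv *
              (v : PGL(2, K) → ℂ) 1 * β ^ ord y else 0 := by
        ext y
        rw [Pi.smul_apply, smul_eq_mul, mul_ite, mul_zero, mul_assoc]
      rw [e2]
      exact regularPeriod_geometric hν (beta_ne_zero hε) _ (fun _ _ => rfl) _
    · rw [inv_LFactor_add_half hsp, MonoidHom.one_apply, Units.val_one, mul_one]
  have hper2 (i : ι) : period ν ((steinbergParam χ).twist η).LFactor η
      (fun g => (starRingEnd ℂ) ((b i : PGL(2, K) → ℂ) g)) (s₁ - s₂) =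
      regularPeriod ν β η (fun y => (starRingEnd ℂ) (torusRestriction 𝒲 (b i) y)) (s₁ - s₂) := by
    refine period_eq_regularPeriod hν (hconj (b i)) hη hη2 (fun s => ?_) _
    have := hsp.twist η
    rw [← mul_assoc (η (unif K) : ℂ) _ (((√(resCard K : ℝ) : ℝ) : ℂ)⁻¹)] at this
    rw [inv_LFactor_add_half this]
    ring
  have hterm (i : ι) : sphericalTerm ν μ (steinbergParam χ) η f s₁ s₂ (b i) =
      V * (v : PGL(2, K) → ℂ) 1 / (P * Iv) * ((starRingEnd ℂ) (c i) *
        regularPeriod ν β η (fun y => (starRingEnd ℂ) (torusRestriction 𝒲 (b i) y)) (s₁ - s₂)) := by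
    rw [sphericalTerm, hper1, hper2, hinner, hcoef]
    -- Injectivity of restriction to the torus is not needed: if the norm of b i is 0, its
    -- restriction to the torus vanishes and both sides are 0, with division by zero giving 0.
    by_cases h0 : torusPairing ν (torusRestriction 𝒲 (b i)) (torusRestriction 𝒲 (b i)) = 0
    · have hz := eq_zero_of_torusPairing_self hν (hm (b i)) h0
      have hz' : (fun y => (starRingEnd ℂ) (torusRestriction 𝒲 (b i) y)) = 0 := by
        rw [hz]
        ext y
        exact map_zero _
      rw [hz', regularPeriod_zero]
      simp
    · field_simp
  constructor
  · refine c.support.finite_toSet.subset fun i hi => ?_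
    rw [Function.mem_support, hterm] at hi
    rw [Finset.mem_coe, Finsupp.mem_support_iff]
    intro hci
    rw [hci] at hi
    simp at hi
  · have hsub : (Function.support fun i =>
        sphericalTerm ν μ (steinbergParam χ) η f s₁ s₂ (b i)) ⊆ c.support := fun i hi => by
      rw [Function.mem_support, hterm] at hi
      rw [Finset.mem_coe, Finsupp.mem_support_iff]
      intro hci
      rw [hci] at hi
      simp at hi
    rw [finsum_eq_sum_of_support_subset _ hsub]
    simp only [hterm]
    rw [← Finset.mul_sum, ← regularPeriod_linearCombination hν _ _ (fun i => hconj (b i)) hη hη2]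
    -- The conjugate coordinates are exactly those that reassemble the conjugate of w₁.
    have e : (∑ i ∈ c.support, (starRingEnd ℂ) (c i) •
        fun y => (starRingEnd ℂ) (torusRestriction 𝒲 (b i) y)) =
        fun y => (starRingEnd ℂ) (torusRestriction 𝒲 w₁ y) := by
      conv_rhs => rw [← b.linearCombination_repr w₁, Finsupp.linearCombination_apply, Finsupp.sum,
        map_sum]
      ext y
      simp only [Finset.sum_apply, Pi.smul_apply, map_smul, smul_eq_mul, map_sum, map_mul, ← hc]
    rw [e]
    ring

theorem IsCellVector.regularPeriod_conj (h : IsCellVector 𝒲.toRepresentation ε v) (hε : ε ^ 2 = 1)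
    {ν : Measure Kˣ} [ν.IsHaarMeasure] (hν : ν {u : Kˣ | valuation K (u : K) = 1} = 1)
    (hψ : HasConductorIntegers ψ)
    (hW : ∀ W ∈ 𝒲.toSubmodule, ∀ (x : K) (g : PGL(2, K)), W (unip x * g) = ψ x * W g)
    {η : Kˣ →* ℂˣ} (hη : IsUnramified η) (s : ℂ) :
    regularPeriod ν (ε * (resCard K : ℂ)⁻¹) η
      (fun y => (starRingEnd ℂ) (torusRestriction 𝒲 v y)) s =
        (starRingEnd ℂ) ((v : PGL(2, K) → ℂ) 1) := by
  have e : (fun y => (starRingEnd ℂ) (torusRestriction 𝒲 v y)) = fun y : Kˣ =>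
      if 0 ≤ ord y then (starRingEnd ℂ) ((v : PGL(2, K) → ℂ) 1) *
        (ε * (resCard K : ℂ)⁻¹) ^ ord y else 0 := by
    rw [h.torusRestriction_eq hε hψ hW]
    ext y
    beta_reduce
    split_ifs
    · rw [map_mul, map_zpow₀, conj_beta hε]
    · exact map_zero _
  rw [e]
  exact regularPeriod_geometric hν (beta_ne_zero hε) _ hη s

/-- Since wv = -ε a(ϖ)v, its Kirillov function is -ε times the shift of that of v by ϖ, and the
shift multiplies the period by η(ϖ)q^s. -/
theorem IsCellVector.regularPeriod_conj_weyl (h : IsCellVector 𝒲.toRepresentation ε v)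
    (hε : ε ^ 2 = 1)
    {ν : Measure Kˣ} [ν.IsHaarMeasure] (hν : ν {u : Kˣ | valuation K (u : K) = 1} = 1)
    (hψ : HasConductorIntegers ψ)
    (hW : ∀ W ∈ 𝒲.toSubmodule, ∀ (x : K) (g : PGL(2, K)), W (unip x * g) = ψ x * W g)
    {η : Kˣ →* ℂˣ} (hη : IsUnramified η) (hη2 : η ^ 2 = 1) (s : ℂ) :
    regularPeriod ν (ε * (resCard K : ℂ)⁻¹) η
      (fun y => (starRingEnd ℂ) (torusRestriction 𝒲 (𝒲.toRepresentation (weyl K) v) y)) s =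
        -(ε * (η (unif K) : ℂ) * (resCard K : ℂ) ^ s *
          (starRingEnd ℂ) ((v : PGL(2, K) → ℂ) 1)) := by
  have e : (fun y => (starRingEnd ℂ) (torusRestriction 𝒲 (𝒲.toRepresentation (weyl K) v) y)) =
      (-ε) • fun y : Kˣ => (fun y => (starRingEnd ℂ) (torusRestriction 𝒲 v y)) (y * unif K) := by
    ext y
    rw [h.apply_weyl, Pi.smul_apply, map_neg, map_smul, Pi.neg_apply, Pi.smul_apply, map_neg,
      smul_eq_mul, smul_eq_mul, map_mul, conj_epsilon hε, neg_mul]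
    simp only [torusRestriction, LinearMap.coe_mk, AddHom.coe_mk, toRepresentation_apply, torus_mul]
  have e2 (f : Kˣ → ℂ) (a : ℂ) : regularPeriod ν (ε * (resCard K : ℂ)⁻¹) η (a • f) s =
      a * regularPeriod ν (ε * (resCard K : ℂ)⁻¹) η f s := by
    unfold regularPeriod
    rw [← integral_const_mul]
    congr 1
    ext y
    rw [euler_smul]
    ring
  rw [e, e2, regularPeriod_mul_unif _ (fun y => (starRingEnd ℂ) (torusRestriction 𝒲 v y)) hη2, h.regularPeriod_conj hε hν hψ hW hη]
  ring

end Character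

end

end LocalSpherical

/-! ### Comparison of constants. -/

theorem mainTheorem10 {K : Type*} [Field K] [ValuativeRel K] [TopologicalSpace K]
    [IsNonarchimedeanLocalField K]
    [MeasurableSpace Kˣ] [BorelSpace Kˣ] [MeasurableSpace PGL(2, K)] [BorelSpace PGL(2, K)]
    (ν : Measure Kˣ) [ν.IsHaarMeasure] (hν : ν {u : Kˣ | valuation K (u : K) = 1} = 1)
    (μ : Measure PGL(2, K)) [μ.IsHaarMeasure]
    (ψ : AddChar K Circle) (hψc : Continuous ψ) (hψ : LocalSpherical.HasConductorIntegers ψ)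
    (χ : Kˣ →* ℂˣ) (hχ : LocalSpherical.IsUnramified χ) (hχ2 : χ ^ 2 = 1)
    (η : Kˣ →* ℂˣ) (hη : LocalSpherical.IsUnramified η) (hη2 : η ^ 2 = 1)
    (𝒲 : Subrepresentation (LocalSpherical.rightTranslation K))
    (h𝒲 : LocalSpherical.IsWhittakerModel ψ (LocalSpherical.steinbergTwist χ hχ2) 𝒲)
    {ι : Type*} (b : Module.Basis ι ℂ 𝒲.toSubmodule)
    (hb : LocalSpherical.IsOrthogonalBasis ν
      (LocalSpherical.steinbergParam χ) b)
    (s₁ s₂ : ℂ) :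
    LocalSpherical.HasSphericalCharacter ν μ
        (LocalSpherical.steinbergParam χ) η b
        ((LocalSpherical.iwahori K).indicator 1) s₁ s₂
        ((μ (LocalSpherical.maxCompact K)).toReal * LocalSpherical.localZeta K 2 *
          (LocalSpherical.resCard K : ℂ)⁻¹) ∧
      LocalSpherical.HasSphericalCharacter ν μ
        (LocalSpherical.steinbergParam χ) η b
        ((LocalSpherical.iwahoriWeyl K).indicator 1) s₁ s₂
        ((μ (LocalSpherical.maxCompact K)).toReal * LocalSpherical.localZeta K 2 *
          ((LocalSpherical.steinbergParam χ).twist η).epsFactor (1 / 2) *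
          (LocalSpherical.resCard K : ℂ) ^ (s₁ - s₂ - 1)) := by
  obtain ⟨v, h⟩ := h𝒲.exists_isCellVector hχ
  have hW := h𝒲.equivariant
  have hε : (χ (LocalSpherical.unif K) : ℂ) ^ 2 = 1 := LocalSpherical.quadratic_sq hχ2 _
  have hself := h.torusPairing_self hε hν hψc hψ hW
  have hne := h.torusPairing_self_ne_zero hε hν hψc hψ hW
  have hq : (LocalSpherical.resCard K : ℂ) ≠ 0 := by
    exact_mod_cast (LocalSpherical.resCard_pos K).ne'
  have hq1 : (1 : ℝ) < LocalSpherical.resCard K := by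
    exact_mod_cast LocalSpherical.one_lt_resCard (K := K)
  have h1 : (1 - (LocalSpherical.resCard K : ℂ)⁻¹) ≠ 0 := by
    have : (1 - ((LocalSpherical.resCard K : ℝ))⁻¹) ≠ 0 :=
      (sub_pos.2 (inv_lt_one_of_one_lt₀ hq1)).ne'
    have := Complex.ofReal_ne_zero.2 this
    push_cast at this
    exact this
  have h2 : (1 + (LocalSpherical.resCard K : ℂ)⁻¹) ≠ 0 := by
    have : (1 + ((LocalSpherical.resCard K : ℝ))⁻¹) ≠ 0 := by positivity
    have := Complex.ofReal_ne_zero.2 this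
    push_cast at this
    exact this
  have hfac : (1 - (LocalSpherical.resCard K : ℂ)⁻¹ ^ 2) =
      (1 - (LocalSpherical.resCard K : ℂ)⁻¹) * (1 + (LocalSpherical.resCard K : ℂ)⁻¹) := by ring
  have hzeta : LocalSpherical.localZeta K 2 = (1 - (LocalSpherical.resCard K : ℂ)⁻¹ ^ 2)⁻¹ := by
    rw [LocalSpherical.localZeta, Complex.cpow_neg, inv_pow]
    norm_cast
  have hvol : ((μ (LocalSpherical.maxCompact K)).toReal : ℂ) =
      ((LocalSpherical.resCard K : ℂ) + 1) * ((μ (LocalSpherical.iwahori K)).toReal : ℂ) := by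
    rw [LocalSpherical.measure_maxCompact]
    push_cast
    rfl
  -- Both sides equal vol(Iw)/(1 - q⁻¹): on the left (q+1)q⁻¹ = 1 + q⁻¹ cancels against ζ(2), on the
  -- right |v(1)|² is (1 - q⁻²) times the squared norm of v, which is nonzero.
  have hvalue : ((μ (LocalSpherical.maxCompact K)).toReal : ℂ) * LocalSpherical.localZeta K 2 *
      (LocalSpherical.resCard K : ℂ)⁻¹ = ((μ (LocalSpherical.iwahori K)).toReal : ℂ) *
        ((v : PGL(2, K) → ℂ) 1 * (starRingEnd ℂ) ((v : PGL(2, K) → ℂ) 1)) /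
        ((1 - (LocalSpherical.resCard K : ℂ)⁻¹) * (1 - (LocalSpherical.resCard K : ℂ)⁻¹ ^ 2) *
          LocalSpherical.torusPairing ν (LocalSpherical.IsCellVector.torusRestriction 𝒲 v)
            (LocalSpherical.IsCellVector.torusRestriction 𝒲 v)) := by
    have e : (LocalSpherical.resCard K : ℂ) + 1 =
        LocalSpherical.resCard K * (1 + (LocalSpherical.resCard K : ℂ)⁻¹) := by
      field_simp
    rw [← hself, hvol, hzeta, hfac, e]
    field_simp
  constructor
  · have := LocalSpherical.hasSphericalCharacter_of_hecke hχ2 h hν μ hψc hψ hW hη hη2 b hb s₁ s₂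
      _ _ v (h.hecke_iwahori hε hν μ hψc hψ hW)
    rw [h.regularPeriod_conj hε hν hψ hW hη, mul_assoc _ ((v : PGL(2, K) → ℂ) 1), ← hvalue] at this
    exact this
  · have := LocalSpherical.hasSphericalCharacter_of_hecke hχ2 h hν μ hψc hψ hW hη hη2 b hb s₁ s₂
      _ _ _ (h.hecke_iwahoriWeyl hε hν μ hψc hψ hW)
    rw [h.regularPeriod_conj_weyl hε hν hψ hW hη hη2] at this
    -- Frobenius acts on V / ker N by χ(ϖ)η(ϖ)q^{1/2}, and q^{-1/2} at the central point cancels the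
    -- square root.
    have heps : ((LocalSpherical.steinbergParam χ).twist η).epsFactor (1 / 2) =
        -(χ (LocalSpherical.unif K) * η (LocalSpherical.unif K) : ℂ) := by
      have hs : ((√(LocalSpherical.resCard K : ℝ) : ℝ) : ℂ) ≠ 0 := by
        exact_mod_cast (Real.sqrt_pos.2 (by linarith)).ne'
      rw [((LocalSpherical.isSpecial_steinbergParam χ).twist η).epsFactor_eq,
        LocalSpherical.cpow_half]
      field_simp
    convert! this using 1
    rw [heps, Complex.cpow_sub _ _ hq, Complex.cpow_one]
    linear_combination (-(χ (LocalSpherical.unif K) * η (LocalSpherical.unif K) : ℂ) *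
      (LocalSpherical.resCard K : ℂ) ^ (s₁ - s₂)) * hvalue
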